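/- **Setting.** Let $K$ agents act at the times $t=1,\dots,n$. The state spaces $\mathbb X_t$, observation spaces $\mathbb Y_t^k$ and action spaces $\mathbb U_t^k$ are non-empty standard Borel spaces. The network is given by the law $S_1$ of $X_1$ and stochastic kernels $S_{t+1}(dx_{t+1}|x_t,u_t^{(K)})$, $Q_1^k(dy_1^k|x_1)$, $Q_{t+1}^k(dy_{t+1}^k|x_{t+1},u_t^{(K)})$; given the state and the previous actions, the observations of different agents are independent. Let $T\ge 1$ be the sharing delay. Put $\Delta_t=\{Y_s^j,U_s^j: s\le t-T,\ 1\le j\le K\}$ (shared data), $\Lambda_t^k=\{Y_s^k: t-T<s\le t\}\cup\{U_s^k: t-T<s<t\}$ (private data), $I_t^k=(\Delta_t,\Lambda_t^k)$. A strategy $\gamma^k$ of agent $k$ consists of measurable maps $U_t^k=\gamma_t^k(I_t^k)$; a profile $\gamma=(\gamma^1,\dots,\gamma^K)$ determines the joint law $\mathbb P^\gamma$. The running costs $\ell(t,x,u^{(K)})$ are real-valued, measurable and bounded from below, and all expectations are taken in $(-\infty,+\infty]$. Let $J_n(\gamma)=\mathbb E^\gamma\sum_{t=1}^n\ell(t,X_t,U_t^{(K)})$.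 A profile $\gamma^o$ is a *decentralized team equilibrium* if $J_n(\gamma^o)\le J_n(\gamma^k,\gamma^{-k,o})$ for all $k$ and all strategies $\gamma^k$ of agent $k$. Fix a profile $\gamma^o$. For each $k$ let $\xi_t^k[i]$ be the private posterior of $(X_t,\Lambda_t^{-k})$ given $I_t^k=i$, built recursively from $\gamma^{-k,o}$ alone by regular conditional laws: $\xi_1^k$ is the conditional law of $(X_1,\Lambda_1^{-k})$ given $I_1^k$; and $\xi_{t+1}^k$ is the conditional law of $(X_{t+1},\Lambda_{t+1}^{-k})$ given $Y_{t+1}^k$ and the data $Y_{t+1-T}^{-k},U_{t+1-T}^{-k}$ that become shared, when $(X_t,\Lambda_t^{-k})\sim\xi_t^k[i_t^k]$, $\Delta_t=\delta_t$, agent $k$ applies the action $u_t^k$ and the others use $\gamma_t^{-k,o}$. For a law $\xi$ of $(X_t,\Lambda_t^{-k})$ let $$P_{t+1}(dy_{t+1}^k,d\lambda_t^{-k},dx_t,dx_{t+1}|\xi,\delta_t,u)=Q_{t+1}^k(dy_{t+1}^k|x_{t+1},u,\gamma_t^{-k,o}(\delta_t,\lambda_t^{-k}))\,S_{t+1}(dx_{t+1}|x_t,u,\gamma_t^{-k,o}(\delta_t,\lambda_t^{-k}))\,\xi(dx_t,d\lambda_t^{-k}).$$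 Let $J_{t,n}^{\gamma^k,\gamma^{-k,o}}(i)$ be the expectation of $\sum_{j=t}^n\ell(j,X_j,U_j^{(K)})$ for the network started at time $t$ with $I_t^k=i$ and $(X_t,\Lambda_t^{-k})\sim\xi_t^k[i]$, and $\mathcal V_t^{\gamma^{k,o},\gamma^{-k,o}}(i)=\inf J_{t,n}^{\gamma^k,\gamma^{-k,o}}(i)$ over the strategies $\gamma^k$ that agree with $\gamma^{k,o}$ before $t$. For functions $W_1,\dots,W_n$ put $$G_t^W(\xi,i,u)=\int \ell(t,x_t,u,\gamma_t^{-k,o}(\delta_t,\lambda_t^{-k}))\,\xi(dx_t,d\lambda_t^{-k})+\int W_{t+1}(i,y_{t+1}^k,u,y_{t-T+1}^{-k},u_{t-T+1}^{-k})\,P_{t+1}(\cdot|\xi,\delta_t,u),$$ without the second term when $t=n$. The *DP equations* of agent $k$ are: $W_t$ is measurable and $W_t(i)=\inf_{u\in\mathbb U_t^k}G_t^W(\xi_t^k[i],i,u)$ for all $t\le n$ and all $i$. **Theorem.** Let $\gamma^o$ be any profile. (0) For every $k$, every strategy $\gamma^k$ and every $t$: $\xi_t^k$ does not depend on the strategy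 of agent $k$ and is a version of the conditional law of $(X_t,\Lambda_t^{-k})$ given $I_t^k$ under $\mathbb P^{\gamma^k,\gamma^{-k,o}}$; $J_{t,n}^{\gamma^k,\gamma^{-k,o}}(I_t^k)$ is a version of $\mathbb E^{\gamma^k,\gamma^{-k,o}}[\sum_{j\ge t}\ell(j,X_j,U_j^{(K)})|I_t^k]$; for $t<n$, $P_{t+1}(\cdot|\xi_t^k[i],\delta_t,u)$ is a version of the conditional law of $(Y_{t+1}^k,\Lambda_t^{-k},X_t,X_{t+1})$ given $I_t^k=i$, $U_t^k=u$ under $\mathbb P^{\gamma^k,\gamma^{-k,o}}$; and, for $t<n$, almost surely, for $\xi_t^k[I_t^k]$-almost every value of the unobserved quantities, $u_{t-T+1}^{-k}=\gamma_{t-T+1}^{-k,o}(\delta_{t-T+1},\lambda_{t-T+1}^{-k})$ when $t-T+1\ge1$, where all arguments except $y_{t-T+1}^{-k}$ are specified by $\delta_t$. (1.1) For every $k$, $\mathcal V_t^{\gamma^{k,o},\gamma^{-k,o}}=\mathcal V_t^{\gamma^{-k,o}}$ does not depend on $\gamma^{k,o}$. If the infima over $u$ of $G_t^{\mathcal V}(\xi_t^k[i],i,u)$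 are attained, for all $i$, at a measurable function of $i$ ($t\le n$), then $\mathcal V^{\gamma^{-k,o}}$ satisfies the DP equations of agent $k$; equivalently, $\mathcal V_n^{\gamma^{-k,o}}(i)=\inf_u\mathbb E^{\gamma^{-k,o}}\{\ell(n,X_n,u,\gamma_n^{-k,o})|i,u\}$ and $\mathcal V_t^{\gamma^{-k,o}}(i)=\inf_u\mathbb E^{\gamma^{-k,o}}\{\ell(t,X_t,u,\gamma_t^{-k,o})+\mathcal V_{t+1}^{\gamma^{-k,o}}(I_{t+1}^k)|i,u\}$ for $t<n$, the conditional expectations being integrals against $\xi_n^k[i]$ and $P_{t+1}(\cdot|\xi_t^k[i],\delta_t,u)$. (1.2) Let $\gamma^o$ be a decentralized team equilibrium, and suppose that for agent $k$ the infima over $u$ of $G_t^{\mathcal V}(\xi,i,u)$ are attained, for all probability measures $\xi$ and all $i$, at a measurable function of $(\xi,i)$. Then $\xi_{t+1}^k$ is a measurable function of $(\xi_t^k,\delta_t,u_t^k,y_{t+1}^k)$ and of the data $y_{t+1-T}^{-k},u_{t+1-T}^{-k}$ that become shared. There is a semi-separated strategy of agent $k$, $u_t^k=\varphi_t(\xi_t^k[i_t^k],\delta_t,\lambda_t^k)$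 for $t<n$ and $u_n^k=\varphi_n(\xi_n^k[i_n^k],\delta_n)$ with $\varphi_t$ measurable, that achieves the infima in the DP equations for all $i$, has cost-to-go $\mathcal V_t^{\gamma^{-k,o}}(i)$ for all $t$ and $i$, and has payoff $J_n(\gamma^o)$ against $\gamma^{-k,o}$. If $J_n(\gamma^o)<\infty$, then $\mathbb P^{\gamma^o}$-almost surely, for all $t$, $J_{t,n}^{\gamma^{o}}(I_t^k)=\mathcal V_t^{\gamma^{-k,o}}(I_t^k)$ and the action $\gamma_t^{k,o}(I_t^k)$ achieves the infimum in the DP equation. (2.1) If $W$ satisfies the DP equations of agent $k$, then $W_t(i)\le J_{t,n}^{\gamma^k,\gamma^{-k,o}}(i)$ for every strategy $\gamma^k$, every $t$ and every $i$ (in particular almost surely at $i=I_t^k$). (2.2) If for every $k$ there is a solution $W^k$ of the DP equations of agent $k$ such that $\gamma_t^{k,o}(i)$ achieves the infimum for all $t$ and $i$, then $\gamma^o$ is a decentralized team equilibrium, and $W_t^k(i)=J_{t,n}^{\gamma^{o}}(i)=\mathcal V_t^{\gamma^{-k,o}}(i)$ for all $k,t,i$. -/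

import Mathlib

open MeasureTheory ProbabilityTheory
open scoped ENNReal

set_option linter.unusedSectionVars false

noncomputable section

namespace DelayedSharing

/-! ### Extended expectation -/

/-- Expectation of an extended-real random variable, `E[f⁺] - E[f⁻]`.  It is the usual expectation
(possibly `+∞`) for every measurable `f` that is bounded from below. -/
def eint {α : Type*} [MeasurableSpace α] (μ : Measure α) (f : α → EReal) : EReal :=
  ((∫⁻ a, (f a).toENNReal ∂μ : ℝ≥0∞) : EReal) - ((∫⁻ a, (-f a).toENNReal ∂μ : ℝ≥0∞) : EReal)

/-- `J ∘ I` is a version of the conditional expectation `E[Z | I]` of an extended-real random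
variable `Z` that is bounded from below. -/
def IsCondExpectation {Ω β : Type*} [MeasurableSpace Ω] [MeasurableSpace β] (P : Measure Ω)
    (I : Ω → β) (Z : Ω → EReal) (J : β → EReal) : Prop :=
  Measurable J ∧ ∀ A : Set β, MeasurableSet A →
    eint P ((I ⁻¹' A).indicator Z) = eint P ((I ⁻¹' A).indicator (fun ω => J (I ω)))

/-! ### Product of finitely many stochastic kernels -/

/-- The kernel `a ↦ ∏ j, κ j (· | a)`. -/
def piKernel {ι α : Type*} [Fintype ι] [MeasurableSpace α] {β : ι → Type*}
    [∀ j, MeasurableSpace (β j)] (κ : ∀ j, Kernel α (β j)) [∀ j, IsMarkovKernel (κ j)] :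
    Kernel α (∀ j, β j) where
  toFun a := Measure.pi fun j => κ j a
  measurable' := by
    refine Measurable.measure_of_isPiSystem_of_isProbabilityMeasure
      generateFrom_pi.symm isPiSystem_pi ?_
    rintro _ ⟨s, hs, rfl⟩
    simp only [Measure.pi_pi]
    exact Finset.measurable_prod _ fun j _ => (κ j).measurable_coe (hs j (Set.mem_univ j))

instance {ι α : Type*} [Fintype ι] [MeasurableSpace α] {β : ι → Type*}
    [∀ j, MeasurableSpace (β j)] (κ : ∀ j, Kernel α (β j)) [∀ j, IsMarkovKernel (κ j)] :
    IsMarkovKernel (piKernel κ) :=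
  ⟨fun a => inferInstanceAs (IsProbabilityMeasure (Measure.pi fun j => κ j a))⟩

/-! ### Trajectories and the `T`-step delayed sharing information pattern

Times are numbered `0, 1, 2, …`; agents are the elements of the finite type `ι`. -/

section Patterns

variable {ι : Type*} (X : ℕ → Type*) (Y U : ℕ → ι → Type*) (T : ℕ)

/-- Trajectories of states, observations and actions. -/
abbrev Path := (∀ t, X t) × (∀ t j, Y t j) × (∀ t j, U t j)

/-- Values of the shared data `Δ_t = {Y_s^j, U_s^j : s ≤ t - T, all j}`. -/
abbrev Common (t : ℕ) := ∀ s : {s : ℕ // s + T ≤ t}, ∀ j, Y s j × U s j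

/-- Values of the private data `Λ_t^j = {Y_s^j : t - T < s ≤ t} ∪ {U_s^j : t - T < s < t}`. -/
abbrev Private (t : ℕ) (j : ι) :=
  (∀ s : {s : ℕ // s ≤ t ∧ t < s + T}, Y s j) × (∀ s : {s : ℕ // s < t ∧ t < s + T}, U s j)

/-- Values of the information `I_t^k = (Δ_t, Λ_t^k)` of agent `k`. -/
abbrev Info (t : ℕ) (k : ι) := Common Y U T t × Private Y U T t k

/-- Private data `Λ_t^{-k}` of all the agents other than `k`. -/
abbrev OthersPrivate (t : ℕ) (k : ι) := ∀ j : {j : ι // j ≠ k}, Private Y U T t j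

/-- Values of `(X_t, Λ_t^{-k})`, the quantities which agent `k` does not observe. -/
abbrev Hidden (t : ℕ) (k : ι) := X t × OthersPrivate Y U T t k

/-- What agent `k` learns between `t` and `t + 1`, besides its own action: its observation at
time `t + 1` and the data `Y_s^{-k}, U_s^{-k}`, `s = t + 1 - T`, that become shared. -/
abbrev NewData (t : ℕ) (k : ι) :=
  Y (t + 1) k × (∀ s : {s : ℕ // s + T = t + 1}, ∀ j : {j : ι // j ≠ k}, Y s j × U s j)

variable {X Y U}

def common (t : ℕ) (ω : Path X Y U) : Common Y U T t := fun s j => (ω.2.1 s j, ω.2.2 s j)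

def priv (t : ℕ) (j : ι) (ω : Path X Y U) : Private Y U T t j :=
  (fun s => ω.2.1 s j, fun s => ω.2.2 s j)

def info (t : ℕ) (k : ι) (ω : Path X Y U) : Info Y U T t k := (common T t ω, priv T t k ω)

def hidden (t : ℕ) (k : ι) (ω : Path X Y U) : Hidden X Y U T t k :=
  (ω.1 t, fun j => priv T t j.1 ω)

def newData (t : ℕ) (k : ι) (ω : Path X Y U) : NewData Y U T t k :=
  (ω.2.1 (t + 1) k, fun s j => (ω.2.1 s j, ω.2.2 s j))

section Fill

variable [∀ t, Nonempty (X t)] [∀ t j, Nonempty (Y t j)] [∀ t j, Nonempty (U t j)]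

/-- The trajectory with `X_t = x`, `Δ_t = δ`, `Λ_t = l`; all the other coordinates are
arbitrary (nothing below depends on them). -/
def fill (t : ℕ) (x : X t) (δ : Common Y U T t) (l : ∀ j, Private Y U T t j) : Path X Y U :=
  (Function.update (fun _ => Classical.arbitrary _) t x,
   fun s j => if h : s + T ≤ t then (δ ⟨s, h⟩ j).1
      else if h' : s ≤ t then (l j).1 ⟨s, h', not_le.mp h⟩ else Classical.arbitrary _,
   fun s j => if h : s + T ≤ t then (δ ⟨s, h⟩ j).2
      else if h' : s < t then (l j).2 ⟨s, h', not_le.mp h⟩ else Classical.arbitrary _)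

variable [DecidableEq ι]

/-- The trajectory determined up to time `t` by the information `i` of agent `k` and the value
`h` of what agent `k` does not observe. -/
def join (t : ℕ) (k : ι) (i : Info Y U T t k) (h : Hidden X Y U T t k) : Path X Y U :=
  fill T t h.1 i.1 ((Equiv.piSplitAt k fun j => Private Y U T t j).symm (i.2, h.2))

end Fill

/-- Replace the actions at time `t`. -/
def setAction (t : ℕ) (ω : Path X Y U) (a : ∀ j, U t j) : Path X Y U :=
  (ω.1, ω.2.1, Function.update ω.2.2 t a)

/-- Replace the state and the observations at time `t`. -/
def setState (t : ℕ) (ω : Path X Y U) (z : X t × ∀ j, Y t j) : Path X Y U :=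
  (Function.update ω.1 t z.1, Function.update ω.2.1 t z.2, ω.2.2)

/-- Replace the observation of agent `k` at time `t`. -/
def setObs [DecidableEq ι] (t : ℕ) (k : ι) (ω : Path X Y U) (y : Y t k) : Path X Y U :=
  (ω.1, Function.update ω.2.1 t (Function.update (ω.2.1 t) k y), ω.2.2)

end Patterns

/-! ### Strategies -/

section Strategies

variable {ι : Type*} (Y U : ℕ → ι → Type*) [∀ t j, MeasurableSpace (Y t j)]
  [∀ t j, MeasurableSpace (U t j)] (T : ℕ)

/-- Admissible strategies of agent `k`: a measurable function of `I_t^k` at every time `t`. -/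
abbrev Strategy (k : ι) := ∀ t, {g : Info Y U T t k → U t k // Measurable g}

/-- Strategy profiles `γ = (γ^j)_j`.  The profile `(γ^k, γ^{-k,o})` is
`Function.update γo k γk`. -/
abbrev Profile := ∀ k : ι, Strategy Y U T k

end Strategies

/-! ### The network -/

/-- A Markovian decentralized network: initial law and transition kernels of the state,
observation kernels of the agents, and a running cost that is bounded from below. -/
structure Network (ι : Type*) (X : ℕ → Type*) (Y U : ℕ → ι → Type*)
    [∀ t, MeasurableSpace (X t)] [∀ t j, MeasurableSpace (Y t j)]
    [∀ t j, MeasurableSpace (U t j)] where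
  /-- law of `X_0` -/
  S₀ : Measure (X 0)
  /-- law of `X_{t+1}` given `X_t` and the actions `U_t` -/
  S : ∀ t, Kernel (X t × ∀ j, U t j) (X (t + 1))
  /-- law of `Y_0^j` given `X_0` -/
  Q₀ : ∀ j, Kernel (X 0) (Y 0 j)
  /-- law of `Y_{t+1}^j` given `X_{t+1}` and the actions `U_t` -/
  Q : ∀ t j, Kernel (X (t + 1) × ∀ j, U t j) (Y (t + 1) j)
  /-- running cost at time `t` -/
  cost : ∀ t, X t → (∀ j, U t j) → ℝ
  prob_S₀ : IsProbabilityMeasure S₀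
  markov_S : ∀ t, IsMarkovKernel (S t)
  markov_Q₀ : ∀ j, IsMarkovKernel (Q₀ j)
  markov_Q : ∀ t j, IsMarkovKernel (Q t j)
  measurable_cost : ∀ t, Measurable fun p : X t × (∀ j, U t j) => cost t p.1 p.2
  cost_bddBelow : ∀ t, ∃ c : ℝ, ∀ x u, c ≤ cost t x u

attribute [instance] Network.prob_S₀ Network.markov_S Network.markov_Q₀ Network.markov_Q

section Model

variable {ι : Type*} [Fintype ι] [DecidableEq ι] {X : ℕ → Type*} {Y U : ℕ → ι → Type*}
  [∀ t, MeasurableSpace (X t)] [∀ t j, MeasurableSpace (Y t j)] [∀ t j, MeasurableSpace (U t j)]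
  [∀ t, Nonempty (X t)] [∀ t j, Nonempty (Y t j)] [∀ t j, Nonempty (U t j)]
  {T : ℕ}

/-- The actions at time `t` when agent `k` applies `u` and the others apply
`γ_t^{-k}(δ, λ^{-k})`. -/
def jointAction (γ : Profile Y U T) (k : ι) (t : ℕ) (δ : Common Y U T t)
    (l : OthersPrivate Y U T t k) (u : U t k) : ∀ j, U t j :=
  (Equiv.piSplitAt k (U t)).symm (u, fun j => (γ j t).1 (δ, l j))

/-- All agents act at time `t` according to `γ`. -/
def act (γ : Profile Y U T) (t : ℕ) (ω : Path X Y U) : Path X Y U :=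
  setAction t ω fun j => (γ j t).1 (info T t j ω)

/-- The trajectory up to the actions at time `t`, when `I_t^k = i`, `(X_t, Λ_t^{-k}) = h`, agent
`k` applies `u` and the others follow `γ^{-k}`. -/
def afterAction (γ : Profile Y U T) (k : ι) (t : ℕ) (i : Info Y U T t k)
    (h : Hidden X Y U T t k) (u : U t k) : Path X Y U :=
  setAction t (join T t k i h) (jointAction γ k t i.1 h.2 u)

/-- `I_{t+1}^k = (i, y_{t+1}^k, u_t^k, y_{t-T+1}^{-k}, u_{t-T+1}^{-k})`. -/
def nextInfo (γ : Profile Y U T) (k : ι) (t : ℕ) (i : Info Y U T t k)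
    (h : Hidden X Y U T t k) (u : U t k) (y : Y (t + 1) k) : Info Y U T (t + 1) k :=
  info T (t + 1) k (setObs (t + 1) k (afterAction γ k t i h u) y)

/-! Measurability of the maps above. -/

lemma measurable_piSplitAt_symm {β : ι → Type*} [∀ j, MeasurableSpace (β j)] (k : ι) :
    Measurable (Equiv.piSplitAt k β).symm := by
  refine measurable_pi_iff.mpr fun j => ?_
  by_cases h : j = k
  · subst h
    simpa [Equiv.piSplitAt] using measurable_fst
  · have : (fun x : β k × (∀ j : {j // j ≠ k}, β j) => (Equiv.piSplitAt k β).symm x j) =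
        fun x => x.2 ⟨j, h⟩ := by
      funext x; simp [Equiv.piSplitAt, h]
    rw [this]
    exact (measurable_pi_apply (⟨j, h⟩ : {j // j ≠ k})).comp measurable_snd

lemma measurable_info (t : ℕ) (k : ι) : Measurable (info T t k : Path X Y U → _) := by
  unfold info common priv; fun_prop

lemma measurable_hidden (t : ℕ) (k : ι) : Measurable (hidden T t k : Path X Y U → _) := by
  unfold hidden priv; fun_prop

lemma measurable_newData (t : ℕ) (k : ι) : Measurable (newData T t k : Path X Y U → _) := by
  unfold newData; fun_prop

lemma measurable_fill (t : ℕ) :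
    Measurable fun p : X t × Common Y U T t × (∀ j, Private Y U T t j) =>
      fill T t p.1 p.2.1 p.2.2 := by
  unfold fill
  refine Measurable.prodMk ((measurable_update _).comp measurable_fst) (Measurable.prodMk ?_ ?_)
  all_goals
    refine measurable_pi_iff.mpr fun s => measurable_pi_iff.mpr fun j => ?_
    by_cases h : s + T ≤ t
    · simp only [h, dite_true]; fun_prop
    · simp only [h, dite_false]
      split_ifs <;> fun_prop

lemma measurable_join (t : ℕ) (k : ι) :
    Measurable fun p : Info Y U T t k × Hidden X Y U T t k => join T t k p.1 p.2 := by
  have h : Measurable fun p : Info Y U T t k × Hidden X Y U T t k =>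
      (p.2.1, p.1.1, (Equiv.piSplitAt k fun j => Private Y U T t j).symm (p.1.2, p.2.2)) :=
    (by fun_prop : Measurable fun p : Info Y U T t k × Hidden X Y U T t k => p.2.1).prodMk
      ((by fun_prop : Measurable fun p : Info Y U T t k × Hidden X Y U T t k => p.1.1).prodMk
        ((measurable_piSplitAt_symm k).comp (by fun_prop)))
  exact (measurable_fill t).comp h

lemma measurable_setAction (t : ℕ) :
    Measurable fun p : Path X Y U × (∀ j, U t j) => setAction t p.1 p.2 := by
  unfold setAction
  exact (by fun_prop : Measurable fun p : Path X Y U × (∀ j, U t j) => p.1.1).prodMk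
    ((by fun_prop : Measurable fun p : Path X Y U × (∀ j, U t j) => p.1.2.1).prodMk
      (measurable_update'.comp
        (by fun_prop : Measurable fun p : Path X Y U × (∀ j, U t j) => (p.1.2.2, p.2))))

lemma measurable_setState (t : ℕ) :
    Measurable fun p : Path X Y U × (X t × ∀ j, Y t j) => setState t p.1 p.2 := by
  unfold setState
  exact (measurable_update'.comp
      (by fun_prop : Measurable fun p : Path X Y U × (X t × ∀ j, Y t j) => (p.1.1, p.2.1))).prodMk
    ((measurable_update'.comp
      (by fun_prop : Measurable fun p : Path X Y U × (X t × ∀ j, Y t j) =>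
        (p.1.2.1, p.2.2))).prodMk (by fun_prop))

lemma measurable_jointAction (γ : Profile Y U T) (k : ι) (t : ℕ) :
    Measurable fun p : Common Y U T t × OthersPrivate Y U T t k × U t k =>
      jointAction γ k t p.1 p.2.1 p.2.2 := by
  unfold jointAction
  refine (measurable_piSplitAt_symm k).comp (Measurable.prodMk (by fun_prop) ?_)
  exact measurable_pi_iff.mpr fun j => (γ j t).2.comp (by fun_prop)

lemma measurable_act (γ : Profile Y U T) (t : ℕ) :
    Measurable (act γ t : Path X Y U → Path X Y U) := by
  unfold act
  exact (measurable_setAction t).comp (measurable_id.prodMk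
    (measurable_pi_iff.mpr fun j => (γ j t).2.comp (measurable_info t j)))

/-- Parameters `(ξ, δ, u)`: a law of `(X_t, Λ_t^{-k})`, shared data, an action of agent `k`. -/
abbrev Belief (X : ℕ → Type*) (Y U : ℕ → ι → Type*)
    [∀ t, MeasurableSpace (X t)] [∀ t j, MeasurableSpace (Y t j)]
    [∀ t j, MeasurableSpace (U t j)] (T t : ℕ) (k : ι) :=
  ProbabilityMeasure (Hidden X Y U T t k) × Common Y U T t × U t k

/-- The kernel `(ξ, δ, u) ↦ ξ`. -/
def beliefKernel (t : ℕ) (k : ι) :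
    Kernel (Belief X Y U T t k) (Hidden X Y U T t k) where
  toFun p := (p.1 : Measure (Hidden X Y U T t k))
  measurable' := measurable_subtype_coe.comp measurable_fst

instance (t : ℕ) (k : ι) :
    IsMarkovKernel (beliefKernel t k : Kernel (Belief X Y U T t k) _) :=
  ⟨fun p => p.1.2⟩

/-- A trajectory that carries the information `i` of agent `k` at time `t`; the coordinates which
are not determined by `i` are arbitrary. -/
def ownPath (X : ℕ → Type*) [∀ t, Nonempty (X t)] (t : ℕ) (k : ι) (i : Info Y U T t k) :
    Path X Y U :=
  join T t k i (Classical.arbitrary _)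

lemma measurable_ownPath (t : ℕ) (k : ι) :
    Measurable (ownPath X t k : Info Y U T t k → Path X Y U) :=
  (measurable_join t k).comp (measurable_id.prodMk measurable_const)

/-- `I_t^k` as a function of `I_{t+1}^k`. -/
def prevInfo (X : ℕ → Type*) [∀ t, Nonempty (X t)] (t : ℕ) (k : ι) (i : Info Y U T (t + 1) k) :
    Info Y U T t k :=
  info T t k (ownPath X (t + 1) k i)

/-- `U_t^k` as a function of `I_{t+1}^k`. -/
def prevAction (X : ℕ → Type*) [∀ t, Nonempty (X t)] (t : ℕ) (k : ι)
    (i : Info Y U T (t + 1) k) : U t k :=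
  (ownPath X (t + 1) k i).2.2 t k

/-- The new data of agent `k` at time `t + 1` as a function of `I_{t+1}^k`. -/
def lastData (X : ℕ → Type*) [∀ t, Nonempty (X t)] (t : ℕ) (k : ι) (i : Info Y U T (t + 1) k) :
    NewData Y U T t k :=
  newData T t k (ownPath X (t + 1) k i)

/-! ### The law of the network under a strategy profile -/

namespace Network

variable (M : Network ι X Y U)

/-- Law of `X_0` and of the observations at time `0`, as a law on trajectories. -/
def initLaw : Measure (Path X Y U) :=
  (M.S₀ ⊗ₘ piKernel M.Q₀).map (setState 0 (Classical.arbitrary _))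

instance : IsProbabilityMeasure M.initLaw :=
  Measure.isProbabilityMeasure_map
    ((measurable_setState 0).comp (measurable_const.prodMk measurable_id)).aemeasurable

/-- Given the trajectory up to the actions at time `t`, draw `X_{t+1}` from
`S_{t+1}(· | X_t, U_t)` and then the observations from `∏_j Q_{t+1}^j(· | X_{t+1}, U_t)`. -/
def advance (t : ℕ) : Kernel (Path X Y U) (Path X Y U) :=
  (Kernel.id ×ₖ
    (((M.S t).comap (fun ω : Path X Y U => (ω.1 t, ω.2.2 t)) (by fun_prop)) ⊗ₖ
      ((piKernel (M.Q t)).comap (fun p : Path X Y U × X (t + 1) => (p.2, p.1.2.2 t))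
        (by fun_prop)))).map (fun p => setState (t + 1) p.1 p.2)

instance (t : ℕ) : IsMarkovKernel (M.advance t) :=
  Kernel.IsMarkovKernel.map _ (measurable_setState (t + 1))

/-- Evolution under the profile `γ` from time `t` (`X_t` and the observations at time `t`
already drawn) until the actions at time `t + m` are taken. -/
def run (γ : Profile Y U T) : ℕ → ℕ → Kernel (Path X Y U) (Path X Y U)
  | t, 0 => Kernel.deterministic (act γ t) (measurable_act γ t)
  | t, m + 1 => run γ (t + 1) m ∘ₖ
      (M.advance t ∘ₖ Kernel.deterministic (act γ t) (measurable_act γ t))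

instance (γ : Profile Y U T) (t m : ℕ) : IsMarkovKernel (M.run γ t m) := by
  induction m generalizing t with
  | zero => unfold run; infer_instance
  | succ m ih => unfold run; have := ih (t + 1); infer_instance

/-- The joint law `P^γ` of states, observations and actions at the times `0, …, N`. -/
def law (N : ℕ) (γ : Profile Y U T) : Measure (Path X Y U) := M.run γ 0 N ∘ₘ M.initLaw

instance (N : ℕ) (γ : Profile Y U T) : IsProbabilityMeasure (M.law N γ) := by
  unfold law; infer_instance

/-- Cost incurred at the times `t, …, N`. -/
def pathCost (N t : ℕ) (ω : Path X Y U) : EReal :=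
  ((∑ s ∈ Finset.Icc t N, M.cost s (ω.1 s) (ω.2.2 s) : ℝ) : EReal)

/-- The payoff `J_n(γ)`, for the horizon `0, …, N`, `n = N + 1`. -/
def payoff (N : ℕ) (γ : Profile Y U T) : EReal := eint (M.law N γ) (M.pathCost N 0)

/-- Decentralized sequential team equilibrium (person-by-person optimality). -/
def IsEquilibrium (N : ℕ) (γ : Profile Y U T) : Prop :=
  ∀ k, ∀ g : Strategy Y U T k, M.payoff N γ ≤ M.payoff N (Function.update γ k g)

/-! ### Private posterior -/

/-- Law of the trajectory up to the observations at time `t + 1` when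
`(X_t, Λ_t^{-k})` has law `ξ`, `Δ_t = δ`, agent `k` applies `u` and the others follow `γ^{-k}`.
(The private data of agent `k`, which do not matter here, are set to arbitrary values.) -/
def nextLaw (γ : Profile Y U T) (t : ℕ) (k : ι) : Kernel (Belief X Y U T t k) (Path X Y U) :=
  M.advance t ∘ₖ ((Kernel.id ×ₖ beliefKernel t k).map fun p =>
    setAction t (join T t k (p.1.2.1, Classical.arbitrary _) p.2)
      (jointAction γ k t p.1.2.1 p.2.2 p.1.2.2))

lemma measurable_nextLaw_aux (γ : Profile Y U T) (t : ℕ) (k : ι) :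
    Measurable fun p : Belief X Y U T t k × Hidden X Y U T t k =>
      setAction t (join T t k (p.1.2.1, Classical.arbitrary _) p.2)
        (jointAction γ k t p.1.2.1 p.2.2 p.1.2.2) := by
  refine (measurable_setAction t).comp (Measurable.prodMk ?_ ?_)
  · exact (measurable_join t k).comp (by fun_prop :
      Measurable fun p : Belief X Y U T t k × Hidden X Y U T t k =>
        (((p.1.2.1, Classical.arbitrary _) : Info Y U T t k), p.2))
  · exact (measurable_jointAction γ k t).comp (by fun_prop :
      Measurable fun p : Belief X Y U T t k × Hidden X Y U T t k => (p.1.2.1, p.2.2, p.1.2.2))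

instance (γ : Profile Y U T) (t : ℕ) (k : ι) : IsMarkovKernel (M.nextLaw γ t k) := by
  have := Kernel.IsMarkovKernel.map
    (Kernel.id ×ₖ (beliefKernel t k : Kernel (Belief X Y U T t k) (Hidden X Y U T t k)))
    (measurable_nextLaw_aux γ t k)
  unfold nextLaw
  infer_instance

/-- The transition law
`Q_{t+1}^k(dy | x', u, γ_t^{-k}(δ, λ^{-k})) S_{t+1}(dx' | x, u, γ_t^{-k}(δ, λ^{-k}))
ξ(dx, dλ^{-k})` of `((X_t, Λ_t^{-k}), X_{t+1}, Y_{t+1}^k)`, as a function of `(ξ, δ, u)`. -/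
def transition (γ : Profile Y U T) (t : ℕ) (k : ι) :
    Kernel (Belief X Y U T t k) (Hidden X Y U T t k × X (t + 1) × Y (t + 1) k) :=
  beliefKernel t k ⊗ₖ
    (((M.S t).comap (fun p : Belief X Y U T t k × Hidden X Y U T t k =>
        (p.2.1, jointAction γ k t p.1.2.1 p.2.2 p.1.2.2))
        (Measurable.prodMk (by fun_prop) ((measurable_jointAction γ k t).comp (by fun_prop :
          Measurable fun p : Belief X Y U T t k × Hidden X Y U T t k =>
            (p.1.2.1, p.2.2, p.1.2.2))))) ⊗ₖ
      ((M.Q t k).comap (fun p : (Belief X Y U T t k × Hidden X Y U T t k) × X (t + 1) =>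
        (p.2, jointAction γ k t p.1.1.2.1 p.1.2.2 p.1.1.2.2))
        (Measurable.prodMk (by fun_prop) ((measurable_jointAction γ k t).comp (by fun_prop :
          Measurable fun p : (Belief X Y U T t k × Hidden X Y U T t k) × X (t + 1) =>
            (p.1.1.2.1, p.1.2.2, p.1.1.2.2))))))

variable [∀ t, StandardBorelSpace (X t)] [∀ t j, StandardBorelSpace (Y t j)]
  [∀ t j, StandardBorelSpace (U t j)]

/-- One step of the posterior recursion: the conditional law of `(X_{t+1}, Λ_{t+1}^{-k})` given
the new data of agent `k`, under `nextLaw`. -/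
def filter (γ : Profile Y U T) (t : ℕ) (k : ι) :
    Kernel (Belief X Y U T t k × NewData Y U T t k) (Hidden X Y U T (t + 1) k) :=
  ((M.nextLaw γ t k).map fun ω => (newData T t k ω, hidden T (t + 1) k ω)).condKernel

instance (γ : Profile Y U T) (t : ℕ) (k : ι) : IsMarkovKernel (M.filter γ t k) := by
  unfold filter; infer_instance

/-- The private posterior `ξ_t^k[i] = P^{γ^{-k}}(dx_t, dλ_t^{-k} | I_t^k = i)`.  The actions of
agent `k` recorded in `i` enter as parameters; the strategy of agent `k` does not enter. -/
def posterior (γ : Profile Y U T) (k : ι) :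
    ∀ t, Info Y U T t k → ProbabilityMeasure (Hidden X Y U T t k)
  | 0, i => ⟨condDistrib (hidden T 0 k) (info T 0 k) M.initLaw i, inferInstance⟩
  | t + 1, i => ⟨M.filter γ t k
      ((posterior γ k t (prevInfo X t k i), (prevInfo X t k i).1, prevAction X t k i),
        lastData X t k i), inferInstance⟩

lemma measurable_posterior (γ : Profile Y U T) (k : ι) (t : ℕ) :
    Measurable (M.posterior γ k t) := by
  induction t with
  | zero =>
    exact Measurable.subtype_mk (condDistrib (hidden T 0 k) (info T 0 k) M.initLaw).measurable
  | succ t ih =>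
    have h1 : Measurable (prevInfo X t k : Info Y U T (t + 1) k → _) :=
      (measurable_info t k).comp (measurable_ownPath (t + 1) k)
    have h2 : Measurable (prevAction X t k : Info Y U T (t + 1) k → _) :=
      (by fun_prop : Measurable fun ω : Path X Y U => ω.2.2 t k).comp
        (measurable_ownPath (t + 1) k)
    have h3 : Measurable (lastData X t k : Info Y U T (t + 1) k → _) :=
      (measurable_newData t k).comp (measurable_ownPath (t + 1) k)
    exact Measurable.subtype_mk ((M.filter γ t k).measurable.comp
      (((ih.comp h1).prodMk ((measurable_fst.comp h1).prodMk h2)).prodMk h3))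

/-- The private posterior as a stochastic kernel. -/
def posteriorKernel (γ : Profile Y U T) (k : ι) (t : ℕ) :
    Kernel (Info Y U T t k) (Hidden X Y U T t k) where
  toFun i := (M.posterior γ k t i : Measure (Hidden X Y U T t k))
  measurable' := measurable_subtype_coe.comp (M.measurable_posterior γ k t)

/-- The transition law with `ξ = ξ_t^k[i]`, as a kernel from `(i, u)`. -/
def infoTransition (γ : Profile Y U T) (k : ι) (t : ℕ) :
    Kernel (Info Y U T t k × U t k) (Hidden X Y U T t k × X (t + 1) × Y (t + 1) k) :=
  (M.transition γ t k).comap (fun p => (M.posterior γ k t p.1, p.1.1, p.2))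
    (((M.measurable_posterior γ k t).comp measurable_fst).prodMk (by fun_prop))

/-- The private posterior is conditionally Markov: the next posterior is a measurable function
of the present posterior, the shared data, the action of agent `k`, its new observation and the
data of the other agents that become shared. -/
def IsConditionallyMarkov (γ : Profile Y U T) (k : ι) : Prop :=
  ∀ t, ∃ F : Belief X Y U T t k × NewData Y U T t k →
      ProbabilityMeasure (Hidden X Y U T (t + 1) k), Measurable F ∧
    ∀ i : Info Y U T (t + 1) k, M.posterior γ k (t + 1) i =
      F ((M.posterior γ k t (prevInfo X t k i), (prevInfo X t k i).1, prevAction X t k i),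
        lastData X t k i)

/-! ### Cost-to-go and value process -/

/-- Conditional law of the network given `I_t^k = i`, when the profile `γ` is used from time `t`
on. -/
def condLaw (N : ℕ) (γ : Profile Y U T) (k : ι) (t : ℕ) (i : Info Y U T t k) :
    Measure (Path X Y U) :=
  M.run γ t (N - t) ∘ₘ
    ((M.posterior γ k t i : Measure (Hidden X Y U T t k)).map (join T t k i))

/-- Cost-to-go `J_{t,n}^γ(i) = E^γ[∑_{s ≥ t} ℓ(s, X_s, U_s) | I_t^k = i]`. -/
def costToGo (N : ℕ) (γ : Profile Y U T) (k : ι) (t : ℕ) (i : Info Y U T t k) : EReal :=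
  eint (M.condLaw N γ k t i) (M.pathCost N t)

/-- Value process `𝒱_t^{γ^k, γ^{-k}}(i)`: infimum of the cost-to-go over the strategies of agent
`k` which use `γ^k` before time `t`. -/
def value (N : ℕ) (γ : Profile Y U T) (k : ι) (t : ℕ) (i : Info Y U T t k) : EReal :=
  ⨅ g : {g : Strategy Y U T k // ∀ s < t, g s = γ k s},
    M.costToGo N (Function.update γ k g.1) k t i

/-! ### Dynamic programming equations -/

/-- The running cost `ℓ(t, x_t, u, γ_t^{-k}(δ_t, λ_t^{-k}))`. -/
def actionCost (γ : Profile Y U T) (k : ι) (t : ℕ) (i : Info Y U T t k) (u : U t k)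
    (h : Hidden X Y U T t k) : EReal :=
  (M.cost t h.1 (jointAction γ k t i.1 h.2 u) : EReal)

/-- The term that is minimized in the dynamic programming equation,
`∫ ℓ(t, x_t, u, γ_t^{-k}(δ, λ^{-k})) ξ(dx_t, dλ^{-k})
  + ∫ W_{t+1}(i, y_{t+1}^k, u, y_{t-T+1}^{-k}, u_{t-T+1}^{-k}) P(dy_{t+1}^k, dλ^{-k}, dx_t, dx_{t+1} | ξ, δ, u)`,
where the second summand is absent at the last time `t = N`. -/
def dpCost (N : ℕ) (γ : Profile Y U T) (k : ι) (W : ∀ t, Info Y U T t k → EReal) (t : ℕ)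
    (ξ : ProbabilityMeasure (Hidden X Y U T t k)) (i : Info Y U T t k) (u : U t k) : EReal :=
  eint (ξ : Measure (Hidden X Y U T t k)) (M.actionCost γ k t i u) +
    if t < N then eint (M.transition γ t k (ξ, i.1, u))
      (fun z => W (t + 1) (nextInfo γ k t i z.1 u z.2.2)) else 0

/-- `W` solves the dynamic programming equations of agent `k` against `γ^{-k}`. -/
def IsDPSolution (N : ℕ) (γ : Profile Y U T) (k : ι) (W : ∀ t, Info Y U T t k → EReal) : Prop :=
  ∀ t ≤ N, Measurable (W t) ∧
    ∀ i, W t i = ⨅ u : U t k, M.dpCost N γ k W t (M.posterior γ k t i) i u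

/-- The strategy `g` achieves the infimum in the dynamic programming equations. -/
def IsMinimizer (N : ℕ) (γ : Profile Y U T) (k : ι) (W : ∀ t, Info Y U T t k → EReal)
    (g : Strategy Y U T k) : Prop :=
  ∀ t ≤ N, ∀ i, M.dpCost N γ k W t (M.posterior γ k t i) i ((g t).1 i) =
    ⨅ u : U t k, M.dpCost N γ k W t (M.posterior γ k t i) i u

/-- Measurable selectors: the minimum over the actions is attained, for all `(ξ, i)`, at a
measurable function of `(ξ, i)`. -/
def HasSelectors (N : ℕ) (γ : Profile Y U T) (k : ι) (W : ∀ t, Info Y U T t k → EReal) : Prop :=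
  ∀ t ≤ N, ∃ σ : ProbabilityMeasure (Hidden X Y U T t k) × Info Y U T t k → U t k,
    Measurable σ ∧ ∀ ξ i, M.dpCost N γ k W t ξ i (σ (ξ, i)) =
      ⨅ u : U t k, M.dpCost N γ k W t ξ i u

/-- Semi-separated strategies: `u_t^k = φ_t(ξ_t^k[i], δ_t, λ_t^k)` for `t < N`, and
`u_N^k = φ_N(ξ_N^k[i], δ_N)` at the last time. -/
def IsSemiSeparated (N : ℕ) (γ : Profile Y U T) (k : ι) (g : Strategy Y U T k) : Prop :=
  (∀ t < N, ∃ φ : ProbabilityMeasure (Hidden X Y U T t k) × Common Y U T t × Private Y U T t k →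
      U t k, Measurable φ ∧ ∀ i, (g t).1 i = φ (M.posterior γ k t i, i.1, i.2)) ∧
  ∃ φ : ProbabilityMeasure (Hidden X Y U T N k) × Common Y U T N → U N k,
    Measurable φ ∧ ∀ i, (g N).1 i = φ (M.posterior γ k N i, i.1)

end Network

end Model

end DelayedSharing

end

open DelayedSharing

/-! Once the strategies of the other agents are frozen, agent `k` faces a one-person control problem
with hidden state `(X_t, Λ_t^{-k})` and observed information `I_t^k`. Two facts make it tractable.
Since `T ≥ 1`, each action at time `t` is a function of data recorded in `(I_t^k, X_t, Λ_t^{-k})`,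
and the noise depends only on the present state and actions; hence this pair carries everything that
the future and its costs can see (`agree_join`, `lintegral_run_congr`, `pathCostToGo_congr`).
Moreover, the action of agent `k` enters a step only through its value, so it can be treated as a
parameter `u` (`act_join`).

The posterior recursion uses recorded actions only, so its independence of the strategy of agent `k`
is immediate; the content is that it gives the correct conditional law under every strategy. The
core is a one-step Bayes rule valid for every `(i, u)`, not merely almost every one
(`lintegral_stepLaw_posterior`). It rests on the disintegration of a kernel at each parameter and on
the equivalence of `I_{t+1}^k` with `I_t^k`, the action and the new data. Induction on time then
gives the disintegration of the network law (`lintegral_preLaw_posterior`), and uniqueness of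
conditional laws gives the statements about `condDistrib`.

The same pointwise rule shows that the cost-to-go of any strategy satisfies the dynamic programming
recursion without the infimum, for every `i` (`costToGo_eq_dpCost`). The verification statements
follow by backward induction from monotonicity of `dpCost`. The value process needs no measurable
selection theorem: it equals the cost-to-go of the assumed minimizer, which also makes it measurable
(`IsMinimizer.costToGo_eq_value`).

For an equilibrium with finite payoff, the expected cost-to-go at the initial time equals the
expected value although it dominates the value pointwise, so the two agree almost surely. Cancelling
the finite running cost propagates this equality forward along trajectories
(`IsMinimizer.ae_stepLaw_costToGo_eq_value`). All expectations are reduced to Lebesgue integrals by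
adding a constant that makes the integrand nonnegative. -/

noncomputable section

namespace DelayedSharing

/-! ### Extended expectation of functions that are bounded from below -/

open scoped NNReal

section ExtendedExpectation

variable {α β : Type*} [MeasurableSpace α] [MeasurableSpace β]

/-- Measurable extended-real functions which are bounded from below by a real number. -/
structure IsLowerBounded (f : α → EReal) : Prop where
  measurable : Measurable f
  exists_bound : ∃ c : ℝ≥0, ∀ a, -((c : ℝ) : EReal) ≤ f a

lemma add_nonneg_of_neg_le {c : ℝ≥0} {x : EReal} (h : -((c : ℝ) : EReal) ≤ x) :
    0 ≤ x + ((c : ℝ) : EReal) := by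
  induction x with
  | bot => simp at h
  | top => simp
  | coe x =>
    have h' : -(c : ℝ) ≤ x := by exact_mod_cast h
    have : (0 : ℝ) ≤ x + c := by linarith
    exact_mod_cast this

/-- This is `x + c = x⁺ - x⁻ + c` rearranged without subtraction, so that both sides can be
integrated in `ℝ≥0∞`. -/
lemma toENNReal_add_toENNReal_neg {c : ℝ≥0} {x : EReal} (h : -((c : ℝ) : EReal) ≤ x) :
    (x + ((c : ℝ) : EReal)).toENNReal + (-x).toENNReal = x.toENNReal + c := by
  induction x with
  | bot => simp at h
  | top => simp
  | coe x =>
    have h' : -(c : ℝ) ≤ x := by exact_mod_cast h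
    have e1 : ((x : EReal) + ((c : ℝ) : EReal)).toENNReal = ENNReal.ofReal (x + c) := by
      rw [← EReal.real_coe_toENNReal]; rfl
    have e2 : (-(x : EReal)).toENNReal = ENNReal.ofReal (-x) := by
      rw [← EReal.real_coe_toENNReal]; rfl
    rw [e1, e2, EReal.real_coe_toENNReal]
    have e3 : ENNReal.ofReal c = c := ENNReal.ofReal_coe_nnreal
    rw [← e3]
    rcases le_total 0 x with hx | hx
    · rw [ENNReal.ofReal_of_nonpos (by linarith : -x ≤ 0), add_zero,
        ← ENNReal.ofReal_add hx (NNReal.coe_nonneg c)]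
    · rw [ENNReal.ofReal_of_nonpos hx, zero_add, ← ENNReal.ofReal_add (by linarith) (by linarith)]
      congr 1; ring

/-- Only `q` has to be finite: if `p = ∞` then `a = ∞`, and both differences are `⊤`. -/
lemma coe_sub_coe_eq_of_add_eq {a p q : ℝ≥0∞} {c : ℝ≥0} (hq : q ≠ ∞) (h : a + q = p + c) :
    (p : EReal) - (q : EReal) = (a : EReal) - ((c : ℝ) : EReal) := by
  lift q to ℝ≥0 using hq
  rcases eq_or_ne p ∞ with rfl | hp
  · have ha : a = ∞ := by
      by_contra ha
      exact ENNReal.add_ne_top.mpr ⟨ha, ENNReal.coe_ne_top⟩ (by rw [h]; simp)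
    subst ha
    rfl
  · have ha : a ≠ ∞ := by
      rintro rfl
      exact ENNReal.add_ne_top.mpr ⟨hp, ENNReal.coe_ne_top⟩ (by rw [← h]; simp)
    lift p to ℝ≥0 using hp
    lift a to ℝ≥0 using ha
    have h' : (a : ℝ) + q = p + c := by exact_mod_cast h
    have : (p : ℝ) - q = a - c := by linarith
    have h'' : ((p : ℝ) : EReal) - ((q : ℝ) : EReal) = ((a : ℝ) : EReal) - ((c : ℝ) : EReal) := by
      exact_mod_cast congrArg Real.toEReal this
    exact h''

/-- The working form of `eint`: a single integral of a nonnegative function, to which Tonelli and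
the equality case of monotonicity apply. The negative part is at most `c`, hence has finite
integral, and total mass one makes the shift integrate to `c`. -/
lemma eint_eq_lintegral_sub (μ : Measure α) [IsProbabilityMeasure μ] {f : α → EReal}
    (hf : Measurable f) {c : ℝ≥0} (hc : ∀ a, -((c : ℝ) : EReal) ≤ f a) :
    eint μ f = ((∫⁻ a, (f a + ((c : ℝ) : EReal)).toENNReal ∂μ : ℝ≥0∞) : EReal)
      - ((c : ℝ) : EReal) := by
  have hneg : Measurable fun a => (-f a).toENNReal := (hf.neg).ereal_toENNReal
  refine coe_sub_coe_eq_of_add_eq ?_ ?_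
  · refine ne_top_of_le_ne_top (ENNReal.coe_ne_top (r := c)) ?_
    calc ∫⁻ a, (-f a).toENNReal ∂μ ≤ ∫⁻ _, (c : ℝ≥0∞) ∂μ := by
          refine lintegral_mono fun a => ?_
          calc (-f a).toENNReal ≤ ((c : ℝ) : EReal).toENNReal :=
                EReal.toENNReal_le_toENNReal (EReal.neg_le.mp (hc a))
            _ = c := by rw [EReal.real_coe_toENNReal, ENNReal.ofReal_coe_nnreal]
      _ = c := by simp
  · rw [← lintegral_add_right _ hneg]
    calc ∫⁻ a, ((f a + ((c : ℝ) : EReal)).toENNReal + (-f a).toENNReal) ∂μ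
        = ∫⁻ a, ((f a).toENNReal + c) ∂μ :=
          lintegral_congr fun a => toENNReal_add_toENNReal_neg (hc a)
      _ = _ := by rw [lintegral_add_right _ measurable_const]; simp

lemma sub_add_cancel_coe (x : EReal) (c : ℝ≥0) :
    x - ((c : ℝ) : EReal) + ((c : ℝ) : EReal) = x :=
  EReal.sub_add_cancel (a := x) (b := (c : ℝ))

lemma eint_add_eq_lintegral (μ : Measure α) [IsProbabilityMeasure μ] {f : α → EReal}
    (hf : Measurable f) {c : ℝ≥0} (hc : ∀ a, -((c : ℝ) : EReal) ≤ f a) :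
    eint μ f + ((c : ℝ) : EReal)
      = ((∫⁻ a, (f a + ((c : ℝ) : EReal)).toENNReal ∂μ : ℝ≥0∞) : EReal) := by
  rw [eint_eq_lintegral_sub μ hf hc, sub_add_cancel_coe]

lemma eint_mono (μ : Measure α) {f g : α → EReal} (h : ∀ a, f a ≤ g a) :
    eint μ f ≤ eint μ g := by
  refine EReal.sub_le_sub ?_ ?_
  · exact EReal.coe_ennreal_le_coe_ennreal_iff.mpr
      (lintegral_mono fun a => EReal.toENNReal_le_toENNReal (h a))
  · exact EReal.coe_ennreal_le_coe_ennreal_iff.mpr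
      (lintegral_mono fun a => EReal.toENNReal_le_toENNReal (EReal.neg_le_neg_iff.mpr (h a)))

lemma eint_congr_ae {μ : Measure α} {f g : α → EReal} (h : f =ᵐ[μ] g) :
    eint μ f = eint μ g := by
  unfold eint
  congr 2 <;> refine lintegral_congr_ae ?_
  · filter_upwards [h] with a ha using by rw [ha]
  · filter_upwards [h] with a ha using by rw [ha]

lemma eint_map {μ : Measure α} {g : α → β} (hg : Measurable g) {f : β → EReal}
    (hf : Measurable f) : eint (μ.map g) f = eint μ (fun a => f (g a)) := by
  unfold eint
  rw [lintegral_map hf.ereal_toENNReal hg, lintegral_map (show Measurable fun a => (-f a).toENNReal from hf.neg.ereal_toENNReal) hg]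

lemma eint_dirac (a : α) {f : α → EReal} (hf : Measurable f) :
    eint (Measure.dirac a) f = f a := by
  unfold eint
  rw [lintegral_dirac' _ hf.ereal_toENNReal, lintegral_dirac' _ (show Measurable fun a => (-f a).toENNReal from hf.neg.ereal_toENNReal)]
  rcases le_total 0 (f a) with h | h
  · rw [EReal.coe_toENNReal h, EReal.toENNReal_of_nonpos (by simpa using h)]; simp
  · rw [EReal.toENNReal_of_nonpos h, EReal.coe_toENNReal (by simpa using h)]; simp

lemma eint_zero (μ : Measure α) : eint μ (fun _ => 0) = 0 := by simp [eint]

lemma eint_const (μ : Measure α) [IsProbabilityMeasure μ] (x : EReal) :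
    eint μ (fun _ => x) = x := by
  -- The positive and negative parts of a constant have the same integrals under every probability
  -- measure, so the Dirac mass on a point, where the signs have been dealt with, is enough.
  have h := eint_dirac () (f := fun _ : Unit => x) measurable_const
  simpa [eint] using h

lemma neg_le_eint (μ : Measure α) [IsProbabilityMeasure μ] {f : α → EReal} {c : ℝ≥0}
    (hc : ∀ a, -((c : ℝ) : EReal) ≤ f a) : -((c : ℝ) : EReal) ≤ eint μ f := by
  calc -((c : ℝ) : EReal) = eint μ (fun _ => -((c : ℝ) : EReal)) := (eint_const μ _).symm
    _ ≤ eint μ f := eint_mono μ hc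

namespace IsLowerBounded

lemma measurable_shift {f : α → EReal} (hf : IsLowerBounded f) (c : ℝ≥0) :
    Measurable fun a => (f a + ((c : ℝ) : EReal)).toENNReal :=
  (hf.measurable.add measurable_const).ereal_toENNReal

lemma add {f g : α → EReal} (hf : IsLowerBounded f) (hg : IsLowerBounded g) :
    IsLowerBounded fun a => f a + g a := by
  obtain ⟨c, hc⟩ := hf.exists_bound
  obtain ⟨d, hd⟩ := hg.exists_bound
  refine ⟨hf.measurable.add hg.measurable, c + d, fun a => ?_⟩
  calc -(((c + d : ℝ≥0) : ℝ) : EReal)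
      = -((c : ℝ) : EReal) + -((d : ℝ) : EReal) := by
        have : -((c : ℝ) + d) = -(c : ℝ) + -(d : ℝ) := by ring
        exact_mod_cast congrArg Real.toEReal this
    _ ≤ _ := add_le_add (hc a) (hd a)

lemma comp {f : β → EReal} (hf : IsLowerBounded f) {g : α → β} (hg : Measurable g) :
    IsLowerBounded fun a => f (g a) :=
  ⟨hf.measurable.comp hg, hf.exists_bound.imp fun _ hc a => hc (g a)⟩

lemma indicator {f : α → EReal} (hf : IsLowerBounded f) {s : Set α} (hs : MeasurableSet s) :
    IsLowerBounded (s.indicator f) := by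
  refine ⟨hf.measurable.indicator hs, hf.exists_bound.imp fun c hc a => ?_⟩
  by_cases h : a ∈ s
  · simpa [h] using hc a
  · rw [Set.indicator_of_notMem h, EReal.neg_le, neg_zero]
    exact_mod_cast c.2

/-- Closure under integration against a kernel makes iterated expectations meaningful. The bound `c`
survives unchanged because the kernel has mass one. -/
lemma eint {κ : Kernel α β} [IsMarkovKernel κ] {f : α × β → EReal} (hf : IsLowerBounded f) :
    IsLowerBounded fun a => eint (κ a) fun b => f (a, b) := by
  obtain ⟨c, hc⟩ := hf.exists_bound
  refine ⟨?_, c, fun a => neg_le_eint _ fun b => hc (a, b)⟩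
  have : (fun a => DelayedSharing.eint (κ a) fun b => f (a, b)) = fun a =>
      ((∫⁻ b, (f (a, b) + ((c : ℝ) : EReal)).toENNReal ∂κ a : ℝ≥0∞) : EReal)
        + -((c : ℝ) : EReal) := by
    funext a
    exact eint_eq_lintegral_sub _ (hf.measurable.comp measurable_prodMk_left)
      fun b => hc (a, b)
  rw [this]
  exact ((hf.measurable_shift c).lintegral_kernel_prod_right').coe_ereal_ennreal.add measurable_const

end IsLowerBounded

/-- The lower bounds exclude `∞ - ∞`: after the shifts by `c` and `d` this is additivity of the
Lebesgue integral. -/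
lemma eint_add {μ : Measure α} [IsProbabilityMeasure μ] {f g : α → EReal}
    (hf : IsLowerBounded f) (hg : IsLowerBounded g) :
    eint μ (fun a => f a + g a) = eint μ f + eint μ g := by
  obtain ⟨c, hc⟩ := hf.exists_bound
  obtain ⟨d, hd⟩ := hg.exists_bound
  have hcd : ∀ a, -(((c + d : ℝ≥0) : ℝ) : EReal) ≤ f a + g a := fun a => by
    refine le_trans (le_of_eq ?_) (add_le_add (hc a) (hd a))
    have : -((c : ℝ) + d) = -(c : ℝ) + -(d : ℝ) := by ring
    exact_mod_cast congrArg Real.toEReal this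
  rw [eint_eq_lintegral_sub μ (hf.add hg).measurable hcd,
    eint_eq_lintegral_sub μ hf.measurable hc, eint_eq_lintegral_sub μ hg.measurable hd]
  have hsum : ∀ a, (f a + g a + (((c + d : ℝ≥0) : ℝ) : EReal)).toENNReal =
      (f a + ((c : ℝ) : EReal)).toENNReal + (g a + ((d : ℝ) : EReal)).toENNReal := by
    intro a
    rw [← EReal.toENNReal_add (add_nonneg_of_neg_le (hc a)) (add_nonneg_of_neg_le (hd a))]
    congr 1
    rw [NNReal.coe_add, EReal.coe_add, add_add_add_comm]
  simp_rw [hsum]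
  rw [lintegral_add_left (hf.measurable_shift c)]
  generalize ∫⁻ a, (f a + ((c : ℝ) : EReal)).toENNReal ∂μ = x
  generalize ∫⁻ a, (g a + ((d : ℝ) : EReal)).toENNReal ∂μ = y
  rw [sub_eq_add_neg, sub_eq_add_neg, sub_eq_add_neg, EReal.coe_ennreal_add, add_add_add_comm]
  congr 1
  have : -((c : ℝ) + d) = -(c : ℝ) + -(d : ℝ) := by ring
  exact_mod_cast congrArg Real.toEReal this

/-- The inner expectation has the same lower bound as `f`, so a single shift serves both integrals
and the claim becomes Tonelli. -/
lemma eint_comp {μ : Measure α} [IsProbabilityMeasure μ] {κ : Kernel α β} [IsMarkovKernel κ]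
    {f : β → EReal} (hf : IsLowerBounded f) :
    eint (κ ∘ₘ μ) f = eint μ fun a => eint (κ a) f := by
  obtain ⟨c, hc⟩ := hf.exists_bound
  have hE : IsLowerBounded fun a => eint (κ a) f :=
    (hf.comp measurable_snd : IsLowerBounded fun p : α × β => f p.2).eint
  rw [eint_eq_lintegral_sub _ hf.measurable hc,
    eint_eq_lintegral_sub _ hE.measurable (c := c) (fun a => neg_le_eint _ hc),
    Measure.lintegral_bind κ.aemeasurable (hf.measurable_shift c).aemeasurable]
  simp_rw [eint_add_eq_lintegral _ hf.measurable hc, EReal.toENNReal_coe]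

lemma eint_compProd {μ : Measure α} [IsProbabilityMeasure μ] {κ : Kernel α β} [IsMarkovKernel κ]
    {f : α × β → EReal} (hf : IsLowerBounded f) :
    eint (μ ⊗ₘ κ) f = eint μ fun a => eint (κ a) fun b => f (a, b) := by
  obtain ⟨c, hc⟩ := hf.exists_bound
  have hE : IsLowerBounded fun a => eint (κ a) fun b => f (a, b) := hf.eint
  rw [eint_eq_lintegral_sub _ hf.measurable hc,
    eint_eq_lintegral_sub _ hE.measurable (c := c) (fun a => neg_le_eint _ fun b => hc (a, b)),
    Measure.lintegral_compProd (hf.measurable_shift c)]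
  congr 2
  refine lintegral_congr fun a => ?_
  rw [eint_add_eq_lintegral (κ a) (f := fun b => f (a, b))
    (hf.measurable.comp measurable_prodMk_left) fun b => hc (a, b), EReal.toENNReal_coe]

/-- The equality case of monotonicity. Finiteness is essential: two different functions may both
have expectation `⊤`. -/
lemma ae_eq_of_eint_le {μ : Measure α} [IsProbabilityMeasure μ] {f g : α → EReal}
    (hf : IsLowerBounded f) (hg : IsLowerBounded g) (hfg : ∀ a, f a ≤ g a)
    (hle : eint μ g ≤ eint μ f) (htop : eint μ f < ⊤) : f =ᵐ[μ] g := by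
  obtain ⟨c, hc⟩ := hf.exists_bound
  have hc' : ∀ a, -((c : ℝ) : EReal) ≤ g a := fun a => (hc a).trans (hfg a)
  have hF := eint_add_eq_lintegral μ hf.measurable hc
  have hG := eint_add_eq_lintegral μ hg.measurable hc'
  have h1 : ∫⁻ a, (g a + ((c : ℝ) : EReal)).toENNReal ∂μ ≤
      ∫⁻ a, (f a + ((c : ℝ) : EReal)).toENNReal ∂μ := by
    rw [← EReal.coe_ennreal_le_coe_ennreal_iff, ← hF, ← hG]
    exact add_le_add_left hle _
  have h2 : ∫⁻ a, (f a + ((c : ℝ) : EReal)).toENNReal ∂μ ≠ ∞ := by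
    intro h
    rw [h] at hF
    have : eint μ f + ((c : ℝ) : EReal) < ⊤ := EReal.add_lt_top htop.ne (by simp)
    rw [hF] at this
    simp at this
  have h3 := ae_eq_of_ae_le_of_lintegral_le (μ := μ)
    (ae_of_all _ fun a => EReal.toENNReal_le_toENNReal
      (add_le_add_left (hfg a) ((c : ℝ) : EReal))) h2
    (hg.measurable_shift c).aemeasurable h1
  filter_upwards [h3] with a ha
  rw [EReal.toENNReal_eq_toENNReal (add_nonneg_of_neg_le (hc a))
    (add_nonneg_of_neg_le (hc' a))] at ha
  have := congrArg (fun x => x - ((c : ℝ) : EReal)) ha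
  have hcancel : ∀ x : EReal, x + ((c : ℝ) : EReal) - ((c : ℝ) : EReal) = x := fun x =>
    EReal.add_sub_cancel_right (a := x) (b := (c : ℝ))
  simpa [hcancel] using this

end ExtendedExpectation

/-! ### Trajectories and information -/

section Trajectories

variable {ι : Type*} {X : ℕ → Type*} {Y U : ℕ → ι → Type*} {T : ℕ}

/-- Two trajectories have the same states at the times `t₀, …, t`, the same observations up to
time `t` and the same actions before time `t`. -/
def Agree (t₀ t : ℕ) (ω ω' : Path X Y U) : Prop :=
  (∀ s, t₀ ≤ s → s ≤ t → ω.1 s = ω'.1 s) ∧ (∀ s ≤ t, ω.2.1 s = ω'.2.1 s) ∧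
    ∀ s < t, ω.2.2 s = ω'.2.2 s

lemma Agree.symm {t₀ t : ℕ} {ω ω' : Path X Y U} (h : Agree t₀ t ω ω') : Agree t₀ t ω' ω :=
  ⟨fun s h1 h2 => (h.1 s h1 h2).symm, fun s hs => (h.2.1 s hs).symm,
    fun s hs => (h.2.2 s hs).symm⟩

lemma Agree.trans {t₀ t : ℕ} {ω ω' ω'' : Path X Y U} (h : Agree t₀ t ω ω')
    (h' : Agree t₀ t ω' ω'') : Agree t₀ t ω ω'' :=
  ⟨fun s h1 h2 => (h.1 s h1 h2).trans (h'.1 s h1 h2),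
    fun s hs => (h.2.1 s hs).trans (h'.2.1 s hs), fun s hs => (h.2.2 s hs).trans (h'.2.2 s hs)⟩

lemma Agree.mono {t₀ t₁ s t : ℕ} {ω ω' : Path X Y U} (h : Agree t₀ t ω ω') (h₀ : t₀ ≤ t₁)
    (hs : s ≤ t) : Agree t₁ s ω ω' :=
  ⟨fun r h1 h2 => h.1 r (h₀.trans h1) (h2.trans hs), fun r hr => h.2.1 r (hr.trans hs),
    fun r hr => h.2.2 r (hr.trans_le hs)⟩

lemma agree_setAction (t : ℕ) (ω : Path X Y U) (a : ∀ j, U t j) :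
    Agree 0 t ω (setAction t ω a) :=
  ⟨fun _ _ _ => rfl, fun _ _ => rfl, fun s hs => by simp [setAction, Function.update_of_ne hs.ne]⟩

lemma agree_setState (t : ℕ) (ω : Path X Y U) (z : X (t + 1) × ∀ j, Y (t + 1) j) :
    Agree 0 t ω (setState (t + 1) ω z) := by
  refine ⟨fun s _ hs => ?_, fun s hs => ?_, fun s hs => rfl⟩
  all_goals simp [setState, Function.update_of_ne (show s ≠ t + 1 by omega)]

/-- The induction step for coupling: two trajectories that agree up to time `t`, have equal actions
there and receive the same noise `z` agree one step further. -/
lemma Agree.setState {t₀ t : ℕ} {ω ω' : Path X Y U} (h : Agree t₀ t ω ω')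
    (hu : ω.2.2 t = ω'.2.2 t) (z : X (t + 1) × ∀ j, Y (t + 1) j) :
    Agree t₀ (t + 1) (setState (t + 1) ω z) (setState (t + 1) ω' z) := by
  refine ⟨fun s h1 h2 => ?_, fun s hs => ?_, fun s hs => ?_⟩
  · rcases h2.eq_or_lt with rfl | h2
    · simp [DelayedSharing.setState]
    · simpa [DelayedSharing.setState, Function.update_of_ne h2.ne] using h.1 s h1 (by omega)
  · rcases hs.eq_or_lt with rfl | hs
    · simp [DelayedSharing.setState]
    · simpa [DelayedSharing.setState, Function.update_of_ne hs.ne] using h.2.1 s (by omega)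
  · rcases (Nat.lt_succ_iff.mp hs).eq_or_lt with rfl | hs
    · exact hu
    · exact h.2.2 s hs

@[simp] lemma setAction_action (t : ℕ) (ω : Path X Y U) (a : ∀ j, U t j) :
    (setAction t ω a).2.2 t = a := by simp [setAction]

lemma info_ext {t : ℕ} {k : ι} {ω ω' : Path X Y U}
    (hy : ∀ s j, s + T ≤ t → ω.2.1 s j = ω'.2.1 s j)
    (hu : ∀ s j, s + T ≤ t → ω.2.2 s j = ω'.2.2 s j)
    (hyk : ∀ s ≤ t, ω.2.1 s k = ω'.2.1 s k) (huk : ∀ s < t, ω.2.2 s k = ω'.2.2 s k) :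
    info T t k ω = info T t k ω' := by
  refine Prod.ext ?_ (Prod.ext ?_ ?_)
  · funext s j; exact Prod.ext (hy s j s.2) (hu s j s.2)
  · funext s; exact hyk s s.2.1
  · funext s; exact huk s s.2.1

/-- The delay matters here. Because `T ≥ 1`, the shared data stop before time `t`, so `I_t^k`
contains no action taken at time `t`, on which `Agree t t` is silent. -/
lemma info_congr (hT : 1 ≤ T) {t : ℕ} {ω ω' : Path X Y U} (h : Agree t t ω ω') (k : ι) :
    info T t k ω = info T t k ω' :=
  info_ext (fun s j hs => by rw [h.2.1 s (by omega)]) (fun s j hs => by rw [h.2.2 s (by omega)])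
    (fun s hs => by rw [h.2.1 s hs]) (fun s hs => by rw [h.2.2 s hs])

lemma hidden_congr {t : ℕ} {ω ω' : Path X Y U} (h : Agree t t ω ω') (k : ι) :
    hidden T t k ω = hidden T t k ω' := by
  refine Prod.ext (h.1 t le_rfl le_rfl) ?_
  funext j
  refine Prod.ext ?_ ?_
  · funext s; exact congrFun (h.2.1 s s.2.1) _
  · funext s; exact congrFun (h.2.2 s s.2.1) _

/-- The information of agent `j` at time `s = t + 1 - T` is determined by the shared data at time
`t` and the observation of agent `j` at time `s`. -/
lemma info_eq_of_common_eq (hT : 1 ≤ T) {t s : ℕ} (hs : s + T = t + 1) {j : ι}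
    {ω ω' : Path X Y U} (h : common T t ω = common T t ω') (hy : ω.2.1 s j = ω'.2.1 s j) :
    info T s j ω = info T s j ω' := by
  have hc : ∀ r i, r + T ≤ t → ω.2.1 r i = ω'.2.1 r i ∧ ω.2.2 r i = ω'.2.2 r i := fun r i hr =>
    Prod.ext_iff.mp (congrFun (congrFun h ⟨r, hr⟩) i)
  refine info_ext (fun r i hr => (hc r i (by omega)).1) (fun r i hr => (hc r i (by omega)).2)
    (fun r hr => ?_) (fun r hr => (hc r j (by omega)).2)
  rcases hr.eq_or_lt with rfl | hr
  · exact hy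
  · exact (hc r j (by omega)).1

/-! ### Reconstruction of trajectories from the information of one agent. -/

section Fill

variable [DecidableEq ι] [∀ t, Nonempty (X t)] [∀ t j, Nonempty (Y t j)]
  [∀ t j, Nonempty (U t j)]

/-- `I_t^k` and the hidden variables together record all observations up to `t`, all actions before
`t` and the present state. Only past states are lost, hence the starting time `t` for the states in
`Agree`. -/
lemma agree_join (t : ℕ) (k : ι) (ω : Path X Y U) :
    Agree t t ω (join T t k (info T t k ω) (hidden T t k ω)) := by
  refine ⟨fun s h1 h2 => ?_, fun s hs => ?_, fun s hs => ?_⟩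
  · obtain rfl : s = t := le_antisymm h2 h1
    simp [join, fill, hidden]
  · funext j
    by_cases h : s + T ≤ t
    · simp [join, fill, h, info, common]
    · by_cases hj : j = k
      · subst hj; simp [join, fill, h, hs, info, priv, Equiv.piSplitAt]
      · simp [join, fill, h, hs, hidden, priv, Equiv.piSplitAt, hj]
  · funext j
    by_cases h : s + T ≤ t
    · simp [join, fill, h, info, common]
    · by_cases hj : j = k
      · subst hj; simp [join, fill, h, hs, info, priv, Equiv.piSplitAt]
      · simp [join, fill, h, hs, hidden, priv, Equiv.piSplitAt, hj]

lemma info_join (t : ℕ) (k : ι) (i : Info Y U T t k) (h : Hidden X Y U T t k) (j : ι) :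
    info T t j (join T t k i h) =
      (i.1, (Equiv.piSplitAt k fun j => Private Y U T t j).symm (i.2, h.2) j) := by
  refine Prod.ext ?_ (Prod.ext ?_ ?_)
  · funext s j'
    simp [info, common, join, fill, s.2]
  · funext s
    have : ¬ (s : ℕ) + T ≤ t := not_le.mpr s.2.2
    simp [info, priv, join, fill, this, s.2.1]
  · funext s
    have : ¬ (s : ℕ) + T ≤ t := not_le.mpr s.2.2
    simp [info, priv, join, fill, this, s.2.1]

lemma info_join_self (t : ℕ) (k : ι) (i : Info Y U T t k) (h : Hidden X Y U T t k) :
    info T t k (join T t k i h) = i := by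
  rw [info_join]; simp [Equiv.piSplitAt]

lemma info_join_of_ne (t : ℕ) (k : ι) (i : Info Y U T t k) (h : Hidden X Y U T t k)
    (j : {j // j ≠ k}) : info T t j.1 (join T t k i h) = (i.1, h.2 j) := by
  rw [info_join]; simp [Equiv.piSplitAt, j.2]

lemma hidden_join (t : ℕ) (k : ι) (i : Info Y U T t k) (h : Hidden X Y U T t k) :
    hidden T t k (join T t k i h) = h := by
  refine Prod.ext (by simp [hidden, join, fill]) ?_
  funext j
  exact congrArg Prod.snd (info_join_of_ne t k i h j)

/-- The private data of agent `k` occupy only its own coordinates. This justifies the arbitrary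
private data in `nextLaw`. -/
lemma join_congr_of_ne (t : ℕ) (k : ι) {i i' : Info Y U T t k} (hi : i.1 = i'.1)
    (h : Hidden X Y U T t k) :
    (join T t k i h).1 = (join T t k i' h).1 ∧
    ∀ s j, j ≠ k → (join T t k i h).2.1 s j = (join T t k i' h).2.1 s j ∧
      (join T t k i h).2.2 s j = (join T t k i' h).2.2 s j := by
  refine ⟨rfl, fun s j hj => ?_⟩
  simp [join, fill, hi, Equiv.piSplitAt, hj]

/-- `ownPath` preserves what agent `k` can see: old enough data of everybody, and its own data. -/
lemma ownPath_obs (t : ℕ) (k : ι) (ω : Path X Y U) {s : ℕ} {j : ι}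
    (h : s + T ≤ t ∨ (j = k ∧ s ≤ t)) :
    (ownPath X t k (info T t k ω)).2.1 s j = ω.2.1 s j := by
  by_cases hs : s + T ≤ t
  · simp [ownPath, join, fill, hs, info, common]
  · obtain ⟨rfl, hst⟩ := h.resolve_left hs
    simp [ownPath, join, fill, hs, hst, info, priv, Equiv.piSplitAt]

lemma ownPath_action (t : ℕ) (k : ι) (ω : Path X Y U) {s : ℕ} {j : ι}
    (h : s + T ≤ t ∨ (j = k ∧ s < t)) :
    (ownPath X t k (info T t k ω)).2.2 s j = ω.2.2 s j := by
  by_cases hs : s + T ≤ t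
  · simp [ownPath, join, fill, hs, info, common]
  · obtain ⟨rfl, hst⟩ := h.resolve_left hs
    simp [ownPath, join, fill, hs, hst, info, priv, Equiv.piSplitAt]

lemma prevInfo_info (t : ℕ) (k : ι) (ω : Path X Y U) :
    prevInfo X t k (info T (t + 1) k ω) = info T t k ω :=
  info_ext (fun _ _ hs => ownPath_obs _ _ _ (Or.inl (by omega)))
    (fun _ _ hs => ownPath_action _ _ _ (Or.inl (by omega)))
    (fun _ hs => ownPath_obs _ _ _ (Or.inr ⟨rfl, by omega⟩))
    (fun _ hs => ownPath_action _ _ _ (Or.inr ⟨rfl, by omega⟩))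

lemma prevAction_info (t : ℕ) (k : ι) (ω : Path X Y U) :
    prevAction X t k (info T (t + 1) k ω) = ω.2.2 t k :=
  ownPath_action _ _ _ (Or.inr ⟨rfl, by omega⟩)

lemma lastData_info (t : ℕ) (k : ι) (ω : Path X Y U) :
    lastData X t k (info T (t + 1) k ω) = newData T t k ω := by
  refine Prod.ext (ownPath_obs _ _ _ (Or.inr ⟨rfl, le_rfl⟩)) ?_
  funext s j
  exact Prod.ext (ownPath_obs _ _ _ (Or.inl s.2.le)) (ownPath_action _ _ _ (Or.inl s.2.le))

/-- Record in a trajectory the action `u` of agent `k` at time `t` and its new data `d`. -/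
def recordData (t : ℕ) (k : ι) (ω : Path X Y U) (u : U t k) (d : NewData Y U T t k) :
    Path X Y U :=
  (ω.1,
   fun s j => if h : s + T = t + 1 ∧ j ≠ k then (d.2 ⟨s, h.1⟩ ⟨j, h.2⟩).1
    else (setObs (t + 1) k ω d.1).2.1 s j,
   fun s j => if h : s + T = t + 1 ∧ j ≠ k then (d.2 ⟨s, h.1⟩ ⟨j, h.2⟩).2
    else Function.update ω.2.2 t (Function.update (ω.2.2 t) k u) s j)

/-- `I_{t+1}^k` as a function of `I_t^k`, of `U_t^k` and of the new data of agent `k`. -/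
def infoUpdate (X : ℕ → Type*) [∀ t, Nonempty (X t)] (t : ℕ) (k : ι) (i : Info Y U T t k)
    (u : U t k) (d : NewData Y U T t k) : Info Y U T (t + 1) k :=
  info T (t + 1) k (recordData t k (ownPath X t k i) u d)

/-- With the converse identities for `prevInfo`, `prevAction` and `lastData` below, this shows that
`I_{t+1}^k` is equivalent to `I_t^k`, the last action and the new data. The data of another agent in
`Δ_{t+1}` either are in `Δ_t` already or date from the time `s` with `s + T = t + 1`, which is what
the case split distinguishes. -/
lemma infoUpdate_info (hT : 1 ≤ T) (t : ℕ) (k : ι) (ω : Path X Y U) :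
    infoUpdate X t k (info T t k ω) (ω.2.2 t k) (newData T t k ω) = info T (t + 1) k ω := by
  have hyk : ∀ s ≤ t + 1, (recordData t k (ownPath X t k (info T t k ω)) (ω.2.2 t k)
      (newData T t k ω)).2.1 s k = ω.2.1 s k := by
    intro s hs
    rcases hs.eq_or_lt with rfl | hs
    · simp [recordData, setObs, newData]
    · simp only [recordData, ne_eq, not_true_eq_false, and_false, dite_false, setObs]
      rw [Function.update_of_ne hs.ne]
      exact ownPath_obs _ _ _ (Or.inr ⟨rfl, by omega⟩)
  have huk : ∀ s < t + 1, (recordData t k (ownPath X t k (info T t k ω)) (ω.2.2 t k)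
      (newData T t k ω)).2.2 s k = ω.2.2 s k := by
    intro s hs
    rcases (Nat.lt_succ_iff.mp hs).eq_or_lt with rfl | hs
    · simp [recordData]
    · simp only [recordData, ne_eq, not_true_eq_false, and_false, dite_false]
      rw [Function.update_of_ne hs.ne]
      exact ownPath_action _ _ _ (Or.inr ⟨rfl, hs⟩)
  refine info_ext (fun s j hs => ?_) (fun s j hs => ?_) hyk huk
  · by_cases hj : j = k
    · subst hj; exact hyk s (by omega)
    · rcases hs.eq_or_lt with hs | hs
      · simp [recordData, hs, hj, newData]
      · simp only [recordData, hs.ne, false_and, dite_false, setObs]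
        rw [Function.update_of_ne (by omega)]
        exact ownPath_obs _ _ _ (Or.inl (by omega))
  · by_cases hj : j = k
    · subst hj; exact huk s (by omega)
    · rcases hs.eq_or_lt with hs | hs
      · simp [recordData, hs, hj, newData]
      · simp only [recordData, hs.ne, false_and, dite_false]
        rw [Function.update_of_ne (by omega)]
        exact ownPath_action _ _ _ (Or.inl (by omega))

lemma info_recordData (hT : 1 ≤ T) (t : ℕ) (k : ι) (ω : Path X Y U) (u : U t k)
    (d : NewData Y U T t k) : info T t k (recordData t k ω u d) = info T t k ω := by
  refine info_ext (fun s j hs => ?_) (fun s j hs => ?_) (fun s hs => ?_) (fun s hs => ?_)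
  · simp only [recordData, show s + T ≠ t + 1 by omega, false_and, dite_false, setObs]
    rw [Function.update_of_ne (by omega)]
  · simp only [recordData, show s + T ≠ t + 1 by omega, false_and, dite_false]
    rw [Function.update_of_ne (by omega)]
  · simp only [recordData, ne_eq, not_true_eq_false, and_false, dite_false, setObs]
    rw [Function.update_of_ne (by omega)]
  · simp only [recordData, ne_eq, not_true_eq_false, and_false, dite_false]
    rw [Function.update_of_ne (by omega)]

lemma newData_recordData (t : ℕ) (k : ι) (ω : Path X Y U) (u : U t k)
    (d : NewData Y U T t k) : newData T t k (recordData t k ω u d) = d := by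
  refine Prod.ext (by simp [newData, recordData, setObs]) ?_
  funext s j
  simp [newData, recordData, s.2, j.2]

lemma prevInfo_infoUpdate (hT : 1 ≤ T) (t : ℕ) (k : ι) (i : Info Y U T t k) (u : U t k)
    (d : NewData Y U T t k) : prevInfo X t k (infoUpdate X t k i u d) = i := by
  rw [infoUpdate, prevInfo_info, info_recordData hT, ownPath, info_join_self]

lemma prevAction_infoUpdate (t : ℕ) (k : ι) (i : Info Y U T t k) (u : U t k)
    (d : NewData Y U T t k) : prevAction X t k (infoUpdate X t k i u d) = u := by
  rw [infoUpdate, prevAction_info]; simp [recordData]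

lemma lastData_infoUpdate (t : ℕ) (k : ι) (i : Info Y U T t k) (u : U t k)
    (d : NewData Y U T t k) : lastData X t k (infoUpdate X t k i u d) = d := by
  rw [infoUpdate, lastData_info, newData_recordData]

end Fill

/-- Since `T ≥ 1`, observations of the other agents at time `t + 1` are not yet shared at time `t +
1`; agent `k` sees only its own component of `z`. -/
lemma info_setState [DecidableEq ι] (hT : 1 ≤ T) (t : ℕ) (k : ι) (ω : Path X Y U)
    (z : X (t + 1) × ∀ j, Y (t + 1) j) :
    info T (t + 1) k (setState (t + 1) ω z) =
      info T (t + 1) k (setObs (t + 1) k ω (z.2 k)) := by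
  refine info_ext (fun s j hs => ?_) (fun s j hs => rfl) (fun s hs => ?_) (fun s hs => rfl)
  · simp [setState, setObs, Function.update_of_ne (show s ≠ t + 1 by omega)]
  · rcases hs.eq_or_lt with rfl | hs
    · simp [setState, setObs]
    · simp [setState, setObs, Function.update_of_ne hs.ne]

end Trajectories

/-! ### One agent's action as a free parameter against fixed strategies of the others. -/

section Actions

variable {ι : Type*} [Fintype ι] [DecidableEq ι] {X : ℕ → Type*} {Y U : ℕ → ι → Type*}
  [∀ t, MeasurableSpace (X t)] [∀ t j, MeasurableSpace (Y t j)] [∀ t j, MeasurableSpace (U t j)]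
  [∀ t, Nonempty (X t)] [∀ t j, Nonempty (Y t j)] [∀ t j, Nonempty (U t j)] {T : ℕ}

lemma measurable_infoUpdate (t : ℕ) (k : ι) :
    Measurable fun p : Info Y U T t k × U t k × NewData Y U T t k =>
      infoUpdate X t k p.1 p.2.1 p.2.2 := by
  have ho : Measurable fun p : Info Y U T t k × U t k × NewData Y U T t k =>
      ownPath X t k p.1 := (measurable_ownPath t k).comp measurable_fst
  have hc : ∀ (s : ℕ) (j : ι), Measurable fun p : Info Y U T t k × U t k × NewData Y U T t k =>
      (ownPath X t k p.1).2.1 s j := fun s j =>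
    (by fun_prop : Measurable fun ω : Path X Y U => ω.2.1 s j).comp ho
  have hd : ∀ (s : ℕ) (j : ι), Measurable fun p : Info Y U T t k × U t k × NewData Y U T t k =>
      (ownPath X t k p.1).2.2 s j := fun s j =>
    (by fun_prop : Measurable fun ω : Path X Y U => ω.2.2 s j).comp ho
  refine (measurable_info (t + 1) k).comp (Measurable.prodMk
    ((by fun_prop : Measurable fun ω : Path X Y U => ω.1).comp ho) (Measurable.prodMk ?_ ?_))
  · refine measurable_pi_iff.mpr fun s => measurable_pi_iff.mpr fun j => ?_
    by_cases h : s + T = t + 1 ∧ j ≠ k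
    · simp only [dif_pos h]; fun_prop
    · simp only [h, dite_false, setObs]
      by_cases hs : s = t + 1
      · subst hs
        by_cases hj : j = k
        · subst hj; simp only [Function.update_self]; fun_prop
        · simp only [Function.update_self, Function.update_of_ne hj]; exact hc _ _
      · simp only [Function.update_of_ne hs]; exact hc _ _
  · refine measurable_pi_iff.mpr fun s => measurable_pi_iff.mpr fun j => ?_
    by_cases h : s + T = t + 1 ∧ j ≠ k
    · simp only [dif_pos h]; fun_prop
    · simp only [h, dite_false]
      by_cases hs : s = t
      · subst hs
        by_cases hj : j = k
        · subst hj; simp only [Function.update_self]; fun_prop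
        · simp only [Function.update_self, Function.update_of_ne hj]; exact hd _ _
      · simp only [Function.update_of_ne hs]; exact hd _ _

lemma measurable_afterAction (γ : Profile Y U T) (k : ι) (t : ℕ) :
    Measurable fun p : (Info Y U T t k × U t k) × Hidden X Y U T t k =>
      afterAction γ k t p.1.1 p.2 p.1.2 :=
  (measurable_setAction t).comp (Measurable.prodMk
    ((measurable_join t k).comp (by fun_prop :
      Measurable fun p : (Info Y U T t k × U t k) × Hidden X Y U T t k => (p.1.1, p.2)))
    ((measurable_jointAction γ k t).comp (by fun_prop :
      Measurable fun p : (Info Y U T t k × U t k) × Hidden X Y U T t k =>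
        (p.1.1.1, p.2.2, p.1.2))))

lemma measurable_nextInfo (γ : Profile Y U T) (k : ι) (t : ℕ) (i : Info Y U T t k) (u : U t k) :
    Measurable fun z : Hidden X Y U T t k × X (t + 1) × Y (t + 1) k =>
      nextInfo γ k t i z.1 u z.2.2 := by
  have ha : Measurable fun z : Hidden X Y U T t k × X (t + 1) × Y (t + 1) k =>
      afterAction γ k t i z.1 u :=
    (measurable_afterAction γ k t).comp (by fun_prop :
      Measurable fun z : Hidden X Y U T t k × X (t + 1) × Y (t + 1) k => ((i, u), z.1))
  have ho : Measurable fun p : Path X Y U × Y (t + 1) k => setObs (t + 1) k p.1 p.2 := by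
    have h1 : Measurable fun p : Path X Y U × Y (t + 1) k =>
        Function.update (p.1.2.1 (t + 1)) k p.2 :=
      measurable_update'.comp (by fun_prop :
        Measurable fun p : Path X Y U × Y (t + 1) k => (p.1.2.1 (t + 1), p.2))
    refine Measurable.prodMk (by fun_prop) (Measurable.prodMk ?_ (by fun_prop))
    exact measurable_update'.comp ((by fun_prop :
      Measurable fun p : Path X Y U × Y (t + 1) k => p.1.2.1).prodMk h1)
  have hy : Measurable fun z : Hidden X Y U T t k × X (t + 1) × Y (t + 1) k => z.2.2 := by
    fun_prop
  exact (measurable_info (t + 1) k).comp (ho.comp (ha.prodMk hy))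

lemma jointAction_update (γ : Profile Y U T) (k : ι) (g : Strategy Y U T k) (t : ℕ)
    (δ : Common Y U T t) (l : OthersPrivate Y U T t k) (u : U t k) :
    jointAction (Function.update γ k g) k t δ l u = jointAction γ k t δ l u := by
  unfold jointAction
  congr 2
  funext j
  rw [Function.update_of_ne j.2]

@[simp] lemma jointAction_self (γ : Profile Y U T) (k : ι) (t : ℕ)
    (δ : Common Y U T t) (l : OthersPrivate Y U T t k) (u : U t k) :
    jointAction γ k t δ l u k = u := by
  simp [jointAction, Equiv.piSplitAt]

lemma jointAction_of_ne (γ : Profile Y U T) (k : ι) (t : ℕ)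
    (δ : Common Y U T t) (l : OthersPrivate Y U T t k) (u : U t k) {j : ι} (hj : j ≠ k) :
    jointAction γ k t δ l u j = (γ j t).1 (δ, l ⟨j, hj⟩) := by
  simp [jointAction, Equiv.piSplitAt, hj]

/-- The strategy `g` enters a step only through the value `(g t).1 i`. From here on the action of
agent `k` can be varied independently of any strategy. -/
lemma act_join (γ : Profile Y U T) (k : ι) (g : Strategy Y U T k) (t : ℕ) (i : Info Y U T t k)
    (h : Hidden X Y U T t k) :
    act (Function.update γ k g) t (join T t k i h) = afterAction γ k t i h ((g t).1 i) := by
  unfold act afterAction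
  congr 1
  funext j
  by_cases hj : j = k
  · subst hj
    rw [info_join_self, jointAction_self, Function.update_self]
  · rw [info_join_of_ne t k i h ⟨j, hj⟩, jointAction_of_ne _ _ _ _ _ _ hj,
      Function.update_of_ne hj]

lemma agree_act (γ : Profile Y U T) (t : ℕ) (ω : Path X Y U) : Agree 0 t ω (act γ t ω) :=
  agree_setAction t ω _

lemma act_action_congr (hT : 1 ≤ T) (γ : Profile Y U T) {t : ℕ} {ω ω' : Path X Y U}
    (h : Agree t t ω ω') : (act γ t ω).2.2 t = (act γ t ω').2.2 t := by
  simp only [act, setAction_action]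
  funext j
  rw [info_congr hT h]

lemma info_afterAction (hT : 1 ≤ T) (γ : Profile Y U T) (k : ι) (t : ℕ) (i : Info Y U T t k)
    (h : Hidden X Y U T t k) (u : U t k) : info T t k (afterAction γ k t i h u) = i := by
  rw [afterAction, ← info_congr hT ((agree_setAction t _ _).mono (Nat.zero_le _) le_rfl),
    info_join_self]

lemma info_afterAction_of_ne (hT : 1 ≤ T) (γ : Profile Y U T) (k : ι) (t : ℕ)
    (i : Info Y U T t k) (h : Hidden X Y U T t k) (u : U t k) (j : {j // j ≠ k}) :
    info T t j.1 (afterAction γ k t i h u) = (i.1, h.2 j) := by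
  rw [afterAction, ← info_congr hT ((agree_setAction t _ _).mono (Nat.zero_le _) le_rfl),
    info_join_of_ne]

lemma hidden_afterAction (γ : Profile Y U T) (k : ι) (t : ℕ) (i : Info Y U T t k)
    (h : Hidden X Y U T t k) (u : U t k) : hidden T t k (afterAction γ k t i h u) = h := by
  rw [afterAction, ← hidden_congr ((agree_setAction t _ _).mono (Nat.zero_le _) le_rfl),
    hidden_join]

lemma afterAction_state (γ : Profile Y U T) (k : ι) (t : ℕ) (i : Info Y U T t k)
    (h : Hidden X Y U T t k) (u : U t k) : (afterAction γ k t i h u).1 t = h.1 := by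
  simp [afterAction, setAction, join, fill]

lemma afterAction_action (γ : Profile Y U T) (k : ι) (t : ℕ) (i : Info Y U T t k)
    (h : Hidden X Y U T t k) (u : U t k) :
    (afterAction γ k t i h u).2.2 t = jointAction γ k t i.1 h.2 u :=
  setAction_action _ _ _

end Actions

/-! ### Evolution of the network -/

section Evolution

open scoped NNReal

variable {ι : Type*} [Fintype ι] [DecidableEq ι] {X : ℕ → Type*} {Y U : ℕ → ι → Type*}
  [∀ t, MeasurableSpace (X t)] [∀ t j, MeasurableSpace (Y t j)] [∀ t j, MeasurableSpace (U t j)]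
  [∀ t, Nonempty (X t)] [∀ t j, Nonempty (Y t j)] [∀ t j, Nonempty (U t j)] {T : ℕ}

namespace Network

variable (M : Network ι X Y U)

/-- Law of the state and of the observations at time `t + 1` given the state and the actions at
time `t`. -/
def noise (t : ℕ) : Kernel (X t × ∀ j, U t j) (X (t + 1) × ∀ j, Y (t + 1) j) :=
  M.S t ⊗ₖ (piKernel (M.Q t)).comap (fun p => (p.2, p.1.2)) (by fun_prop)

instance (t : ℕ) : IsMarkovKernel (M.noise t) := by unfold noise; infer_instance

lemma measurable_setState_right (t : ℕ) (ω : Path X Y U) : Measurable (setState t ω) :=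
  (measurable_setState t).comp measurable_prodMk_left

/-- The randomness of a step depends only on the present state and actions, and the past is merely
carried along. Trajectories with equal present state and actions can therefore be driven by the same
`z`. -/
lemma advance_apply (t : ℕ) (ω : Path X Y U) :
    M.advance t ω = (M.noise t (ω.1 t, ω.2.2 t)).map (setState (t + 1) ω) := by
  refine Measure.ext_of_lintegral _ fun f hf => ?_
  have hg : Measurable fun p : Path X Y U × (X (t + 1) × ∀ j, Y (t + 1) j) =>
      f (setState (t + 1) p.1 p.2) := hf.comp (measurable_setState (t + 1))
  rw [lintegral_map hf (measurable_setState_right _ _), advance,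
    Kernel.lintegral_map _ (measurable_setState (t + 1)) _ hf, Kernel.prod_apply, Kernel.id_apply,
    lintegral_prod _ hg.aemeasurable]
  rw [lintegral_dirac' _ hg.lintegral_prod_right']
  have hg' : Measurable fun z => f (setState (t + 1) ω z) :=
    hf.comp (measurable_setState_right _ _)
  rw [noise, Kernel.lintegral_compProd _ _ _ hg', Kernel.lintegral_compProd _ _ _ hg']
  rfl

lemma lintegral_advance (t : ℕ) (ω : Path X Y U) {f : Path X Y U → ℝ≥0∞} (hf : Measurable f) :
    ∫⁻ ω', f ω' ∂M.advance t ω =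
      ∫⁻ z, f (setState (t + 1) ω z) ∂M.noise t (ω.1 t, ω.2.2 t) := by
  rw [advance_apply, lintegral_map hf (measurable_setState_right _ _)]

lemma run_zero_apply (γ : Profile Y U T) (t : ℕ) (ω : Path X Y U) :
    M.run γ t 0 ω = Measure.dirac (act γ t ω) := by
  rw [run, Kernel.deterministic_apply]

lemma run_succ_apply (γ : Profile Y U T) (t m : ℕ) (ω : Path X Y U) :
    M.run γ t (m + 1) ω = M.run γ (t + 1) m ∘ₘ M.advance t (act γ t ω) := by
  rw [run, Kernel.comp_apply, Kernel.comp_apply, Kernel.deterministic_apply,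
    Measure.dirac_bind (Kernel.measurable _)]

lemma run_congr {γ γ' : Profile Y U T} {t : ℕ} (h : ∀ s ≥ t, ∀ j, γ j s = γ' j s) (m : ℕ) :
    M.run γ t m = M.run γ' t m := by
  induction m generalizing t with
  | zero =>
    refine Kernel.ext fun ω => ?_
    rw [run_zero_apply, run_zero_apply]
    simp only [act, h t le_rfl]
  | succ m ih =>
    refine Kernel.ext fun ω => ?_
    rw [run_succ_apply, run_succ_apply, ih fun s hs => h s (by omega)]
    simp only [act, h t le_rfl]

/-- The future of the network depends only on the part of the past which it can see. -/
lemma lintegral_run_congr (hT : 1 ≤ T) (γ : Profile Y U T) {t₀ t m n : ℕ} (h₀ : t₀ ≤ t)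
    (hn : n = t + m) {f : Path X Y U → ℝ≥0∞} (hf : Measurable f)
    (hcongr : ∀ ω ω', Agree t₀ n ω ω' → ω.2.2 n = ω'.2.2 n → f ω = f ω')
    {ω ω' : Path X Y U} (h : Agree t₀ t ω ω') :
    ∫⁻ a, f a ∂M.run γ t m ω = ∫⁻ a, f a ∂M.run γ t m ω' := by
  induction m generalizing t ω ω' with
  | zero =>
    obtain rfl : n = t := hn
    rw [run_zero_apply, run_zero_apply, lintegral_dirac' _ hf, lintegral_dirac' _ hf]
    refine hcongr _ _ ?_ (act_action_congr hT γ (h.mono h₀ le_rfl))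
    exact (((agree_act γ n ω).mono (Nat.zero_le _) le_rfl).symm.trans h).trans
      ((agree_act γ n ω').mono (Nat.zero_le _) le_rfl)
  | succ m ih =>
    have hm : Measurable fun b => ∫⁻ a, f a ∂M.run γ (t + 1) m b := hf.lintegral_kernel
    have ha := act_action_congr hT γ (h.mono h₀ le_rfl)
    have hx : (act γ t ω).1 t = (act γ t ω').1 t := h.1 t h₀ le_rfl
    rw [run_succ_apply, run_succ_apply,
      Measure.lintegral_bind (Kernel.aemeasurable _) hf.aemeasurable,
      Measure.lintegral_bind (Kernel.aemeasurable _) hf.aemeasurable,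
      lintegral_advance _ _ _ hm, lintegral_advance _ _ _ hm, ha, hx]
    -- Coupling: the states and actions at time `t` coincide, so both noises have the same law and
    -- the futures are compared for the same `z`.
    refine lintegral_congr fun z => ih (by omega) (by omega) ?_
    refine Agree.setState ?_ ha z
    exact (((agree_act γ t ω).mono (Nat.zero_le _) le_rfl).symm.trans h).trans
      ((agree_act γ t ω').mono (Nat.zero_le _) le_rfl)

/-- Law of the trajectory up to the observations at time `t`. -/
def preLaw (γ : Profile Y U T) : ℕ → Measure (Path X Y U)
  | 0 => M.initLaw
  | t + 1 => M.advance t ∘ₘ (preLaw γ t).map (act γ t)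

instance (γ : Profile Y U T) (t : ℕ) : IsProbabilityMeasure (M.preLaw γ t) := by
  induction t with
  | zero => unfold preLaw; infer_instance
  | succ t ih =>
    unfold preLaw
    have := Measure.isProbabilityMeasure_map (μ := M.preLaw γ t)
      (measurable_act γ t).aemeasurable
    infer_instance

/-- A step may be counted either as the end of the past or as the beginning of the future; this cuts
the law at an arbitrary time. -/
lemma law_add (γ : Profile Y U T) (t m : ℕ) :
    M.law (t + m) γ = M.run γ t m ∘ₘ M.preLaw γ t := by
  induction t generalizing m with
  | zero => rw [zero_add]; rfl
  | succ t ih =>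
    rw [show t + 1 + m = t + (m + 1) by omega, ih, run, preLaw,
      ← Measure.deterministic_comp_eq_map (measurable_act γ t), Measure.comp_assoc,
      Measure.comp_assoc, Kernel.comp_assoc]

lemma law_eq (γ : Profile Y U T) {t N : ℕ} (h : t ≤ N) :
    M.law N γ = M.run γ t (N - t) ∘ₘ M.preLaw γ t := by
  rw [← law_add, Nat.add_sub_cancel' h]

lemma pathCost_isLowerBounded (N t : ℕ) : IsLowerBounded (M.pathCost N t) := by
  choose c hc using M.cost_bddBelow
  refine ⟨?_, (-∑ s ∈ Finset.Icc t N, c s).toNNReal, fun ω => ?_⟩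
  · refine measurable_coe_real_ereal.comp (Finset.measurable_sum _ fun s _ => ?_)
    exact (M.measurable_cost s).comp
      (by fun_prop : Measurable fun ω : Path X Y U => (ω.1 s, ω.2.2 s))
  · have h1 : ∑ s ∈ Finset.Icc t N, c s ≤ ∑ s ∈ Finset.Icc t N, M.cost s (ω.1 s) (ω.2.2 s) :=
      Finset.sum_le_sum fun s _ => hc s _ _
    have h2 := Real.le_coe_toNNReal (-∑ s ∈ Finset.Icc t N, c s)
    rw [pathCost, ← EReal.coe_neg, EReal.coe_le_coe_iff]
    linarith

lemma cost_isLowerBounded (t : ℕ) :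
    IsLowerBounded fun p : X t × (∀ j, U t j) => (M.cost t p.1 p.2 : EReal) := by
  obtain ⟨c, hc⟩ := M.cost_bddBelow t
  refine ⟨measurable_coe_real_ereal.comp (M.measurable_cost t), (-c).toNNReal, fun p => ?_⟩
  have h2 := Real.le_coe_toNNReal (-c)
  rw [← EReal.coe_neg, EReal.coe_le_coe_iff]
  linarith [hc p.1 p.2]

lemma pathCost_self (N : ℕ) (ω : Path X Y U) :
    M.pathCost N N ω = (M.cost N (ω.1 N) (ω.2.2 N) : EReal) := by simp [pathCost]

lemma pathCost_of_lt {N t : ℕ} (h : t < N) (ω : Path X Y U) :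
    M.pathCost N t ω = (M.cost t (ω.1 t) (ω.2.2 t) : EReal) + M.pathCost N (t + 1) ω := by
  rw [pathCost, pathCost, ← EReal.coe_add]
  congr 1
  rw [← Finset.add_sum_Ioc_eq_sum_Icc h.le]
  congr 2
  ext s
  simp only [Finset.mem_Ioc, Finset.mem_Icc]
  omega

/-- Expected cost at the times `t, …, N` when the profile `γ` is used from time `t` on, given the
trajectory up to time `t`. -/
def pathCostToGo (N : ℕ) (γ : Profile Y U T) (t : ℕ) (ω : Path X Y U) : EReal :=
  eint (M.run γ t (N - t) ω) (M.pathCost N t)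

lemma pathCostToGo_isLowerBounded (N : ℕ) (γ : Profile Y U T) (t : ℕ) :
    IsLowerBounded (M.pathCostToGo N γ t) :=
  ((M.pathCost_isLowerBounded N t).comp measurable_snd :
    IsLowerBounded fun p : Path X Y U × Path X Y U => M.pathCost N t p.2).eint

/-- Costs from time `t` on involve neither earlier states nor anything else missing from `Agree t
t`. A trajectory may thus be replaced by its reconstruction through `join`. -/
lemma pathCostToGo_congr (hT : 1 ≤ T) {N : ℕ} (γ : Profile Y U T) {t : ℕ} (ht : t ≤ N)
    {ω ω' : Path X Y U} (h : Agree t t ω ω') :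
    M.pathCostToGo N γ t ω = M.pathCostToGo N γ t ω' := by
  have hc : ∀ a a' : Path X Y U, Agree t N a a' → a.2.2 N = a'.2.2 N →
      M.pathCost N t a = M.pathCost N t a' := by
    intro a a' h1 h2
    unfold pathCost
    congr 1
    refine Finset.sum_congr rfl fun s hs => ?_
    rw [Finset.mem_Icc] at hs
    rw [h1.1 s hs.1 hs.2]
    congr 1
    rcases hs.2.eq_or_lt with rfl | hs'
    · exact h2
    · exact h1.2.2 s hs'
  have hm := (M.pathCost_isLowerBounded N t).measurable
  have hn : N = t + (N - t) := by omega
  unfold pathCostToGo eint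
  rw [M.lintegral_run_congr hT γ le_rfl hn hm.ereal_toENNReal
      (fun a a' h1 h2 => by rw [hc a a' h1 h2]) h,
    M.lintegral_run_congr hT γ le_rfl hn
      (show Measurable fun a => (-M.pathCost N t a).toENNReal from hm.neg.ereal_toENNReal)
      (fun a a' h1 h2 => by rw [hc a a' h1 h2]) h]

lemma pathCostToGo_self (N : ℕ) (γ : Profile Y U T) (ω : Path X Y U) :
    M.pathCostToGo N γ N ω = (M.cost N (ω.1 N) ((act γ N ω).2.2 N) : EReal) := by
  rw [pathCostToGo, Nat.sub_self, run_zero_apply,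
    eint_dirac _ (M.pathCost_isLowerBounded N N).measurable, pathCost_self]
  rfl

/-! ### The evolution does not overwrite the past. -/

section Standard

variable [∀ t, StandardBorelSpace (X t)] [∀ t j, StandardBorelSpace (Y t j)]
  [∀ t j, StandardBorelSpace (U t j)]

/-- Points are measurable in the standard Borel spaces and their finite products, and only countably
many times are involved. -/
lemma measurableSet_agree (t₀ t : ℕ) (ω : Path X Y U) :
    MeasurableSet {ω' | Agree t₀ t ω ω'} := by
  have hx : ∀ s, MeasurableSet {ω' : Path X Y U | ω.1 s = ω'.1 s} := fun s =>
    measurableSet_eq_fun measurable_const (by fun_prop)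
  have hy : ∀ s, MeasurableSet {ω' : Path X Y U | ω.2.1 s = ω'.2.1 s} := fun s =>
    measurableSet_eq_fun measurable_const (by fun_prop)
  have hu : ∀ s, MeasurableSet {ω' : Path X Y U | ω.2.2 s = ω'.2.2 s} := fun s =>
    measurableSet_eq_fun measurable_const (by fun_prop)
  simp only [Agree, Set.ofPred_and, Set.ofPred_forall]
  exact (MeasurableSet.iInter fun s => .iInter fun _ => .iInter fun _ => hx s).inter
    ((MeasurableSet.iInter fun s => .iInter fun _ => hy s).inter
      (.iInter fun s => .iInter fun _ => hu s))

lemma ae_advance_agree (t : ℕ) (ω : Path X Y U) :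
    ∀ᵐ ω' ∂M.advance t ω, Agree 0 t ω ω' ∧ ω'.2.2 t = ω.2.2 t := by
  rw [advance_apply, ae_map_iff (measurable_setState_right _ _).aemeasurable]
  · exact ae_of_all _ fun z => ⟨agree_setState t ω z, rfl⟩
  · exact (measurableSet_agree 0 t ω).inter
      (measurableSet_eq_fun (by fun_prop) measurable_const)

lemma ae_run_agree (γ : Profile Y U T) (t m : ℕ) (ω : Path X Y U) :
    ∀ᵐ ω' ∂M.run γ t m ω, Agree 0 t ω ω' ∧ ω'.2.2 t = (act γ t ω).2.2 t := by
  have hmeas : MeasurableSet {ω' | Agree 0 t ω ω' ∧ ω'.2.2 t = (act γ t ω).2.2 t} :=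
    (measurableSet_agree 0 t ω).inter (measurableSet_eq_fun (by fun_prop) measurable_const)
  induction m generalizing t ω with
  | zero =>
    rw [run_zero_apply, ae_dirac_iff hmeas]
    exact ⟨agree_act γ t ω, rfl⟩
  | succ m ih =>
    rw [run_succ_apply]
    refine Measure.ae_comp_of_ae_ae hmeas ?_
    filter_upwards [M.ae_advance_agree t (act γ t ω)] with ω₁ h1
    filter_upwards [ih (t + 1) ω₁ ((measurableSet_agree 0 (t + 1) ω₁).inter
      (measurableSet_eq_fun (by fun_prop) measurable_const))] with ω₂ h2
    refine ⟨((agree_act γ t ω).trans h1.1).trans (h2.1.mono le_rfl (by omega)), ?_⟩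
    rw [← h2.1.2.2 t (by omega), h1.2]

/-- Reduces laws of functions of the past, taken over the whole horizon, to `preLaw`, on which
induction over time is possible. -/
lemma map_law (γ : Profile Y U T) {t N : ℕ} (h : t ≤ N) {β : Type*} [MeasurableSpace β]
    {f : Path X Y U → β} (hf : Measurable f) (hcongr : ∀ ω ω', Agree 0 t ω ω' → f ω = f ω') :
    (M.law N γ).map f = (M.preLaw γ t).map f := by
  refine Measure.ext_of_lintegral _ fun φ hφ => ?_
  rw [lintegral_map hφ hf, lintegral_map hφ hf, M.law_eq γ h,
    Measure.lintegral_bind (Kernel.aemeasurable _)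
      (show Measurable fun ω => φ (f ω) from hφ.comp hf).aemeasurable]
  refine lintegral_congr fun ω => ?_
  rw [lintegral_congr_ae (g := fun _ => φ (f ω))]
  · simp
  · filter_upwards [M.ae_run_agree γ t (N - t) ω] with ω' hω'
    rw [hcongr _ _ hω'.1]

/-- Given the trajectory up to time `t`, the cost at time `t` is almost surely constant, so it
splits off from the later costs. -/
lemma pathCostToGo_of_lt {N : ℕ} (γ : Profile Y U T) {t : ℕ} (ht : t < N) (ω : Path X Y U) :
    M.pathCostToGo N γ t ω = (M.cost t (ω.1 t) ((act γ t ω).2.2 t) : EReal) +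
      eint (M.advance t (act γ t ω)) (M.pathCostToGo N γ (t + 1)) := by
  have h1 : eint (M.run γ t (N - t) ω) (M.pathCost N t) =
      eint (M.run γ t (N - t) ω) fun ω' =>
        (M.cost t (ω.1 t) ((act γ t ω).2.2 t) : EReal) + M.pathCost N (t + 1) ω' := by
    refine eint_congr_ae ?_
    filter_upwards [M.ae_run_agree γ t (N - t) ω] with ω' hω'
    rw [M.pathCost_of_lt ht, hω'.2, hω'.1.1 t (Nat.zero_le _) le_rfl]
  have hc : IsLowerBounded fun _ : Path X Y U =>
      (M.cost t (ω.1 t) ((act γ t ω).2.2 t) : EReal) :=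
    (M.cost_isLowerBounded t).comp
      (measurable_const : Measurable fun _ : Path X Y U => (ω.1 t, (act γ t ω).2.2 t))
  rw [pathCostToGo, h1, eint_add hc (M.pathCost_isLowerBounded N (t + 1)), eint_const,
    show N - t = N - (t + 1) + 1 by omega, run_succ_apply,
    eint_comp (M.pathCost_isLowerBounded N (t + 1))]
  rfl

end Standard

end Network

end Evolution

/-! ### The private posterior -/

section Posterior

variable {ι : Type*} [Fintype ι] [DecidableEq ι] {X : ℕ → Type*} {Y U : ℕ → ι → Type*}
  [∀ t, MeasurableSpace (X t)] [∀ t j, MeasurableSpace (Y t j)] [∀ t j, MeasurableSpace (U t j)]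
  [∀ t, Nonempty (X t)] [∀ t j, Nonempty (Y t j)] [∀ t j, Nonempty (U t j)] {T : ℕ}

namespace Network

variable (M : Network ι X Y U)

instance (γ : Profile Y U T) (t : ℕ) (k : ι) : IsMarkovKernel (M.transition γ t k) := by
  unfold transition; infer_instance

lemma nextLaw_update (γ : Profile Y U T) (t : ℕ) (k : ι) (g : Strategy Y U T k) :
    M.nextLaw (Function.update γ k g) t k = M.nextLaw γ t k := by
  unfold nextLaw; simp only [jointAction_update]

lemma lintegral_nextLaw (γ : Profile Y U T) (t : ℕ) (k : ι) (b : Belief X Y U T t k)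
    {f : Path X Y U → ℝ≥0∞} (hf : Measurable f) :
    ∫⁻ ω, f ω ∂M.nextLaw γ t k b =
      ∫⁻ h, ∫⁻ z, f (setState (t + 1) (setAction t
          (join T t k (b.2.1, Classical.arbitrary _) h) (jointAction γ k t b.2.1 h.2 b.2.2)) z)
        ∂M.noise t (h.1, jointAction γ k t b.2.1 h.2 b.2.2) ∂(b.1 : Measure _) := by
  have h1 : Measurable fun a => ∫⁻ ω, f ω ∂M.advance t a := hf.lintegral_kernel
  have h2 : Measurable fun p : Belief X Y U T t k × Hidden X Y U T t k =>
      ∫⁻ ω, f ω ∂M.advance t (setAction t (join T t k (p.1.2.1, Classical.arbitrary _) p.2)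
        (jointAction γ k t p.1.2.1 p.2.2 p.1.2.2)) := h1.comp (measurable_nextLaw_aux γ t k)
  rw [nextLaw, Kernel.lintegral_comp _ _ _ hf,
    Kernel.lintegral_map _ (measurable_nextLaw_aux γ t k) _ h1, Kernel.prod_apply,
    Kernel.id_apply, lintegral_prod _ h2.aemeasurable, lintegral_dirac' _ h2.lintegral_prod_right']
  refine lintegral_congr fun h => ?_
  rw [lintegral_advance _ _ _ hf, setAction_action]
  simp [setAction, join, fill]

/-- `transition` draws only the observation of agent `k`, while `noise` draws all of them from a
product measure; they are compared by taking the `k`-th marginal. -/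
lemma lintegral_transition (γ : Profile Y U T) (t : ℕ) (k : ι) (b : Belief X Y U T t k)
    {φ : Hidden X Y U T t k × X (t + 1) × Y (t + 1) k → ℝ≥0∞} (hφ : Measurable φ) :
    ∫⁻ z, φ z ∂M.transition γ t k b =
      ∫⁻ h, ∫⁻ z, φ (h, z.1, z.2 k) ∂M.noise t (h.1, jointAction γ k t b.2.1 h.2 b.2.2)
        ∂(b.1 : Measure _) := by
  rw [transition, Kernel.lintegral_compProd _ _ _ hφ]
  refine lintegral_congr fun h => ?_
  have h1 : Measurable fun p : X (t + 1) × Y (t + 1) k => φ (h, p) :=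
    hφ.comp measurable_prodMk_left
  have h2 : Measurable fun z : X (t + 1) × (∀ j, Y (t + 1) j) => φ (h, z.1, z.2 k) :=
    h1.comp (by fun_prop)
  rw [Kernel.lintegral_compProd _ _ _ h1, noise, Kernel.lintegral_compProd _ _ _ h2]
  refine lintegral_congr fun x => ?_
  have h3 : Measurable fun y : Y (t + 1) k => φ (h, x, y) := h1.comp measurable_prodMk_left
  exact ((measurePreserving_eval (fun j => M.Q t j (x, jointAction γ k t b.2.1 h.2 b.2.2)) k
    ).lintegral_comp h3).symm

variable [∀ t, StandardBorelSpace (X t)] [∀ t j, StandardBorelSpace (Y t j)]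
  [∀ t j, StandardBorelSpace (U t j)]

instance (γ : Profile Y U T) (k : ι) (t : ℕ) : IsMarkovKernel (M.posteriorKernel γ k t) :=
  ⟨fun i => (M.posterior γ k t i).2⟩

instance (γ : Profile Y U T) (k : ι) (t : ℕ) : IsMarkovKernel (M.infoTransition γ k t) := by
  unfold infoTransition; infer_instance

lemma filter_update (γ : Profile Y U T) (t : ℕ) (k : ι) (g : Strategy Y U T k) :
    M.filter (Function.update γ k g) t k = M.filter γ t k := by
  unfold filter
  simp only [nextLaw_update]

/-- The past actions of agent `k` enter the recursion as recorded data, and `jointAction` never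
consults `γ k`. -/
lemma posterior_update (γ : Profile Y U T) (k : ι) (g : Strategy Y U T k) (t : ℕ) :
    M.posterior (Function.update γ k g) k t = M.posterior γ k t := by
  induction t with
  | zero => rfl
  | succ t ih =>
    funext i
    refine Subtype.ext ?_
    change M.filter (Function.update γ k g) t k _ = M.filter γ t k _
    rw [filter_update, ih]

/-- Law of the trajectory up to the observations at time `t + 1`, given `I_t^k = i`, when agent `k`
applies `u` and the others follow `γ^{-k}`. -/
def stepLaw (γ : Profile Y U T) (k : ι) (t : ℕ) (i : Info Y U T t k) (u : U t k) :
    Measure (Path X Y U) :=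
  M.advance t ∘ₘ (M.posteriorKernel γ k t i).map fun h => afterAction γ k t i h u

lemma measurable_afterAction_right (γ : Profile Y U T) (k : ι) (t : ℕ) (i : Info Y U T t k)
    (u : U t k) : Measurable fun h : Hidden X Y U T t k => afterAction γ k t i h u :=
  (measurable_afterAction γ k t).comp
    (measurable_prodMk_left : Measurable fun h : Hidden X Y U T t k => ((i, u), h))

instance (γ : Profile Y U T) (k : ι) (t : ℕ) (i : Info Y U T t k) (u : U t k) :
    IsProbabilityMeasure (M.stepLaw γ k t i u) := by
  have := Measure.isProbabilityMeasure_map (μ := M.posteriorKernel γ k t i)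
    (measurable_afterAction_right γ k t i u).aemeasurable
  unfold stepLaw
  infer_instance

lemma lintegral_stepLaw_advance (γ : Profile Y U T) (k : ι) (t : ℕ) (i : Info Y U T t k)
    (u : U t k) {f : Path X Y U → ℝ≥0∞} (hf : Measurable f) :
    ∫⁻ ω, f ω ∂M.stepLaw γ k t i u =
      ∫⁻ h, ∫⁻ ω, f ω ∂M.advance t (afterAction γ k t i h u) ∂M.posteriorKernel γ k t i := by
  rw [stepLaw, Measure.lintegral_bind (Kernel.aemeasurable _) hf.aemeasurable,
    lintegral_map hf.lintegral_kernel (measurable_afterAction_right γ k t i u)]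

lemma lintegral_stepLaw (γ : Profile Y U T) (k : ι) (t : ℕ) (i : Info Y U T t k)
    (u : U t k) {f : Path X Y U → ℝ≥0∞} (hf : Measurable f) :
    ∫⁻ ω, f ω ∂M.stepLaw γ k t i u =
      ∫⁻ h, ∫⁻ z, f (setState (t + 1) (afterAction γ k t i h u) z)
        ∂M.noise t (h.1, jointAction γ k t i.1 h.2 u) ∂M.posteriorKernel γ k t i := by
  rw [lintegral_stepLaw_advance _ _ _ _ _ _ hf]
  refine lintegral_congr fun h => ?_
  rw [lintegral_advance _ _ _ hf, afterAction_state, afterAction_action]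

lemma lintegral_stepLaw_eq_infoTransition (γ : Profile Y U T) (k : ι) (t : ℕ)
    (i : Info Y U T t k) (u : U t k) {f : Path X Y U → ℝ≥0∞} (hf : Measurable f)
    {φ : Hidden X Y U T t k × X (t + 1) × Y (t + 1) k → ℝ≥0∞} (hφ : Measurable φ)
    (h : ∀ h z, f (setState (t + 1) (afterAction γ k t i h u) z) = φ (h, z.1, z.2 k)) :
    ∫⁻ ω, f ω ∂M.stepLaw γ k t i u = ∫⁻ z, φ z ∂M.infoTransition γ k t (i, u) := by
  rw [lintegral_stepLaw _ _ _ _ _ _ hf, infoTransition, Kernel.comap_apply,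
    lintegral_transition _ _ _ _ _ hφ]
  simp only [h]
  rfl

/-- `stepLaw` carries the true private data of agent `k`, `nextLaw` arbitrary ones. Neither the new
data nor the hidden variables at time `t + 1` see the difference, and `infoUpdate` restores the true
data from `i` and `u`. This makes a kernel in `(ξ, δ, u)` sufficient for the recursion. -/
lemma lintegral_stepLaw_eq_nextLaw (hT : 1 ≤ T) (γ : Profile Y U T) (k : ι) (t : ℕ)
    (i : Info Y U T t k) (u : U t k)
    {F : Info Y U T (t + 1) k × Hidden X Y U T (t + 1) k → ℝ≥0∞} (hF : Measurable F) :
    ∫⁻ ω, F (info T (t + 1) k ω, hidden T (t + 1) k ω) ∂M.stepLaw γ k t i u =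
      ∫⁻ ω, F (infoUpdate X t k i u (newData T t k ω), hidden T (t + 1) k ω)
        ∂M.nextLaw γ t k (M.posterior γ k t i, i.1, u) := by
  have h1 : Measurable fun ω : Path X Y U => F (info T (t + 1) k ω, hidden T (t + 1) k ω) :=
    hF.comp ((measurable_info _ _).prodMk (measurable_hidden _ _))
  have h2 : Measurable fun ω : Path X Y U =>
      F (infoUpdate X t k i u (newData T t k ω), hidden T (t + 1) k ω) :=
    hF.comp (((measurable_infoUpdate t k).comp (measurable_const.prodMk
      (measurable_const.prodMk (measurable_newData t k)))).prodMk (measurable_hidden _ _))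
  rw [lintegral_stepLaw _ _ _ _ _ _ h1, lintegral_nextLaw _ _ _ _ _ h2]
  refine lintegral_congr fun h => lintegral_congr fun z => ?_
  -- Both trajectories are driven by the same hidden value `h` and the same noise `z`; they can
  -- differ only in coordinates of agent `k` up to time `t`.
  set ω := setState (t + 1) (afterAction γ k t i h u) z with hω
  set ω' := setState (t + 1) (setAction t (join T t k (i.1, Classical.arbitrary _) h)
    (jointAction γ k t i.1 h.2 u)) z with hω'
  have hag : Agree 0 t (afterAction γ k t i h u) ω := agree_setState t _ z
  have hi : info T t k ω = i := by
    rw [← info_congr hT (hag.mono (Nat.zero_le _) le_rfl), info_afterAction hT]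
  have hu : ω.2.2 t k = u := by
    change (afterAction γ k t i h u).2.2 t k = u
    rw [afterAction_action, jointAction_self]
  have hne : ∀ s j, j ≠ k → ω.2.1 s j = ω'.2.1 s j ∧ ω.2.2 s j = ω'.2.2 s j := by
    intro s j hj
    have hjn := (join_congr_of_ne t k
      (show i.1 = ((i.1, Classical.arbitrary _) : Info Y U T t k).1 from rfl) h).2 s j hj
    constructor
    · by_cases hs : s = t + 1
      · subst hs; simp [hω, hω', setState]
      · simpa [hω, hω', setState, Function.update_of_ne hs, afterAction, setAction] using hjn.1
    · by_cases hs : s = t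
      · subst hs; simp [hω, hω', setState, afterAction, setAction]
      · simpa [hω, hω', setState, Function.update_of_ne hs, afterAction, setAction] using hjn.2
  have hnew : newData T t k ω = newData T t k ω' := by
    refine Prod.ext (by simp [newData, hω, hω', setState]) ?_
    funext s j
    exact Prod.ext (hne s j j.2).1 (hne s j j.2).2
  have hhid : hidden T (t + 1) k ω = hidden T (t + 1) k ω' := by
    refine Prod.ext (by simp [hidden, hω, hω', setState]) ?_
    funext j
    refine Prod.ext ?_ ?_
    · funext s; exact (hne s j j.2).1
    · funext s; exact (hne s j j.2).2
  rw [← infoUpdate_info hT t k ω, hi, hu, hnew, hhid]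

/-- The conditional kernel disintegrates the kernel at every parameter `b`, with no exceptional set.
The later recursions hold for every `i` for this reason. -/
lemma lintegral_nextLaw_filter (γ : Profile Y U T) (k : ι) (t : ℕ) (b : Belief X Y U T t k)
    {Φ : NewData Y U T t k × Hidden X Y U T (t + 1) k → ℝ≥0∞} (hΦ : Measurable Φ) :
    ∫⁻ ω, Φ (newData T t k ω, hidden T (t + 1) k ω) ∂M.nextLaw γ t k b =
      ∫⁻ ω, ∫⁻ h, Φ (newData T t k ω, h) ∂M.filter γ t k (b, newData T t k ω)
        ∂M.nextLaw γ t k b := by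
  have hm : Measurable fun ω : Path X Y U => (newData T t k ω, hidden T (t + 1) k ω) :=
    (measurable_newData t k).prodMk (measurable_hidden _ _)
  set κ := (M.nextLaw γ t k).map fun ω => (newData T t k ω, hidden T (t + 1) k ω) with hκ
  have hκm : IsMarkovKernel κ := Kernel.IsMarkovKernel.map _ hm
  have h1 : ∫⁻ ω, Φ (newData T t k ω, hidden T (t + 1) k ω) ∂M.nextLaw γ t k b =
      ∫⁻ p, Φ p ∂κ b := by rw [hκ, Kernel.lintegral_map _ hm _ hΦ]
  have h2 : Measurable fun d => ∫⁻ h, Φ (d, h) ∂κ.condKernel (b, d) :=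
    (hΦ.lintegral_kernel_prod_right' (κ := κ.condKernel.comap (fun d => (b, d))
      measurable_prodMk_left))
  have h3 : κ b = (M.nextLaw γ t k b).map fun ω => (newData T t k ω, hidden T (t + 1) k ω) :=
    Kernel.map_apply _ hm b
  rw [h1, ← κ.disintegrate κ.condKernel, Kernel.lintegral_compProd _ _ _ hΦ,
    Kernel.fst_apply, lintegral_map h2 measurable_fst, h3,
    lintegral_map (f := fun p => ∫⁻ h, Φ (p.1, h) ∂κ.condKernel (b, p.1))
      (h2.comp measurable_fst) hm]
  rfl

lemma filter_eq_posteriorKernel (hT : 1 ≤ T) (γ : Profile Y U T) (k : ι) (t : ℕ)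
    (i : Info Y U T t k) (u : U t k) (d : NewData Y U T t k) :
    M.filter γ t k ((M.posterior γ k t i, i.1, u), d) =
      M.posteriorKernel γ k (t + 1) (infoUpdate X t k i u d) := by
  change _ = M.filter γ t k _
  rw [prevInfo_infoUpdate hT, prevAction_infoUpdate, lastData_infoUpdate]

/-- The one-step Bayes rule. Under `nextLaw` the pair `(i, u)` is a parameter and only the new data
are observed, so `filter` is the conditional law; the change of variables `infoUpdate` turns it into
the posterior at the new information. -/
lemma lintegral_stepLaw_posterior (hT : 1 ≤ T) (γ : Profile Y U T) (k : ι) (t : ℕ)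
    (i : Info Y U T t k) (u : U t k)
    {F : Info Y U T (t + 1) k × Hidden X Y U T (t + 1) k → ℝ≥0∞} (hF : Measurable F) :
    ∫⁻ ω, F (info T (t + 1) k ω, hidden T (t + 1) k ω) ∂M.stepLaw γ k t i u =
      ∫⁻ ω, ∫⁻ h, F (info T (t + 1) k ω, h) ∂M.posteriorKernel γ k (t + 1) (info T (t + 1) k ω)
        ∂M.stepLaw γ k t i u := by
  have hG : Measurable fun p : Info Y U T (t + 1) k × Hidden X Y U T (t + 1) k =>
      ∫⁻ h, F (p.1, h) ∂M.posteriorKernel γ k (t + 1) p.1 :=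
    hF.lintegral_kernel_prod_right'.comp measurable_fst
  have hR : Measurable fun p : NewData Y U T t k × Hidden X Y U T (t + 1) k =>
      (infoUpdate X t k i u p.1, p.2) :=
    ((measurable_infoUpdate t k).comp (measurable_const.prodMk
      (measurable_const.prodMk measurable_fst))).prodMk measurable_snd
  rw [M.lintegral_stepLaw_eq_nextLaw hT γ k t i u hF,
    M.lintegral_stepLaw_eq_nextLaw hT γ k t i u hG,
    M.lintegral_nextLaw_filter γ k t _ (Φ := fun p => F (infoUpdate X t k i u p.1, p.2))
      (hF.comp hR)]
  simp only [M.filter_eq_posteriorKernel hT]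

/-- Disintegration of the law of `(I_{t+1}^k, X_{t+1}, Λ_{t+1}^{-k})` after one step. -/
lemma stepLaw_map_eq_compProd (hT : 1 ≤ T) (γ : Profile Y U T) (k : ι) (t : ℕ)
    (i : Info Y U T t k) (u : U t k) :
    (M.stepLaw γ k t i u).map (fun ω => (info T (t + 1) k ω, hidden T (t + 1) k ω)) =
      (M.stepLaw γ k t i u).map (info T (t + 1) k) ⊗ₘ M.posteriorKernel γ k (t + 1) := by
  have := Measure.isProbabilityMeasure_map (μ := M.stepLaw γ k t i u)
    (measurable_info (T := T) (t + 1) k).aemeasurable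
  refine Measure.ext_of_lintegral _ fun F hF => ?_
  rw [lintegral_map hF ((measurable_info _ _).prodMk (measurable_hidden _ _)),
    Measure.lintegral_compProd hF,
    lintegral_map hF.lintegral_kernel_prod_right' (measurable_info _ _),
    M.lintegral_stepLaw_posterior hT γ k t i u hF]

lemma map_info_stepLaw (hT : 1 ≤ T) (γ : Profile Y U T) (k : ι) (t : ℕ)
    (i : Info Y U T t k) (u : U t k) :
    (M.stepLaw γ k t i u).map (info T (t + 1) k) =
      (M.infoTransition γ k t (i, u)).map fun z => nextInfo γ k t i z.1 u z.2.2 := by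
  have hn : Measurable fun z : Hidden X Y U T t k × X (t + 1) × Y (t + 1) k =>
      nextInfo γ k t i z.1 u z.2.2 :=
    measurable_nextInfo γ k t i u
  refine Measure.ext_of_lintegral _ fun f hf => ?_
  rw [lintegral_map hf (measurable_info _ _), lintegral_map hf hn]
  refine M.lintegral_stepLaw_eq_infoTransition γ k t i u
    (f := fun ω => f (info T (t + 1) k ω)) (hf.comp (measurable_info _ _))
    (φ := fun z => f (nextInfo γ k t i z.1 u z.2.2)) (hf.comp hn) fun h z => ?_
  rw [info_setState hT, nextInfo]

/-- Given `I_t^k = i` and the action `u` of agent `k`, the law of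
`((X_t, Λ_t^{-k}), X_{t+1}, Y_{t+1}^k)` is the transition law. -/
lemma lintegral_stepLaw_observed (hT : 1 ≤ T) (γ : Profile Y U T) (k : ι) (t : ℕ)
    (i : Info Y U T t k) (u : U t k)
    {φ : (Info Y U T t k × U t k) × Hidden X Y U T t k × X (t + 1) × Y (t + 1) k → ℝ≥0∞}
    (hφ : Measurable φ) :
    ∫⁻ ω, φ ((info T t k ω, ω.2.2 t k), hidden T t k ω, ω.1 (t + 1), ω.2.1 (t + 1) k)
        ∂M.stepLaw γ k t i u = ∫⁻ z, φ ((i, u), z) ∂M.infoTransition γ k t (i, u) := by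
  refine M.lintegral_stepLaw_eq_infoTransition γ k t i u ?_ (hφ.comp measurable_prodMk_left)
    fun h z => ?_
  · exact hφ.comp (((measurable_info t k).prodMk (by fun_prop)).prodMk
      ((measurable_hidden t k).prodMk (by fun_prop)))
  · have hag : Agree t t (afterAction γ k t i h u)
        (setState (t + 1) (afterAction γ k t i h u) z) :=
      (agree_setState t _ z).mono (Nat.zero_le _) le_rfl
    have hu : (setState (t + 1) (afterAction γ k t i h u) z).2.2 t k = u := by
      change (afterAction γ k t i h u).2.2 t k = u
      rw [afterAction_action, jointAction_self]
    rw [← info_congr hT hag, ← hidden_congr hag, info_afterAction hT, hidden_afterAction, hu]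
    simp [setState]

/-! The law of the network disintegrates along the private posterior. -/

/-- The hypothesis `hd`, the induction hypothesis in the next lemma, permits redrawing the hidden
variables from the posterior. The condition `hcongr` keeps `f` from seeing states before `t`, which
the information and the hidden variables do not remember. -/
lemma lintegral_preLaw_succ (hT : 1 ≤ T) (γ : Profile Y U T) (k : ι) (g : Strategy Y U T k)
    (t : ℕ)
    (hd : ∀ F : Info Y U T t k × Hidden X Y U T t k → ℝ≥0∞, Measurable F →
      ∫⁻ ω, F (info T t k ω, hidden T t k ω) ∂M.preLaw (Function.update γ k g) t =
        ∫⁻ ω, ∫⁻ h, F (info T t k ω, h) ∂M.posteriorKernel γ k t (info T t k ω)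
          ∂M.preLaw (Function.update γ k g) t)
    {f : Path X Y U → ℝ≥0∞} (hf : Measurable f)
    (hcongr : ∀ ω ω', Agree t (t + 1) ω ω' → f ω = f ω') :
    ∫⁻ ω, f ω ∂M.preLaw (Function.update γ k g) (t + 1) =
      ∫⁻ ω, ∫⁻ ω', f ω' ∂M.stepLaw γ k t (info T t k ω) ((g t).1 (info T t k ω))
        ∂M.preLaw (Function.update γ k g) t := by
  set Γ := Function.update γ k g with hΓ
  have hA : Measurable fun ω => ∫⁻ ω', f ω' ∂M.advance t (act Γ t ω) :=
    (hf.lintegral_kernel (κ := M.advance t)).comp (measurable_act Γ t)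
  have hF : Measurable fun p : Info Y U T t k × Hidden X Y U T t k =>
      ∫⁻ ω', f ω' ∂M.advance t (act Γ t (join T t k p.1 p.2)) := hA.comp (measurable_join t k)
  -- Replacing the trajectory by its reconstruction makes the integrand a function of `(I_t^k, X_t,
  -- Λ_t^{-k})` alone, the form to which `hd` applies.
  have h1 : ∀ ω, ∫⁻ ω', f ω' ∂M.advance t (act Γ t ω) =
      ∫⁻ ω', f ω' ∂M.advance t (act Γ t (join T t k (info T t k ω) (hidden T t k ω))) := by
    intro ω
    have hag := agree_join (T := T) t k ω
    have ha := act_action_congr hT Γ hag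
    have hag' : Agree t t (act Γ t ω)
        (act Γ t (join T t k (info T t k ω) (hidden T t k ω))) :=
      (((agree_act Γ t ω).mono (Nat.zero_le _) le_rfl).symm.trans hag).trans
        ((agree_act Γ t _).mono (Nat.zero_le _) le_rfl)
    rw [lintegral_advance _ _ _ hf, lintegral_advance _ _ _ hf, ha, hag'.1 t le_rfl le_rfl]
    exact lintegral_congr fun z => hcongr _ _ (hag'.setState ha z)
  rw [preLaw, Measure.lintegral_bind (Kernel.aemeasurable _) hf.aemeasurable,
    lintegral_map hf.lintegral_kernel (measurable_act Γ t)]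
  rw [lintegral_congr h1, hd _ hF]
  refine lintegral_congr fun ω => ?_
  rw [lintegral_stepLaw_advance _ _ _ _ _ _ hf]
  simp only [hΓ, act_join]

/-- Correctness of the posterior under every strategy `g`. Given `I_t^k = i` the action of agent `k`
is the constant `(g t).1 i`, so the Bayes rule for fixed `(i, u)` can be integrated over the law of
`I_t^k`. -/
lemma lintegral_preLaw_posterior (hT : 1 ≤ T) (γ : Profile Y U T) (k : ι)
    (g : Strategy Y U T k) (t : ℕ) (F : Info Y U T t k × Hidden X Y U T t k → ℝ≥0∞)
    (hF : Measurable F) :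
    ∫⁻ ω, F (info T t k ω, hidden T t k ω) ∂M.preLaw (Function.update γ k g) t =
      ∫⁻ ω, ∫⁻ h, F (info T t k ω, h) ∂M.posteriorKernel γ k t (info T t k ω)
        ∂M.preLaw (Function.update γ k g) t := by
  induction t with
  | zero =>
    have hi : Measurable (info T 0 k : Path X Y U → _) := measurable_info 0 k
    have hh : Measurable (hidden T 0 k : Path X Y U → _) := measurable_hidden 0 k
    have h := compProd_map_condDistrib (μ := M.initLaw) (X := info T 0 k) (Y := hidden T 0 k)
      (mβ := inferInstance)
      hh.aemeasurable
    have := Measure.isProbabilityMeasure_map (μ := M.initLaw) hi.aemeasurable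
    calc ∫⁻ ω, F (info T 0 k ω, hidden T 0 k ω) ∂M.initLaw
        = ∫⁻ p, F p ∂M.initLaw.map fun ω => (info T 0 k ω, hidden T 0 k ω) := by
          rw [lintegral_map hF (hi.prodMk hh)]
      _ = ∫⁻ ω, ∫⁻ h, F (info T 0 k ω, h)
            ∂condDistrib (hidden T 0 k) (info T 0 k) M.initLaw (info T 0 k ω) ∂M.initLaw := by
          rw [← h, Measure.lintegral_compProd hF, lintegral_map hF.lintegral_kernel_prod_right' hi]
  | succ t ih =>
    have hG : Measurable fun i => ∫⁻ h, F (i, h) ∂M.posteriorKernel γ k (t + 1) i :=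
      hF.lintegral_kernel_prod_right'
    rw [M.lintegral_preLaw_succ hT γ k g t ih
        (f := fun ω => F (info T (t + 1) k ω, hidden T (t + 1) k ω))
        (hF.comp ((measurable_info _ _).prodMk (measurable_hidden _ _)))
        (fun ω ω' h => by
          rw [info_congr hT (h.mono (Nat.le_succ t) le_rfl),
            hidden_congr (h.mono (Nat.le_succ t) le_rfl)]),
      M.lintegral_preLaw_succ hT γ k g t ih
        (f := fun ω => ∫⁻ h, F (info T (t + 1) k ω, h)
          ∂M.posteriorKernel γ k (t + 1) (info T (t + 1) k ω))
        (hG.comp (measurable_info _ _))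
        (fun ω ω' h => by rw [info_congr hT (h.mono (Nat.le_succ t) le_rfl)])]
    exact lintegral_congr fun ω => M.lintegral_stepLaw_posterior hT γ k t _ _ hF

lemma preLaw_map_eq_compProd (hT : 1 ≤ T) (γ : Profile Y U T) (k : ι)
    (g : Strategy Y U T k) (t : ℕ) :
    (M.preLaw (Function.update γ k g) t).map (fun ω => (info T t k ω, hidden T t k ω)) =
      (M.preLaw (Function.update γ k g) t).map (info T t k) ⊗ₘ M.posteriorKernel γ k t := by
  have := Measure.isProbabilityMeasure_map (μ := M.preLaw (Function.update γ k g) t)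
    (measurable_info (T := T) t k).aemeasurable
  refine Measure.ext_of_lintegral _ fun F hF => ?_
  rw [lintegral_map hF ((measurable_info _ _).prodMk (measurable_hidden _ _)),
    Measure.lintegral_compProd hF,
    lintegral_map hF.lintegral_kernel_prod_right' (measurable_info _ _),
    M.lintegral_preLaw_posterior hT γ k g t F hF]

lemma map_info_law (hT : 1 ≤ T) (γ : Profile Y U T) (k : ι) {t N : ℕ} (ht : t ≤ N) :
    (M.law N γ).map (info T t k) = (M.preLaw γ t).map (info T t k) :=
  M.map_law γ ht (measurable_info t k) fun _ _ h =>
    info_congr hT (h.mono (Nat.zero_le _) le_rfl) k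

/-- A joint law determines its disintegration up to null sets, so the kernel found by recursion must
be the conditional law. -/
lemma condDistrib_hidden (hT : 1 ≤ T) (γ : Profile Y U T) (k : ι) (g : Strategy Y U T k)
    {t N : ℕ} (ht : t ≤ N) :
    ∀ᵐ i ∂(M.law N (Function.update γ k g)).map (info T t k),
      condDistrib (hidden T t k) (info T t k) (M.law N (Function.update γ k g)) i =
        M.posteriorKernel γ k t i := by
  refine condDistrib_ae_eq_of_measure_eq_compProd _ (measurable_hidden t k).aemeasurable ?_
  rw [M.map_law _ ht ((measurable_info _ _).prodMk (measurable_hidden _ _)) fun ω ω' h => by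
      rw [info_congr hT (h.mono (Nat.zero_le _) le_rfl),
        hidden_congr (h.mono (Nat.zero_le _) le_rfl)],
    M.map_info_law hT _ _ ht, M.preLaw_map_eq_compProd hT]

lemma condDistrib_transition (hT : 1 ≤ T) (γ : Profile Y U T) (k : ι) (g : Strategy Y U T k)
    {t N : ℕ} (ht : t < N) :
    ∀ᵐ p ∂(M.law N (Function.update γ k g)).map (fun ω => (info T t k ω, ω.2.2 t k)),
      condDistrib (fun ω => (hidden T t k ω, ω.1 (t + 1), ω.2.1 (t + 1) k))
          (fun ω => (info T t k ω, ω.2.2 t k)) (M.law N (Function.update γ k g)) p =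
        M.infoTransition γ k t p := by
  have hi : Measurable fun ω : Path X Y U => (info T t k ω, ω.2.2 t k) :=
    (measurable_info t k).prodMk (by fun_prop)
  have hz : Measurable fun ω : Path X Y U => (hidden T t k ω, ω.1 (t + 1), ω.2.1 (t + 1) k) :=
    (measurable_hidden t k).prodMk (by fun_prop)
  have hci : ∀ ω ω' : Path X Y U, Agree t (t + 1) ω ω' →
      (info T t k ω, ω.2.2 t k) = (info T t k ω', ω'.2.2 t k) := fun ω ω' h => by
    rw [info_congr hT (h.mono le_rfl (Nat.le_succ t)), h.2.2 t (Nat.lt_succ_self t)]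
  have hcz : ∀ ω ω' : Path X Y U, Agree t (t + 1) ω ω' →
      (hidden T t k ω, ω.1 (t + 1), ω.2.1 (t + 1) k) =
        (hidden T t k ω', ω'.1 (t + 1), ω'.2.1 (t + 1) k) := fun ω ω' h => by
    rw [hidden_congr (h.mono le_rfl (Nat.le_succ t)), h.1 (t + 1) (Nat.le_succ t) le_rfl,
      h.2.1 (t + 1) le_rfl]
  have ht' : t + 1 ≤ N := ht
  refine condDistrib_ae_eq_of_measure_eq_compProd _ hz.aemeasurable ?_
  rw [M.map_law _ ht' (hi.prodMk hz) fun ω ω' h => Prod.ext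
      (hci ω ω' (h.mono (Nat.zero_le _) le_rfl)) (hcz ω ω' (h.mono (Nat.zero_le _) le_rfl)),
    M.map_law _ ht' hi fun ω ω' h => hci ω ω' (h.mono (Nat.zero_le _) le_rfl)]
  have := Measure.isProbabilityMeasure_map
    (μ := M.preLaw (Function.update γ k g) (t + 1)) hi.aemeasurable
  refine Measure.ext_of_lintegral _ fun φ hφ => ?_
  have hG : Measurable fun p => ∫⁻ z, φ (p, z) ∂M.infoTransition γ k t p :=
    hφ.lintegral_kernel_prod_right'
  have hd := M.lintegral_preLaw_posterior hT γ k g t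
  rw [lintegral_map hφ (hi.prodMk hz), Measure.lintegral_compProd hφ, lintegral_map hG hi,
    M.lintegral_preLaw_succ hT γ k g t hd
      (f := fun ω => φ ((info T t k ω, ω.2.2 t k), hidden T t k ω, ω.1 (t + 1), ω.2.1 (t + 1) k))
      (hφ.comp (hi.prodMk hz))
      (fun ω ω' h => by rw [hci ω ω' h, hcz ω ω' h]),
    M.lintegral_preLaw_succ hT γ k g t hd
      (f := fun ω => ∫⁻ z, φ ((info T t k ω, ω.2.2 t k), z)
        ∂M.infoTransition γ k t (info T t k ω, ω.2.2 t k)) (hG.comp hi)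
      (fun ω ω' h => by rw [hci ω ω' h])]
  -- For fixed `I_t^k` the action is fixed as well, so conditioning on the action adds nothing. Both
  -- sides reduce to the same integral against `infoTransition`; in `h2` the integrand is constant.
  refine lintegral_congr fun ω => ?_
  have h1 := M.lintegral_stepLaw_observed hT γ k t (info T t k ω) ((g t).1 (info T t k ω)) hφ
  have h2 := M.lintegral_stepLaw_observed hT γ k t (info T t k ω) ((g t).1 (info T t k ω))
    (hG.comp measurable_fst)
  simp only [Function.comp_apply, lintegral_const, measure_univ, mul_one] at h1 h2 ⊢
  rw [h1, h2]

end Network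

end Posterior

/-! ### Cost-to-go -/

section CostToGo

variable {ι : Type*} [Fintype ι] [DecidableEq ι] {X : ℕ → Type*} {Y U : ℕ → ι → Type*}
  [∀ t, MeasurableSpace (X t)] [∀ t j, MeasurableSpace (Y t j)] [∀ t j, MeasurableSpace (U t j)]
  [∀ t, Nonempty (X t)] [∀ t j, Nonempty (Y t j)] [∀ t j, Nonempty (U t j)]
  [∀ t, StandardBorelSpace (X t)] [∀ t j, StandardBorelSpace (Y t j)]
  [∀ t j, StandardBorelSpace (U t j)] {T : ℕ}

namespace Network

variable (M : Network ι X Y U)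

lemma measurableSet_action_eq (γ : Profile Y U T) (s : ℕ) (j : ι) :
    MeasurableSet {ω : Path X Y U | ω.2.2 s j = (γ j s).1 (info T s j ω)} :=
  measurableSet_eq_fun (by fun_prop) ((γ j s).2.comp (measurable_info s j))

/-- An action, once taken, is never overwritten, and neither is the information it was based on. -/
lemma ae_preLaw_action (hT : 1 ≤ T) (γ : Profile Y U T) {s t : ℕ} (hs : s < t) (j : ι) :
    ∀ᵐ ω ∂M.preLaw γ t, ω.2.2 s j = (γ j s).1 (info T s j ω) := by
  induction t with
  | zero => omega
  | succ t ih =>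
    rw [preLaw, ← Measure.deterministic_comp_eq_map (measurable_act γ t), Measure.comp_assoc]
    refine Measure.ae_comp_of_ae_ae (measurableSet_action_eq γ s j) ?_
    rcases (Nat.lt_succ_iff.mp hs).eq_or_lt with rfl | hs
    · refine ae_of_all _ fun ω => ?_
      rw [Kernel.comp_apply, Kernel.deterministic_apply, Measure.dirac_bind (Kernel.measurable _)]
      filter_upwards [M.ae_advance_agree s (act γ s ω)] with ω' hω'
      rw [hω'.2, ← info_congr hT (((agree_act γ s ω).trans hω'.1).mono (Nat.zero_le _) le_rfl),
        act, setAction_action]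
    · filter_upwards [ih hs] with ω hω
      rw [Kernel.comp_apply, Kernel.deterministic_apply, Measure.dirac_bind (Kernel.measurable _)]
      filter_upwards [M.ae_advance_agree t (act γ t ω)] with ω' hω'
      have hag := (agree_act γ t ω).trans hω'.1
      rw [← info_congr hT (hag.mono (Nat.zero_le _) hs.le), ← hag.2.2 s hs, hω]

/-- The actions of the other agents that become shared are given by their strategies. -/
lemma ae_shared_action (hT : 1 ≤ T) (γ : Profile Y U T) (k : ι) (g : Strategy Y U T k)
    {t N s : ℕ} (ht : t < N) (hs : s + T = t + 1) :
    ∀ᵐ ω ∂M.law N (Function.update γ k g), ∀ᵐ h ∂M.posteriorKernel γ k t (info T t k ω),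
      ∀ u, ∀ j, j ≠ k → (afterAction γ k t (info T t k ω) h u).2.2 s j =
        (γ j s).1 (info T s j (afterAction γ k t (info T t k ω) h u)) := by
  -- For `T = 1` the action about to be shared is the current one, given by the definition of
  -- `jointAction`. Otherwise it lies in the past and the claim is only almost sure.
  rcases (show s ≤ t by omega).eq_or_lt with rfl | hst
  · refine ae_of_all _ fun ω => ae_of_all _ fun h u j hj => ?_
    rw [afterAction_action, jointAction_of_ne _ _ _ _ _ _ hj,
      info_afterAction_of_ne hT γ k s _ h u ⟨j, hj⟩]
  have hm : Measurable fun ω : Path X Y U => (info T t k ω, hidden T t k ω) :=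
    (measurable_info _ _).prodMk (measurable_hidden _ _)
  have hset : MeasurableSet {p : Info Y U T t k × Hidden X Y U T t k | ∀ j, j ≠ k →
      (join T t k p.1 p.2).2.2 s j = (γ j s).1 (info T s j (join T t k p.1 p.2))} := by
    simp only [Set.ofPred_forall]
    exact MeasurableSet.iInter fun j => MeasurableSet.iInter fun _ =>
      measurable_join t k (measurableSet_action_eq γ s j)
  have h1 : ∀ᵐ ω ∂M.preLaw (Function.update γ k g) t, ∀ j, j ≠ k →
      (join T t k (info T t k ω) (hidden T t k ω)).2.2 s j =
        (γ j s).1 (info T s j (join T t k (info T t k ω) (hidden T t k ω))) := by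
    filter_upwards [ae_all_iff.mpr (M.ae_preLaw_action hT (Function.update γ k g) hst)]
      with ω hω j hj
    have hag := agree_join (T := T) t k ω
    have hinfo : info T s j ω = info T s j (join T t k (info T t k ω) (hidden T t k ω)) :=
      info_ext (fun r i hr => by rw [hag.2.1 r (by omega)])
        (fun r i hr => by rw [hag.2.2 r (by omega)])
        (fun r hr => by rw [hag.2.1 r (by omega)]) (fun r hr => by rw [hag.2.2 r (by omega)])
    have := hω j
    rw [Function.update_of_ne hj] at this
    rw [← hinfo, ← hag.2.2 s hst, this]
  have h2 := (ae_map_iff hm.aemeasurable hset).mpr h1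
  rw [M.preLaw_map_eq_compProd hT] at h2
  have := Measure.isProbabilityMeasure_map (μ := M.preLaw (Function.update γ k g) t)
    (measurable_info (T := T) t k).aemeasurable
  -- Disintegration along the posterior turns an almost sure property of the actual hidden variables
  -- into one of posterior-almost every hidden value.
  have h3 := Measure.ae_ae_of_ae_compProd h2
  rw [← M.map_info_law hT _ _ ht.le] at h3
  filter_upwards [ae_of_ae_map (measurable_info t k).aemeasurable h3] with ω hω
  filter_upwards [hω] with h hh u j hj
  -- Setting the actions at time `t` does not affect time `s < t`, so one null set serves all `u`.
  have hag := agree_setAction t (join T t k (info T t k ω) h)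
    (jointAction γ k t (info T t k ω).1 h.2 u)
  rw [afterAction, ← info_congr hT (hag.mono (Nat.zero_le _) hst.le), ← hag.2.2 s hst]
  exact hh j hj

lemma posteriorKernel_update (γ : Profile Y U T) (k : ι) (g : Strategy Y U T k) (t : ℕ) :
    M.posteriorKernel (Function.update γ k g) k t = M.posteriorKernel γ k t := by
  refine Kernel.ext fun i => ?_
  change (M.posterior (Function.update γ k g) k t i).1 = (M.posterior γ k t i).1
  rw [posterior_update]

lemma measurable_join_right (t : ℕ) (k : ι) (i : Info Y U T t k) :
    Measurable (join T t k i : Hidden X Y U T t k → Path X Y U) :=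
  (measurable_join t k).comp measurable_prodMk_left

lemma costToGo_eq (N : ℕ) (γ : Profile Y U T) (k : ι) (t : ℕ) (i : Info Y U T t k) :
    M.costToGo N γ k t i = eint (M.posteriorKernel γ k t i)
      fun h => M.pathCostToGo N γ t (join T t k i h) := by
  have := Measure.isProbabilityMeasure_map (μ := M.posteriorKernel γ k t i)
    (measurable_join_right (X := X) t k i).aemeasurable
  calc M.costToGo N γ k t i
      = eint (M.run γ t (N - t) ∘ₘ (M.posteriorKernel γ k t i).map (join T t k i))
          (M.pathCost N t) := rfl
    _ = eint ((M.posteriorKernel γ k t i).map (join T t k i)) (M.pathCostToGo N γ t) :=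
        eint_comp (M.pathCost_isLowerBounded N t)
    _ = _ := eint_map (measurable_join_right t k i) (M.pathCostToGo_isLowerBounded N γ t).measurable

lemma costToGo_isLowerBounded (N : ℕ) (γ : Profile Y U T) (k : ι) (t : ℕ) :
    IsLowerBounded (M.costToGo N γ k t) := by
  have h : IsLowerBounded fun p : Info Y U T t k × Hidden X Y U T t k =>
      M.pathCostToGo N γ t (join T t k p.1 p.2) :=
    (M.pathCostToGo_isLowerBounded N γ t).comp (measurable_join t k)
  have h' := h.eint (κ := M.posteriorKernel γ k t)
  rwa [show M.costToGo N γ k t = fun i => eint (M.posteriorKernel γ k t i)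
      fun h => M.pathCostToGo N γ t (join T t k i h) from funext (M.costToGo_eq N γ k t)]

lemma costToGo_congr {N : ℕ} {γ γ' : Profile Y U T} {k : ι} {t : ℕ}
    (hp : M.posterior γ k t = M.posterior γ' k t) (h : ∀ s ≥ t, ∀ j, γ j s = γ' j s)
    (i : Info Y U T t k) : M.costToGo N γ k t i = M.costToGo N γ' k t i := by
  unfold costToGo condLaw
  rw [hp, M.run_congr h]

lemma actionCost_isLowerBounded (γ : Profile Y U T) (k : ι) (t : ℕ) (i : Info Y U T t k)
    (u : U t k) : IsLowerBounded (M.actionCost γ k t i u) :=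
  (M.cost_isLowerBounded t).comp (measurable_fst.prodMk
    ((measurable_jointAction γ k t).comp (by fun_prop :
      Measurable fun h : Hidden X Y U T t k => (i.1, h.2, u))))

lemma eint_stepLaw (γ : Profile Y U T) (k : ι) (t : ℕ) (i : Info Y U T t k) (u : U t k)
    {f : Path X Y U → EReal} (hf : IsLowerBounded f) :
    eint (M.stepLaw γ k t i u) f = eint (M.posteriorKernel γ k t i)
      fun h => eint (M.advance t (afterAction γ k t i h u)) f := by
  have := Measure.isProbabilityMeasure_map (μ := M.posteriorKernel γ k t i)
    (measurable_afterAction_right γ k t i u).aemeasurable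
  rw [stepLaw, eint_comp hf, eint_map (measurable_afterAction_right γ k t i u)]
  exact ((hf.comp measurable_snd :
    IsLowerBounded fun p : Path X Y U × Path X Y U => f p.2).eint).measurable

/-- The tower property at time `t + 1` for fixed `(i, u)`: the trajectory is replaced by its
reconstruction, the hidden variables are integrated against the new posterior, and the law of the
new information is expressed by `infoTransition`. -/
lemma eint_stepLaw_pathCostToGo (hT : 1 ≤ T) (γ : Profile Y U T) (k : ι) (g : Strategy Y U T k)
    {t N : ℕ} (ht : t < N) (i : Info Y U T t k) (u : U t k) :
    eint (M.stepLaw γ k t i u) (M.pathCostToGo N (Function.update γ k g) (t + 1)) =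
      eint (M.infoTransition γ k t (i, u)) fun z =>
        M.costToGo N (Function.update γ k g) k (t + 1) (nextInfo γ k t i z.1 u z.2.2) := by
  set Γ := Function.update γ k g
  have hL : IsLowerBounded fun p : Info Y U T (t + 1) k × Hidden X Y U T (t + 1) k =>
      M.pathCostToGo N Γ (t + 1) (join T (t + 1) k p.1 p.2) :=
    (M.pathCostToGo_isLowerBounded N Γ (t + 1)).comp (measurable_join (t + 1) k)
  have hm : Measurable fun ω : Path X Y U => (info T (t + 1) k ω, hidden T (t + 1) k ω) :=
    (measurable_info _ _).prodMk (measurable_hidden _ _)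
  have := Measure.isProbabilityMeasure_map (μ := M.stepLaw γ k t i u)
    (measurable_info (T := T) (t + 1) k).aemeasurable
  have hcost : ∀ i', (eint (M.posteriorKernel γ k (t + 1) i') fun h =>
      M.pathCostToGo N Γ (t + 1) (join T (t + 1) k i' h)) = M.costToGo N Γ k (t + 1) i' :=
    fun i' => by rw [costToGo_eq, posteriorKernel_update]
  calc eint (M.stepLaw γ k t i u) (M.pathCostToGo N Γ (t + 1))
      = eint (M.stepLaw γ k t i u) fun ω => M.pathCostToGo N Γ (t + 1)
          (join T (t + 1) k (info T (t + 1) k ω) (hidden T (t + 1) k ω)) :=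
        eint_congr_ae (ae_of_all _ fun ω => M.pathCostToGo_congr hT Γ ht (agree_join (t + 1) k ω))
    _ = eint ((M.stepLaw γ k t i u).map (info T (t + 1) k) ⊗ₘ M.posteriorKernel γ k (t + 1))
          fun p => M.pathCostToGo N Γ (t + 1) (join T (t + 1) k p.1 p.2) := by
        rw [← M.stepLaw_map_eq_compProd hT, eint_map hm hL.measurable]
    _ = eint ((M.stepLaw γ k t i u).map (info T (t + 1) k)) (M.costToGo N Γ k (t + 1)) := by
        rw [eint_compProd hL]
        simp only [hcost]
    _ = _ := by
        rw [M.map_info_stepLaw hT, eint_map (measurable_nextInfo γ k t i u)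
          (M.costToGo_isLowerBounded N Γ k (t + 1)).measurable]

/-- The cost-to-go of a strategy satisfies the dynamic programming recursion without the
minimization. -/
lemma costToGo_eq_dpCost (hT : 1 ≤ T) (γ : Profile Y U T) (k : ι) (g : Strategy Y U T k)
    {t N : ℕ} (ht : t ≤ N) (i : Info Y U T t k) :
    M.costToGo N (Function.update γ k g) k t i =
      M.dpCost N γ k (M.costToGo N (Function.update γ k g) k) t (M.posterior γ k t i) i
        ((g t).1 i) := by
  set Γ := Function.update γ k g with hΓ
  have hact : ∀ h : Hidden X Y U T t k, (act Γ t (join T t k i h)).2.2 t = jointAction γ k t i.1 h.2 ((g t).1 i) :=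
    fun h => by rw [hΓ, act_join, afterAction_action]
  have hstate : ∀ h : Hidden X Y U T t k, (join T t k i h).1 t = h.1 := fun h => by
    simp [join, fill]
  have hL := M.pathCostToGo_isLowerBounded N Γ (t + 1)
  rw [costToGo_eq, hΓ, posteriorKernel_update, ← hΓ, dpCost]
  rcases ht.eq_or_lt with rfl | ht
  · rw [if_neg (lt_irrefl _), add_zero]
    refine eint_congr_ae (ae_of_all _ fun h => ?_)
    change M.pathCostToGo t Γ t _ = _
    rw [pathCostToGo_self, hact, hstate]
    rfl
  · have h1 : ∀ h, M.pathCostToGo N Γ t (join T t k i h) =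
        M.actionCost γ k t i ((g t).1 i) h +
          eint (M.advance t (afterAction γ k t i h ((g t).1 i)))
            (M.pathCostToGo N Γ (t + 1)) := fun h => by
      rw [M.pathCostToGo_of_lt Γ ht, hact, hstate, hΓ, act_join]
      rfl
    have hA : IsLowerBounded fun h => eint (M.advance t (afterAction γ k t i h ((g t).1 i)))
        (M.pathCostToGo N Γ (t + 1)) :=
      ((hL.comp measurable_snd : IsLowerBounded fun p : Path X Y U × Path X Y U =>
        M.pathCostToGo N Γ (t + 1) p.2).eint (κ := M.advance t)).comp
          (measurable_afterAction_right γ k t i ((g t).1 i))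
    rw [if_pos ht, eint_congr_ae (ae_of_all _ h1),
      eint_add (M.actionCost_isLowerBounded γ k t i _) hA, ← M.eint_stepLaw γ k t i _ hL,
      M.eint_stepLaw_pathCostToGo hT γ k g ht]
    rfl

lemma isCondExpectation_costToGo (hT : 1 ≤ T) (γ : Profile Y U T) (k : ι)
    (g : Strategy Y U T k) {t N : ℕ} (ht : t ≤ N) :
    IsCondExpectation (M.law N (Function.update γ k g)) (info T t k) (M.pathCost N t)
      (M.costToGo N (Function.update γ k g) k t) := by
  set Γ := Function.update γ k g with hΓ
  have hJ := M.costToGo_isLowerBounded N Γ k t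
  refine ⟨hJ.measurable, fun A hA => ?_⟩
  have hi : Measurable (info T t k : Path X Y U → _) := measurable_info t k
  have hm : Measurable fun ω : Path X Y U => (info T t k ω, hidden T t k ω) :=
    hi.prodMk (measurable_hidden _ _)
  have := Measure.isProbabilityMeasure_map (μ := M.preLaw Γ t) hi.aemeasurable
  have hF : IsLowerBounded ((A ×ˢ Set.univ).indicator
      fun p : Info Y U T t k × Hidden X Y U T t k =>
        M.pathCostToGo N Γ t (join T t k p.1 p.2)) :=
    ((M.pathCostToGo_isLowerBounded N Γ t).comp (measurable_join t k)).indicator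
      (hA.prod MeasurableSet.univ)
  -- The evolution from time `t` leaves `I_t^k` unchanged, so the indicator of the conditioning
  -- event can be taken out.
  have h1 : ∀ ω, eint (M.run Γ t (N - t) ω) ((info T t k ⁻¹' A).indicator (M.pathCost N t)) =
      (A ×ˢ Set.univ).indicator (fun p : Info Y U T t k × Hidden X Y U T t k =>
        M.pathCostToGo N Γ t (join T t k p.1 p.2)) (info T t k ω, hidden T t k ω) := by
    intro ω
    have hinfo : ∀ᵐ ω' ∂M.run Γ t (N - t) ω, info T t k ω' = info T t k ω := by
      filter_upwards [M.ae_run_agree Γ t (N - t) ω] with ω' hω'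
      exact (info_congr hT (hω'.1.mono (Nat.zero_le _) le_rfl) k).symm
    by_cases hω : info T t k ω ∈ A
    · rw [Set.indicator_of_mem (by simpa using hω),
        ← M.pathCostToGo_congr hT Γ ht (agree_join t k ω)]
      refine eint_congr_ae ?_
      filter_upwards [hinfo] with ω' hω'
      rw [Set.indicator_of_mem (by simpa [hω'] using hω)]
    · rw [Set.indicator_of_notMem (by simpa using hω)]
      refine (eint_congr_ae ?_).trans (eint_zero _)
      filter_upwards [hinfo] with ω' hω'
      rw [Set.indicator_of_notMem (by simpa [hω'] using hω)]
  have h2 : ∀ i, (eint (M.posteriorKernel γ k t i) fun h => (A ×ˢ Set.univ).indicator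
      (fun p : Info Y U T t k × Hidden X Y U T t k =>
        M.pathCostToGo N Γ t (join T t k p.1 p.2)) (i, h)) =
      A.indicator (M.costToGo N Γ k t) i := by
    intro i
    by_cases hiA : i ∈ A
    · rw [Set.indicator_of_mem hiA, costToGo_eq, hΓ, posteriorKernel_update]
      simp [Set.indicator, hiA]
    · simp [Set.indicator, hiA, eint_zero]
  calc eint (M.law N Γ) ((info T t k ⁻¹' A).indicator (M.pathCost N t))
      = eint (M.preLaw Γ t) fun ω => (A ×ˢ Set.univ).indicator
          (fun p : Info Y U T t k × Hidden X Y U T t k =>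
            M.pathCostToGo N Γ t (join T t k p.1 p.2)) (info T t k ω, hidden T t k ω) := by
        rw [M.law_eq Γ ht, eint_comp ((M.pathCost_isLowerBounded N t).indicator (hi hA))]
        simp only [h1]
    _ = eint ((M.preLaw Γ t).map (info T t k)) (A.indicator (M.costToGo N Γ k t)) := by
        rw [← eint_map hm hF.measurable, hΓ, M.preLaw_map_eq_compProd hT, ← hΓ,
          eint_compProd hF]
        simp only [h2]
    _ = eint (M.law N Γ) ((info T t k ⁻¹' A).indicator
          fun ω => M.costToGo N Γ k t (info T t k ω)) := by
        rw [← M.map_info_law hT Γ k ht, eint_map hi (hJ.indicator hA).measurable]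
        rfl

/-- The law of the initial information does not involve any strategy. Payoffs can therefore be
compared by comparing costs-to-go pointwise. -/
lemma payoff_eq (hT : 1 ≤ T) (γ : Profile Y U T) (k : ι) (g : Strategy Y U T k) (N : ℕ) :
    M.payoff N (Function.update γ k g) = eint (M.initLaw.map (info T 0 k))
      (M.costToGo N (Function.update γ k g) k 0) := by
  have h := (M.isCondExpectation_costToGo hT γ k g (Nat.zero_le N)).2 Set.univ MeasurableSet.univ
  simp only [Set.preimage_univ, Set.indicator_univ] at h
  rw [payoff, h, ← eint_map (measurable_info 0 k)
    (M.costToGo_isLowerBounded N (Function.update γ k g) k 0).measurable,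
    M.map_info_law hT _ _ (Nat.zero_le N)]
  rfl

end Network

end CostToGo

/-! ### Dynamic programming -/

lemma ae_lt_top_of_eint_lt_top {α : Type*} [MeasurableSpace α] {μ : Measure α}
    [IsProbabilityMeasure μ] {f : α → EReal} (hf : IsLowerBounded f) (h : eint μ f < ⊤) :
    ∀ᵐ a ∂μ, f a < ⊤ := by
  obtain ⟨c, hc⟩ := hf.exists_bound
  have hF := eint_add_eq_lintegral μ hf.measurable hc
  have h2 : ∫⁻ a, (f a + ((c : ℝ) : EReal)).toENNReal ∂μ ≠ ∞ := by
    intro h'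
    rw [h'] at hF
    have : eint μ f + ((c : ℝ) : EReal) < ⊤ := EReal.add_lt_top h.ne (by simp)
    rw [hF] at this
    simp at this
  filter_upwards [ae_lt_top (hf.measurable_shift c) h2] with a ha
  refine lt_top_iff_ne_top.mpr fun hfa => ?_
  simp [hfa] at ha

section DynamicProgramming

variable {ι : Type*} [Fintype ι] [DecidableEq ι] {X : ℕ → Type*} {Y U : ℕ → ι → Type*}
  [∀ t, MeasurableSpace (X t)] [∀ t j, MeasurableSpace (Y t j)] [∀ t j, MeasurableSpace (U t j)]
  [∀ t, Nonempty (X t)] [∀ t j, Nonempty (Y t j)] [∀ t j, Nonempty (U t j)]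
  [∀ t, StandardBorelSpace (X t)] [∀ t j, StandardBorelSpace (Y t j)]
  [∀ t j, StandardBorelSpace (U t j)] {T : ℕ}

namespace Network

variable (M : Network ι X Y U)

/-- `eint` is monotone without measurability, so this applies to the value process before its
measurability is known. -/
lemma dpCost_mono {N : ℕ} {γ : Profile Y U T} {k : ι} {W W' : ∀ t, Info Y U T t k → EReal}
    {t : ℕ} (h : t < N → ∀ i, W (t + 1) i ≤ W' (t + 1) i)
    (ξ : ProbabilityMeasure (Hidden X Y U T t k)) (i : Info Y U T t k) (u : U t k) :
    M.dpCost N γ k W t ξ i u ≤ M.dpCost N γ k W' t ξ i u := by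
  unfold dpCost
  refine add_le_add le_rfl ?_
  split_ifs with ht
  · exact eint_mono _ fun z => h ht _
  · exact le_rfl

lemma dpCost_congr {N : ℕ} {γ : Profile Y U T} {k : ι} {W W' : ∀ t, Info Y U T t k → EReal}
    {t : ℕ} (h : t < N → ∀ i, W (t + 1) i = W' (t + 1) i)
    (ξ : ProbabilityMeasure (Hidden X Y U T t k)) (i : Info Y U T t k) (u : U t k) :
    M.dpCost N γ k W t ξ i u = M.dpCost N γ k W' t ξ i u :=
  le_antisymm (M.dpCost_mono (fun ht i => (h ht i).le) ξ i u)
    (M.dpCost_mono (fun ht i => (h ht i).ge) ξ i u)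

/-- Backward induction over the times `t ≤ N`. -/
lemma backward_induction {N : ℕ} {P : ℕ → Prop} (h : ∀ t ≤ N, (t < N → P (t + 1)) → P t)
    {t : ℕ} (ht : t ≤ N) : P t := by
  obtain ⟨m, rfl⟩ := Nat.exists_eq_add_of_le ht
  induction m generalizing t with
  | zero => exact h t le_rfl fun h' => absurd h' (lt_irrefl _)
  | succ m ih =>
    refine h t ht fun _ => ih ?_ (by omega)
    intro s hs hs'
    exact h s (by omega) fun hlt => hs' (by omega)

/-- The value process is the infimum of the cost-to-go over all strategies of agent `k`. -/
lemma value_eq_iInf (N : ℕ) (γ : Profile Y U T) (k : ι) (t : ℕ) (i : Info Y U T t k) :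
    M.value N γ k t i = ⨅ g : Strategy Y U T k, M.costToGo N (Function.update γ k g) k t i := by
  refine le_antisymm (le_iInf fun g => ?_) (le_iInf fun g => iInf_le _ g.1)
  -- Splice `γ k` before time `t` with `g` afterwards: the cost-to-go at `t` uses strategies from
  -- `t` on only, and the posterior ignores those of agent `k`.
  let g' : Strategy Y U T k := fun s => if s < t then γ k s else g s
  have hg' : ∀ s < t, g' s = γ k s := fun s hs => if_pos hs
  refine (iInf_le _ (⟨g', hg'⟩ : {g : Strategy Y U T k // ∀ s < t, g s = γ k s})).trans
    (le_of_eq ?_)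
  refine M.costToGo_congr (by rw [posterior_update, posterior_update]) (fun s hs j => ?_) i
  by_cases hj : j = k
  · subst hj
    simp only [Function.update_self]
    exact if_neg (by omega)
  · simp [Function.update_of_ne hj]

lemma value_le_costToGo (N : ℕ) (γ : Profile Y U T) (k : ι) (g : Strategy Y U T k) (t : ℕ)
    (i : Info Y U T t k) : M.value N γ k t i ≤ M.costToGo N (Function.update γ k g) k t i := by
  rw [value_eq_iInf]; exact iInf_le _ g

lemma value_update (N : ℕ) (γ : Profile Y U T) (k : ι) (g : Strategy Y U T k) (t : ℕ)
    (i : Info Y U T t k) : M.value N (Function.update γ k g) k t i = M.value N γ k t i := by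
  simp only [value_eq_iInf, Function.update_idem]

/-- Solutions of the dynamic programming equations are lower bounds of the cost-to-go. -/
lemma IsDPSolution.le_costToGo (hT : 1 ≤ T) {N : ℕ} {γ : Profile Y U T} {k : ι}
    {W : ∀ t, Info Y U T t k → EReal} (hW : M.IsDPSolution N γ k W) (g : Strategy Y U T k)
    {t : ℕ} (ht : t ≤ N) (i : Info Y U T t k) :
    W t i ≤ M.costToGo N (Function.update γ k g) k t i := by
  refine backward_induction (N := N)
    (P := fun t => ∀ i, W t i ≤ M.costToGo N (Function.update γ k g) k t i) ?_ ht i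
  intro t ht ih i
  rw [(hW t ht).2 i, M.costToGo_eq_dpCost hT γ k g ht]
  exact (iInf_le _ ((g t).1 i)).trans (M.dpCost_mono ih _ i _)

/-- A strategy which achieves the infimum in the dynamic programming equations has cost-to-go
equal to the solution. -/
lemma IsDPSolution.eq_costToGo (hT : 1 ≤ T) {N : ℕ} {γ : Profile Y U T} {k : ι}
    {W : ∀ t, Info Y U T t k → EReal} (hW : M.IsDPSolution N γ k W) {g : Strategy Y U T k}
    (hg : M.IsMinimizer N γ k W g) {t : ℕ} (ht : t ≤ N) (i : Info Y U T t k) :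
    W t i = M.costToGo N (Function.update γ k g) k t i := by
  refine backward_induction (N := N)
    (P := fun t => ∀ i, W t i = M.costToGo N (Function.update γ k g) k t i) ?_ ht i
  intro t ht ih i
  rw [(hW t ht).2 i, ← hg t ht i, M.costToGo_eq_dpCost hT γ k g ht]
  exact M.dpCost_congr ih _ i _

/-- A strategy which achieves the infima for the value process is optimal. -/
lemma IsMinimizer.costToGo_eq_value (hT : 1 ≤ T) {N : ℕ} {γ : Profile Y U T} {k : ι}
    {g : Strategy Y U T k} (hg : M.IsMinimizer N γ k (M.value N γ k) g) {t : ℕ} (ht : t ≤ N)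
    (i : Info Y U T t k) :
    M.costToGo N (Function.update γ k g) k t i = M.value N γ k t i ∧
      M.value N γ k t i = ⨅ u, M.dpCost N γ k (M.value N γ k) t (M.posterior γ k t i) i u := by
  refine backward_induction (N := N)
    (P := fun t => ∀ i, M.costToGo N (Function.update γ k g) k t i = M.value N γ k t i ∧
      M.value N γ k t i = ⨅ u, M.dpCost N γ k (M.value N γ k) t (M.posterior γ k t i) i u)
    ?_ ht i
  intro t ht ih i
  have h1 : M.costToGo N (Function.update γ k g) k t i =
      ⨅ u, M.dpCost N γ k (M.value N γ k) t (M.posterior γ k t i) i u := by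
    rw [← hg t ht i, M.costToGo_eq_dpCost hT γ k g ht]
    exact M.dpCost_congr (fun h i => (ih h i).1) _ i _
  have h2 : M.costToGo N (Function.update γ k g) k t i = M.value N γ k t i := by
    -- Any competitor `g'` has continuation cost at least the value, so its cost-to-go is at least
    -- the infimum, which `g` attains. No infimum is interchanged with an integral.
    refine le_antisymm ?_ (M.value_le_costToGo N γ k g t i)
    rw [h1, value_eq_iInf]
    refine le_iInf fun g' => ?_
    rw [M.costToGo_eq_dpCost hT γ k g' ht]
    exact (iInf_le _ ((g' t).1 i)).trans
      (M.dpCost_mono (fun _ i => M.value_le_costToGo N γ k g' (t + 1) i) _ i _)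
  exact ⟨h2, h2 ▸ h1⟩

/-- An infimum over uncountably many strategies need not be measurable; here it is the cost-to-go of
a single strategy. -/
lemma IsMinimizer.value_isLowerBounded (hT : 1 ≤ T) {N : ℕ} {γ : Profile Y U T} {k : ι}
    {g : Strategy Y U T k} (hg : M.IsMinimizer N γ k (M.value N γ k) g) {t : ℕ} (ht : t ≤ N) :
    IsLowerBounded (M.value N γ k t) := by
  have : M.costToGo N (Function.update γ k g) k t = M.value N γ k t :=
    funext fun i => (hg.costToGo_eq_value M hT ht i).1
  exact this ▸ M.costToGo_isLowerBounded N _ k t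

lemma IsMinimizer.isDPSolution (hT : 1 ≤ T) {N : ℕ} {γ : Profile Y U T} {k : ι}
    {g : Strategy Y U T k} (hg : M.IsMinimizer N γ k (M.value N γ k) g) :
    M.IsDPSolution N γ k (M.value N γ k) := fun _ ht =>
  ⟨(hg.value_isLowerBounded M hT ht).measurable,
    fun i => (hg.costToGo_eq_value M hT ht i).2⟩

/-- Allows the running cost to be integrated against the transition law, so that the two integrals
in `dpCost` merge into one. -/
lemma map_fst_infoTransition (γ : Profile Y U T) (k : ι) (t : ℕ) (i : Info Y U T t k)
    (u : U t k) :
    (M.infoTransition γ k t (i, u)).map Prod.fst = M.posteriorKernel γ k t i := by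
  refine Measure.ext_of_lintegral _ fun f hf => ?_
  rw [lintegral_map hf measurable_fst, infoTransition, Kernel.comap_apply,
    M.lintegral_transition _ _ _ _ (φ := fun z => f z.1) (hf.comp measurable_fst)]
  simp only [lintegral_const, measure_univ, mul_one]
  rfl

lemma dpCost_eq_eint_infoTransition {N : ℕ} {γ : Profile Y U T} {k : ι}
    {W : ∀ t, Info Y U T t k → EReal} {t : ℕ} (ht : t < N) (hW : IsLowerBounded (W (t + 1)))
    (i : Info Y U T t k) (u : U t k) :
    M.dpCost N γ k W t (M.posterior γ k t i) i u =
      eint (M.infoTransition γ k t (i, u)) fun z =>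
        M.actionCost γ k t i u z.1 + W (t + 1) (nextInfo γ k t i z.1 u z.2.2) := by
  have hc := M.actionCost_isLowerBounded γ k t i u
  rw [eint_add (hc.comp measurable_fst) (hW.comp (measurable_nextInfo γ k t i u)),
    ← eint_map measurable_fst hc.measurable, map_fst_infoTransition, dpCost, if_pos ht]
  rfl

lemma dpCost_last (N : ℕ) (γ : Profile Y U T) (k : ι) (W : ∀ t, Info Y U T t k → EReal)
    (ξ : ProbabilityMeasure (Hidden X Y U T N k)) (i : Info Y U T N k) (u : U N k) :
    M.dpCost N γ k W N ξ i u =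
      eint (ξ : Measure (Hidden X Y U T N k)) (M.actionCost γ k N i u) := by
  rw [dpCost, if_neg (lt_irrefl _), add_zero]

lemma IsMinimizer.value_last (hT : 1 ≤ T) {N : ℕ} {γ : Profile Y U T} {k : ι}
    {g : Strategy Y U T k} (hg : M.IsMinimizer N γ k (M.value N γ k) g) (i : Info Y U T N k) :
    M.value N γ k N i = ⨅ u : U N k,
      eint (M.posteriorKernel γ k N i) (M.actionCost γ k N i u) := by
  rw [(hg.costToGo_eq_value M hT le_rfl i).2]
  simp only [dpCost_last]
  rfl

lemma IsMinimizer.value_of_lt (hT : 1 ≤ T) {N : ℕ} {γ : Profile Y U T} {k : ι}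
    {g : Strategy Y U T k} (hg : M.IsMinimizer N γ k (M.value N γ k) g) {t : ℕ} (ht : t < N)
    (i : Info Y U T t k) :
    M.value N γ k t i = ⨅ u : U t k,
      eint (M.infoTransition γ k t (i, u)) (fun z => M.actionCost γ k t i u z.1 +
        M.value N γ k (t + 1) (nextInfo γ k t i z.1 u z.2.2)) := by
  rw [(hg.costToGo_eq_value M hT ht.le i).2]
  exact iInf_congr fun u =>
    M.dpCost_eq_eint_infoTransition ht (hg.value_isLowerBounded M hT ht) i u

lemma isConditionallyMarkov (γ : Profile Y U T) (k : ι) : M.IsConditionallyMarkov γ k :=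
  fun t => ⟨fun p => ⟨M.filter γ t k p, inferInstance⟩,
    Measurable.subtype_mk (M.filter γ t k).measurable, fun _ => rfl⟩

/-- Measurable selectors yield a semi-separated strategy that achieves the infima. -/
lemma HasSelectors.exists_isSemiSeparated {N : ℕ} {γ : Profile Y U T} {k : ι}
    {W : ∀ t, Info Y U T t k → EReal} (h : M.HasSelectors N γ k W) :
    ∃ g : Strategy Y U T k, M.IsSemiSeparated N γ k g ∧ M.IsMinimizer N γ k W g := by
  choose σ hσm hσ using h
  have hpost := fun t => M.measurable_posterior γ k t
  let g : Strategy Y U T k := fun t =>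
    if ht : t ≤ N then
      if t < N then ⟨fun i => σ t ht (M.posterior γ k t i, i),
        (hσm t ht).comp ((hpost t).prodMk measurable_id)⟩
      else ⟨fun i => σ t ht (M.posterior γ k t i, i.1, Classical.arbitrary _),
        (hσm t ht).comp ((hpost t).prodMk (measurable_fst.prodMk measurable_const))⟩
    else γ k t
  have hlt : ∀ t (ht : t < N) i, (g t).1 i = σ t ht.le (M.posterior γ k t i, i) :=
    fun t ht i => by simp [g, ht, ht.le]
  have hN : ∀ i, (g N).1 i = σ N le_rfl (M.posterior γ k N i, i.1, Classical.arbitrary _) :=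
    fun i => by simp [g]
  refine ⟨g, ⟨fun t ht => ⟨fun p => σ t ht.le (p.1, p.2.1, p.2.2), ?_, hlt t ht⟩,
    fun p => σ N le_rfl (p.1, p.2, Classical.arbitrary _), ?_, hN⟩, fun t ht i => ?_⟩
  · exact hσm t ht.le
  · exact (hσm N le_rfl).comp
      (measurable_fst.prodMk (measurable_snd.prodMk measurable_const))
  · rcases ht.eq_or_lt with rfl | ht
    · have := hσ t le_rfl (M.posterior γ k t i) (i.1, Classical.arbitrary _)
      rw [hN i]
      simp only [dpCost_last] at this ⊢
      exact this
    · rw [hlt t ht i, hσ t ht.le]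

/-! ### Almost sure optimality along the trajectories of an equilibrium. -/

lemma payoff_eq_self (hT : 1 ≤ T) (γ : Profile Y U T) (k : ι) (N : ℕ) :
    M.payoff N γ = eint (M.initLaw.map (info T 0 k)) (M.costToGo N γ k 0) := by
  simpa using M.payoff_eq hT γ k (γ k) N

/-- The null-set version of `lintegral_preLaw_succ`, applied to the indicator of the exceptional
set. -/
lemma ae_preLaw_succ_of_ae_stepLaw (hT : 1 ≤ T) (γ : Profile Y U T) (k : ι) (t : ℕ)
    {p : Info Y U T (t + 1) k → Prop} (hp : MeasurableSet {i | p i})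
    (h : ∀ᵐ ω ∂M.preLaw γ t, ∀ᵐ i ∂(M.stepLaw γ k t (info T t k ω)
      ((γ k t).1 (info T t k ω))).map (info T (t + 1) k), p i) :
    ∀ᵐ ω ∂M.preLaw γ (t + 1), p (info T (t + 1) k ω) := by
  have hi : Measurable (info T (t + 1) k : Path X Y U → _) := measurable_info (t + 1) k
  have hf : Measurable ({i | p i}ᶜ.indicator (1 : Info Y U T (t + 1) k → ℝ≥0∞)) :=
    measurable_one.indicator hp.compl
  have hs := M.lintegral_preLaw_succ hT γ k (γ k) t
    (M.lintegral_preLaw_posterior hT γ k (γ k) t)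
    (f := fun ω => {i | p i}ᶜ.indicator 1 (info T (t + 1) k ω)) (hf.comp hi)
    (fun ω ω' h => by rw [info_congr hT (h.mono (Nat.le_succ t) le_rfl)])
  rw [Function.update_eq_self] at hs
  have hμ : ∀ μ : Measure (Path X Y U),
      ∫⁻ ω, {i | p i}ᶜ.indicator 1 (info T (t + 1) k ω) ∂μ =
        μ.map (info T (t + 1) k) {i | p i}ᶜ := fun μ => by
    rw [← lintegral_map hf hi, lintegral_indicator_one hp.compl]
  rw [← ae_map_iff hi.aemeasurable hp, ae_iff]
  change (M.preLaw γ (t + 1)).map (info T (t + 1) k) {i | p i}ᶜ = 0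
  rw [← hμ, hs]
  refine (lintegral_congr_ae ?_).trans lintegral_zero
  filter_upwards [h] with ω hω
  rw [hμ]
  exact hω

lemma dpCost_value_le_costToGo (hT : 1 ≤ T) (γ : Profile Y U T) (k : ι) {t N : ℕ} (ht : t ≤ N)
    (i : Info Y U T t k) :
    M.dpCost N γ k (M.value N γ k) t (M.posterior γ k t i) i ((γ k t).1 i) ≤
      M.costToGo N γ k t i := by
  have h := M.costToGo_eq_dpCost hT γ k (γ k) ht i
  rw [Function.update_eq_self] at h
  rw [h]
  exact M.dpCost_mono
    (fun _ i => by simpa using M.value_le_costToGo N γ k (γ k) (t + 1) i) _ i _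

/-- One step of the propagation of optimality along the trajectories of the network. -/
lemma IsMinimizer.ae_stepLaw_costToGo_eq_value (hT : 1 ≤ T) {N : ℕ} {γ : Profile Y U T} {k : ι}
    {g : Strategy Y U T k} (hg : M.IsMinimizer N γ k (M.value N γ k) g) {t : ℕ} (ht : t < N)
    {i : Info Y U T t k} (heq : M.costToGo N γ k t i = M.value N γ k t i)
    (htop : M.costToGo N γ k t i < ⊤) :
    ∀ᵐ i' ∂(M.stepLaw γ k t i ((γ k t).1 i)).map (info T (t + 1) k),
      M.costToGo N γ k (t + 1) i' = M.value N γ k (t + 1) i' ∧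
        M.costToGo N γ k (t + 1) i' < ⊤ := by
  set u := (γ k t).1 i with hu
  have hV := hg.value_isLowerBounded M hT ht
  have hC := M.costToGo_isLowerBounded N γ k (t + 1)
  have hle : ∀ i', M.value N γ k (t + 1) i' ≤ M.costToGo N γ k (t + 1) i' := fun i' => by
    simpa using M.value_le_costToGo N γ k (γ k) (t + 1) i'
  have hn := measurable_nextInfo (X := X) γ k t i u
  set μ := (M.stepLaw γ k t i u).map (info T (t + 1) k) with hμ
  have hμp : IsProbabilityMeasure μ :=
    Measure.isProbabilityMeasure_map (measurable_info (t + 1) k).aemeasurable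
  have hdp : ∀ W : ∀ t, Info Y U T t k → EReal, IsLowerBounded (W (t + 1)) →
      M.dpCost N γ k W t (M.posterior γ k t i) i u =
        eint (M.posteriorKernel γ k t i) (M.actionCost γ k t i u) + eint μ (W (t + 1)) := by
    intro W hW
    rw [hμ, M.map_info_stepLaw hT, eint_map hn hW.measurable, dpCost, if_pos ht]
    rfl
  have hcost : M.costToGo N γ k t i =
      eint (M.posteriorKernel γ k t i) (M.actionCost γ k t i u) +
        eint μ (M.costToGo N γ k (t + 1)) := by
    have h := M.costToGo_eq_dpCost hT γ k (γ k) ht.le i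
    rw [Function.update_eq_self] at h
    rw [h, ← hu, hdp _ hC]
  have hval : M.value N γ k t i ≤
      eint (M.posteriorKernel γ k t i) (M.actionCost γ k t i u) +
        eint μ (M.value N γ k (t + 1)) := by
    rw [← hdp _ hV, (hg.costToGo_eq_value M hT ht.le i).2]
    exact iInf_le _ u
  obtain ⟨c, hc⟩ := hC.exists_bound
  obtain ⟨d, hd⟩ := (M.actionCost_isLowerBounded γ k t i u).exists_bound
  have hCbot : eint μ (M.costToGo N γ k (t + 1)) ≠ ⊥ := fun h => by
    have := neg_le_eint μ hc
    simp [h] at this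
  have hAbot : eint (M.posteriorKernel γ k t i) (M.actionCost γ k t i u) ≠ ⊥ := fun h => by
    have := neg_le_eint (M.posteriorKernel γ k t i) hd
    simp [h] at this
  -- The total is finite and neither summand is `⊥`, so both summands are finite; the running cost
  -- can then be cancelled.
  rw [heq] at hcost htop
  have hAtop : eint (M.posteriorKernel γ k t i) (M.actionCost γ k t i u) ≠ ⊤ := fun h => by
    rw [h, EReal.top_add_of_ne_bot hCbot] at hcost
    exact htop.ne hcost
  have hCtop : eint μ (M.costToGo N γ k (t + 1)) < ⊤ := lt_top_iff_ne_top.mpr fun h => by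
    rw [h, EReal.add_top_of_ne_bot hAbot] at hcost
    exact htop.ne hcost
  have hle' : eint μ (M.costToGo N γ k (t + 1)) ≤ eint μ (M.value N γ k (t + 1)) := by
    rw [hcost] at hval
    generalize eint (M.posteriorKernel γ k t i) (M.actionCost γ k t i u) = a at *
    lift a to ℝ using ⟨hAtop, hAbot⟩
    exact (EReal.addLECancellable_coe a) hval
  filter_upwards [ae_eq_of_eint_le hV hC hle hle' ((eint_mono μ hle).trans_lt hCtop),
    ae_lt_top_of_eint_lt_top hC hCtop] with i' h1 h2
  exact ⟨h1.symm, h2⟩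

/-- Along the trajectories of the network, the cost-to-go of an optimal strategy with finite
payoff is the value process. -/
lemma IsMinimizer.ae_costToGo_eq_value (hT : 1 ≤ T) {N : ℕ} {γ : Profile Y U T} {k : ι}
    {g : Strategy Y U T k} (hg : M.IsMinimizer N γ k (M.value N γ k) g)
    (hopt : M.payoff N γ ≤ M.payoff N (Function.update γ k g)) (htop : M.payoff N γ < ⊤)
    {t : ℕ} (ht : t ≤ N) :
    ∀ᵐ ω ∂M.preLaw γ t,
      M.costToGo N γ k t (info T t k ω) = M.value N γ k t (info T t k ω) ∧
        M.costToGo N γ k t (info T t k ω) < ⊤ := by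
  induction t with
  | zero =>
    have hV := hg.value_isLowerBounded M hT (Nat.zero_le N)
    have hC := M.costToGo_isLowerBounded N γ k 0
    have hp : IsProbabilityMeasure (M.initLaw.map (info T 0 k)) :=
      Measure.isProbabilityMeasure_map (measurable_info 0 k).aemeasurable
    have hle : ∀ i', M.value N γ k 0 i' ≤ M.costToGo N γ k 0 i' := fun i' => by
      simpa using M.value_le_costToGo N γ k (γ k) 0 i'
    have h1 : M.costToGo N (Function.update γ k g) k 0 = M.value N γ k 0 :=
      funext fun i => (hg.costToGo_eq_value M hT (Nat.zero_le N) i).1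
    -- Optimality now says that the expected initial cost-to-go is at most the expected value, while
    -- pointwise it is at least the value.
    rw [M.payoff_eq hT γ k g, h1, M.payoff_eq_self hT γ k] at hopt
    rw [M.payoff_eq_self hT γ k] at htop
    rw [preLaw]
    refine ae_of_ae_map (measurable_info 0 k).aemeasurable
      (p := fun i => M.costToGo N γ k 0 i = M.value N γ k 0 i ∧ M.costToGo N γ k 0 i < ⊤) ?_
    filter_upwards [ae_eq_of_eint_le hV hC hle hopt ((eint_mono _ hle).trans_lt htop),
      ae_lt_top_of_eint_lt_top hC htop] with i h1 h2
    exact ⟨h1.symm, h2⟩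
  | succ t ih =>
    have hV := hg.value_isLowerBounded M hT ht
    have hC := M.costToGo_isLowerBounded N γ k (t + 1)
    refine M.ae_preLaw_succ_of_ae_stepLaw hT γ k t
      (p := fun i => M.costToGo N γ k (t + 1) i = M.value N γ k (t + 1) i ∧
        M.costToGo N γ k (t + 1) i < ⊤)
      ((measurableSet_eq_fun hC.measurable hV.measurable).inter
        (measurableSet_lt hC.measurable measurable_const)) ?_
    filter_upwards [ih (by omega)] with ω hω
    exact hg.ae_stepLaw_costToGo_eq_value M hT ht hω.1 hω.2

lemma IsMinimizer.ae_isOptimal (hT : 1 ≤ T) {N : ℕ} {γ : Profile Y U T} {k : ι}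
    {g : Strategy Y U T k} (hg : M.IsMinimizer N γ k (M.value N γ k) g)
    (hopt : M.payoff N γ ≤ M.payoff N (Function.update γ k g)) (htop : M.payoff N γ < ⊤)
    {t : ℕ} (ht : t ≤ N) :
    ∀ᵐ ω ∂M.law N γ,
      M.costToGo N γ k t (info T t k ω) = M.value N γ k t (info T t k ω) ∧
      M.dpCost N γ k (M.value N γ k) t (M.posterior γ k t (info T t k ω)) (info T t k ω)
          ((γ k t).1 (info T t k ω)) =
        ⨅ u : U t k, M.dpCost N γ k (M.value N γ k) t (M.posterior γ k t (info T t k ω))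
          (info T t k ω) u := by
  have hV := hg.value_isLowerBounded M hT ht
  have hC := M.costToGo_isLowerBounded N γ k t
  have hi : Measurable (info T t k : Path X Y U → _) := measurable_info t k
  have h1 : ∀ᵐ i ∂(M.preLaw γ t).map (info T t k),
      M.costToGo N γ k t i = M.value N γ k t i := by
    rw [ae_map_iff hi.aemeasurable (measurableSet_eq_fun hC.measurable hV.measurable)]
    filter_upwards [hg.ae_costToGo_eq_value M hT hopt htop ht] with ω hω using hω.1
  rw [← M.map_info_law hT γ k ht] at h1
  filter_upwards [ae_of_ae_map hi.aemeasurable h1] with ω hω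
  -- Sandwich: the infimum is at most the `dpCost` of the action used, which is at most the
  -- cost-to-go, which here equals the value and thus the infimum.
  refine ⟨hω, le_antisymm ?_ (iInf_le _ _)⟩
  rw [← (hg.costToGo_eq_value M hT ht _).2, ← hω]
  exact M.dpCost_value_le_costToGo hT γ k ht _

lemma IsMinimizer.payoff_le (hT : 1 ≤ T) {N : ℕ} {γ : Profile Y U T} {k : ι}
    {g : Strategy Y U T k} (hg : M.IsMinimizer N γ k (M.value N γ k) g) :
    M.payoff N (Function.update γ k g) ≤ M.payoff N γ := by
  rw [M.payoff_eq hT γ k g, M.payoff_eq_self hT γ k]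
  refine eint_mono _ fun i => ?_
  rw [(hg.costToGo_eq_value M hT (Nat.zero_le N) i).1]
  simpa using M.value_le_costToGo N γ k (γ k) 0 i

end Network

end DynamicProgramming

end DelayedSharing

end

/-! ### The main theorem. -/

theorem mainTheorem2 {ι : Type*} [Fintype ι] [DecidableEq ι]
    {X : ℕ → Type*} {Y U : ℕ → ι → Type*}
    [∀ t, MeasurableSpace (X t)] [∀ t j, MeasurableSpace (Y t j)]
    [∀ t j, MeasurableSpace (U t j)]
    [∀ t, StandardBorelSpace (X t)] [∀ t j, StandardBorelSpace (Y t j)]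
    [∀ t j, StandardBorelSpace (U t j)]
    [∀ t, Nonempty (X t)] [∀ t j, Nonempty (Y t j)] [∀ t j, Nonempty (U t j)]
    (M : Network ι X Y U) (T N : ℕ) (hT : 1 ≤ T) (γ : Profile Y U T) :
    (∀ k, ∀ g : Strategy Y U T k,
      (∀ t, M.posterior (Function.update γ k g) k t = M.posterior γ k t) ∧
      (∀ t ≤ N, ∀ᵐ i ∂(M.law N (Function.update γ k g)).map (info T t k),
        condDistrib (hidden T t k) (info T t k) (M.law N (Function.update γ k g)) i =
          M.posteriorKernel γ k t i) ∧
      (∀ t < N, ∀ᵐ p ∂(M.law N (Function.update γ k g)).map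
          (fun ω => (info T t k ω, ω.2.2 t k)),
        condDistrib (fun ω => (hidden T t k ω, ω.1 (t + 1), ω.2.1 (t + 1) k))
            (fun ω => (info T t k ω, ω.2.2 t k)) (M.law N (Function.update γ k g)) p =
          M.infoTransition γ k t p) ∧
      (∀ t ≤ N, IsCondExpectation (M.law N (Function.update γ k g)) (info T t k)
        (M.pathCost N t) (M.costToGo N (Function.update γ k g) k t)) ∧
      (∀ t < N, ∀ s, s + T = t + 1 → ∀ᵐ ω ∂M.law N (Function.update γ k g),
        ∀ᵐ h ∂M.posteriorKernel γ k t (info T t k ω), ∀ u, ∀ j, j ≠ k →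
          (afterAction γ k t (info T t k ω) h u).2.2 s j =
            (γ j s).1 (info T s j (afterAction γ k t (info T t k ω) h u)))) ∧
    (∀ t s, s + T = t + 1 → ∀ j, ∀ ω ω' : Path X Y U, common T t ω = common T t ω' →
      ω.2.1 s j = ω'.2.1 s j → info T s j ω = info T s j ω') ∧
    (∀ k, ∀ g : Strategy Y U T k, ∀ t ≤ N, ∀ i,
      M.value N (Function.update γ k g) k t i = M.value N γ k t i) ∧
    (∀ k, (∃ g : Strategy Y U T k, M.IsMinimizer N γ k (M.value N γ k) g) →
      M.IsDPSolution N γ k (M.value N γ k) ∧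
      (∀ i, M.value N γ k N i = ⨅ u : U N k,
        eint (M.posteriorKernel γ k N i) (M.actionCost γ k N i u)) ∧
      (∀ t < N, ∀ i, M.value N γ k t i = ⨅ u : U t k,
        eint (M.infoTransition γ k t (i, u)) (fun z => M.actionCost γ k t i u z.1 +
          M.value N γ k (t + 1) (nextInfo γ k t i z.1 u z.2.2)))) ∧
    (M.IsEquilibrium N γ → ∀ k, M.HasSelectors N γ k (M.value N γ k) →
      M.IsConditionallyMarkov γ k ∧
      (∃ g : Strategy Y U T k, M.IsSemiSeparated N γ k g ∧
        M.IsMinimizer N γ k (M.value N γ k) g ∧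
        (∀ t ≤ N, ∀ i, M.costToGo N (Function.update γ k g) k t i = M.value N γ k t i) ∧
        M.payoff N (Function.update γ k g) = M.payoff N γ) ∧
      (M.payoff N γ < ⊤ → ∀ t ≤ N, ∀ᵐ ω ∂M.law N γ,
        M.costToGo N γ k t (info T t k ω) = M.value N γ k t (info T t k ω) ∧
        M.dpCost N γ k (M.value N γ k) t (M.posterior γ k t (info T t k ω)) (info T t k ω)
            ((γ k t).1 (info T t k ω)) =
          ⨅ u : U t k, M.dpCost N γ k (M.value N γ k) t (M.posterior γ k t (info T t k ω))
            (info T t k ω) u)) ∧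
    (∀ k, ∀ W : ∀ t, Info Y U T t k → EReal, M.IsDPSolution N γ k W →
      ∀ g : Strategy Y U T k, ∀ t ≤ N, ∀ i,
        W t i ≤ M.costToGo N (Function.update γ k g) k t i) ∧
    (∀ W : ∀ k t, Info Y U T t k → EReal,
      (∀ k, M.IsDPSolution N γ k (W k) ∧ M.IsMinimizer N γ k (W k) (γ k)) →
        M.IsEquilibrium N γ ∧ ∀ k, ∀ t ≤ N, ∀ i,
          W k t i = M.costToGo N γ k t i ∧ W k t i = M.value N γ k t i) := by
  refine ⟨fun k g => ⟨M.posterior_update γ k g, fun t ht => M.condDistrib_hidden hT γ k g ht,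
      fun t ht => M.condDistrib_transition hT γ k g ht,
      fun t ht => M.isCondExpectation_costToGo hT γ k g ht,
      fun t ht s hs => M.ae_shared_action hT γ k g ht hs⟩,
    fun t s hs j ω ω' h hy => info_eq_of_common_eq hT hs h hy,
    fun k g t _ i => M.value_update N γ k g t i, ?_, ?_,
    fun k W hW g t ht i => hW.le_costToGo M hT g ht i, ?_⟩
  · rintro k ⟨g, hg⟩
    exact ⟨hg.isDPSolution M hT, hg.value_last M hT, fun t ht => hg.value_of_lt M hT ht⟩
  · intro heq k hsel
    obtain ⟨g, hsep, hmin⟩ := hsel.exists_isSemiSeparated M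
    -- The equilibrium property is needed against one deviation only, the semi-separated minimizer
    -- `g`.
    exact ⟨M.isConditionallyMarkov γ k,
      ⟨g, hsep, hmin, fun t ht i => (hmin.costToGo_eq_value M hT ht i).1,
        le_antisymm (hmin.payoff_le M hT) (heq k g)⟩,
      fun htop t ht => hmin.ae_isOptimal M hT (heq k g) htop ht⟩
  · intro W hW
    have hcost : ∀ k, ∀ t ≤ N, ∀ i, W k t i = M.costToGo N γ k t i := fun k t ht i => by
      simpa using (hW k).1.eq_costToGo M hT (hW k).2 ht i
    refine ⟨fun k g => ?_, fun k t ht i => ⟨hcost k t ht i, le_antisymm ?_ ?_⟩⟩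
    · rw [M.payoff_eq_self hT γ k, M.payoff_eq hT γ k g]
      refine eint_mono _ fun i => ?_
      -- The solution `W k` equals the cost-to-go of `γ` and bounds that of every deviation from
      -- below, for each initial information.
      rw [← hcost k 0 (Nat.zero_le N) i]
      exact (hW k).1.le_costToGo M hT g (Nat.zero_le N) i
    · rw [M.value_eq_iInf]
      exact le_iInf fun g => (hW k).1.le_costToGo M hT g ht i
    · rw [hcost k t ht i]
      simpa using M.value_le_costToGo N γ k (γ k) t i
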